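/- For $\sigma\in\mathbb R$ and $1\le p\le\infty$ let $L^p_\sigma(\mathbb R^n)$ be the space of all measurable $f$ with $(1+|x|^2)^{\sigma/2}f\in L^p(\mathbb R^n)$, and let $H^1_\sigma(\mathbb R^n)$ be the Hilbert space of all complex-valued $f\in L^2_\sigma(\mathbb R^n)$ whose weak gradient $\nabla f$ also belongs to $L^2_\sigma(\mathbb R^n)$, with norm $\|f\|^2_{H^1_\sigma}=\|f\|^2_{L^2_\sigma}+\|\nabla f\|^2_{L^2_\sigma}$. Let $n=2$ and $2<p\le\infty$, or $n=3$ and $3\le p\le\infty$. Let $\delta>\frac{n+1}{2}-\frac np$ (with $\frac n\infty=0$) and $\mu>2$. Let $\vec W:\mathbb R^n\to\mathbb R^n$ and $V:\mathbb R^n\to\mathbb R$ be such that $\vec W\in L^\infty_\delta(\mathbb R^n)$, the weak Jacobian satisfies $\nabla\vec W\in L^p_\delta(\mathbb R^n)$, $V\in L^p_{loc}(\mathbb R^n)$, and for some constants $c,R$ $$|V(x)|,\ |\vec W(x)|,\ |\nabla\vec W(x)|\le \frac{c}{|x|^{\mu}}\qquad\text{for almost all } |x|\ge R .$$ For real $k\neq0$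 let $$G_k^+(r)=\frac i4\Big(\frac{|k|}{2\pi r}\Big)^{\frac{n-2}2}H^{(1)}_{\frac{n-2}2}(|k|r),\qquad r>0,$$ where $H^{(1)}_\nu$ is the Hankel function of the first kind, so that $G_k^+(|x-y|)$ is the kernel of $(-\Delta-k^2-i0)^{-1}$, and let $$L_kf(x)=\int_{\mathbb R^n}G_k^+(|x-y|)\Big(i\nabla\cdot(\vec Wf)(y)+i\vec W(y)\cdot\nabla f(y)-\big(|\vec W(y)|^2+V(y)\big)f(y)\Big)\,dy ,$$ where $\nabla\cdot(\vec Wf)$ is the weak divergence. Then there is $\delta_0>\frac12$ such that for every real $k\ne0$ the operator $L_k$ is well defined on $H^1_{-\delta_0}(\mathbb R^n)$ (for every $f\in H^1_{-\delta_0}(\mathbb R^n)$ the weak divergence of $\vec Wf$ is a locally integrable function, and the integral converges absolutely for almost every $x$), and $L_k$ is a compact linear operator from $H^1_{-\delta_0}(\mathbb R^n)$ to itself. -/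

import Mathlib

open MeasureTheory Complex
open scoped ContDiff ENNReal

/-! ### Weak derivatives on `ℝⁿ` -/

/-- `v` is the weak partial derivative `∂_j u` on `ℝⁿ`, tested against real-valued `C_c^∞`
functions. -/
def HasWeakPartial {n : ℕ} {𝕜 : Type} [RCLike 𝕜] (j : Fin n)
    (u v : EuclideanSpace ℝ (Fin n) → 𝕜) : Prop :=
  LocallyIntegrable u ∧ LocallyIntegrable v ∧
    ∀ φ : EuclideanSpace ℝ (Fin n) → ℝ, ContDiff ℝ ∞ φ → HasCompactSupport φ →
      ∫ x, fderiv ℝ φ x (EuclideanSpace.single j 1) • u x = -∫ x, φ x • v x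

/-- `h` is the weak divergence of the complex vector field `F` on `ℝⁿ`. -/
def HasWeakDivergence {n : ℕ} (F : EuclideanSpace ℝ (Fin n) → EuclideanSpace ℂ (Fin n))
    (h : EuclideanSpace ℝ (Fin n) → ℂ) : Prop :=
  LocallyIntegrable F ∧ LocallyIntegrable h ∧
    ∀ φ : EuclideanSpace ℝ (Fin n) → ℝ, ContDiff ℝ ∞ φ → HasCompactSupport φ →
      ∫ x, ∑ j, fderiv ℝ φ x (EuclideanSpace.single j 1) • F x j = -∫ x, φ x • h x

/-! ### Weighted Lebesgue and Sobolev spaces -/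

/-- `f ∈ L^p_σ(ℝⁿ)`: the function `(1 + |x|²)^{σ/2} f` belongs to `L^p(ℝⁿ)`. -/
def MemWeightedLp {n : ℕ} {F : Type} [NormedAddCommGroup F] [NormedSpace ℝ F]
    (f : EuclideanSpace ℝ (Fin n) → F) (p : ℝ≥0∞) (σ : ℝ) : Prop :=
  MemLp (fun x => ((1 + ‖x‖ ^ 2) ^ (σ / 2) : ℝ) • f x) p volume

/-- `f ∈ L^p_loc(ℝⁿ)`. -/
def MemLocalLp {n : ℕ} {F : Type} [NormedAddCommGroup F]
    (f : EuclideanSpace ℝ (Fin n) → F) (p : ℝ≥0∞) : Prop :=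
  ∀ K : Set (EuclideanSpace ℝ (Fin n)), IsCompact K → MemLp f p (volume.restrict K)

/-- The measure `(1 + |x|²)^σ dx`; its `L²` space is `L²_σ(ℝⁿ)`, with
`‖f‖² = ∫ (1 + |x|²)^σ |f|² dx`. -/
noncomputable def weightedVolume (n : ℕ) (σ : ℝ) : Measure (EuclideanSpace ℝ (Fin n)) :=
  volume.withDensity fun x => ENNReal.ofReal ((1 + ‖x‖ ^ 2) ^ σ)

/-- An auxiliary fact: test functions times locally integrable functions are integrable. -/
theorem integrable_test_smul {n : ℕ} {ψ : EuclideanSpace ℝ (Fin n) → ℝ}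
    {u : EuclideanSpace ℝ (Fin n) → ℂ} (hψ : Continuous ψ) (hc : HasCompactSupport ψ)
    (hu : LocallyIntegrable u) : Integrable fun x => ψ x • u x :=
  hu.integrable_smul_left_of_hasCompactSupport hψ hc

theorem HasWeakPartial.congr {n : ℕ} {j : Fin n} {u v u' v' : EuclideanSpace ℝ (Fin n) → ℂ}
    (h : HasWeakPartial j u v) (hu : u =ᵐ[volume] u') (hv : v =ᵐ[volume] v') :
    HasWeakPartial j u' v' := by
  refine ⟨h.1.congr hu, h.2.1.congr hv, fun φ h1 h2 => ?_⟩
  have e1 : ∫ x, fderiv ℝ φ x (EuclideanSpace.single j 1) • u' x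
      = ∫ x, fderiv ℝ φ x (EuclideanSpace.single j 1) • u x :=
    integral_congr_ae (hu.mono fun x hx => by simp only [hx])
  have e2 : ∫ x, φ x • v' x = ∫ x, φ x • v x :=
    integral_congr_ae (hv.mono fun x hx => by simp only [hx])
  rw [e1, e2]
  exact h.2.2 φ h1 h2

theorem HasWeakPartial.add {n : ℕ} {j : Fin n} {u v u' v' : EuclideanSpace ℝ (Fin n) → ℂ}
    (h : HasWeakPartial j u v) (h' : HasWeakPartial j u' v') :
    HasWeakPartial j (u + u') (v + v') := by
  refine ⟨h.1.add h'.1, h.2.1.add h'.2.1, fun φ h1 h2 => ?_⟩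
  have c1 : Continuous fun x => fderiv ℝ φ x (EuclideanSpace.single j 1) :=
    (h1.continuous_fderiv (by simp)).clm_apply continuous_const
  have c2 : HasCompactSupport fun x => fderiv ℝ φ x (EuclideanSpace.single j 1) :=
    h2.fderiv_apply ℝ _
  simp only [Pi.add_apply, smul_add]
  rw [integral_add (integrable_test_smul c1 c2 h.1) (integrable_test_smul c1 c2 h'.1),
    integral_add (integrable_test_smul h1.continuous h2 h.2.1)
      (integrable_test_smul h1.continuous h2 h'.2.1), h.2.2 φ h1 h2, h'.2.2 φ h1 h2]
  ring

theorem HasWeakPartial.const_smul {n : ℕ} {j : Fin n} {u v : EuclideanSpace ℝ (Fin n) → ℂ}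
    (c : ℂ) (h : HasWeakPartial j u v) : HasWeakPartial j (c • u) (c • v) := by
  refine ⟨h.1.smul c, h.2.1.smul c, fun φ h1 h2 => ?_⟩
  simp only [Pi.smul_apply]
  simp_rw [smul_comm _ c]
  rw [integral_smul, integral_smul, h.2.2 φ h1 h2, smul_neg]

theorem HasWeakPartial.zero {n : ℕ} {j : Fin n} :
    HasWeakPartial j (0 : EuclideanSpace ℝ (Fin n) → ℂ) 0 :=
  ⟨locallyIntegrable_zero, locallyIntegrable_zero, fun φ _ _ => by simp⟩

theorem volume_ac_weightedVolume (n : ℕ) (σ : ℝ) :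
    (volume : Measure (EuclideanSpace ℝ (Fin n))) ≪ weightedVolume n σ := by
  refine withDensity_absolutelyContinuous' ?_ ?_
  · refine (Continuous.measurable ?_).ennreal_ofReal.aemeasurable
    exact Continuous.rpow_const (by fun_prop) fun x => Or.inl (by positivity)
  · refine Filter.Eventually.of_forall fun x => ?_
    have : 0 < (1 + ‖x‖ ^ 2) ^ σ := by positivity
    simpa using this

/-- The weighted Sobolev space `H¹_σ(ℝⁿ)` of complex functions: all pairs `(f, ∇f)` with
`f` and its weak gradient in `L²_σ(ℝⁿ)`, normed by
`‖f‖² = ‖f‖²_{L²_σ} + ‖∇f‖²_{L²_σ}`. -/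
noncomputable def WeightedH1 (n : ℕ) (σ : ℝ) :
    Submodule ℂ (WithLp 2 (Lp ℂ 2 (weightedVolume n σ) ×
      Lp (EuclideanSpace ℂ (Fin n)) 2 (weightedVolume n σ))) where
  carrier := {f | ∀ j : Fin n, HasWeakPartial j (fun x => f.fst x) (fun x => f.snd x j)}
  zero_mem' := fun j => by
    have hac := volume_ac_weightedVolume n σ
    refine HasWeakPartial.zero.congr ?_ ?_
    · filter_upwards [hac.ae_le (Lp.coeFn_zero ℂ 2 (weightedVolume n σ))] with x hx
      exact hx.symm
    · filter_upwards [hac.ae_le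
        (Lp.coeFn_zero (EuclideanSpace ℂ (Fin n)) 2 (weightedVolume n σ))] with x hx
      exact (congrArg (fun v : EuclideanSpace ℂ (Fin n) => v j) hx).symm
  add_mem' := fun {f g} hf hg j => by
    have hac := volume_ac_weightedVolume n σ
    refine ((hf j).add (hg j)).congr ?_ ?_
    · filter_upwards [hac.ae_le (Lp.coeFn_add f.fst g.fst)] with x hx
      exact hx.symm
    · filter_upwards [hac.ae_le (Lp.coeFn_add f.snd g.snd)] with x hx
      exact (congrArg (fun v : EuclideanSpace ℂ (Fin n) => v j) hx).symm
  smul_mem' := fun c f hf j => by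
    have hac := volume_ac_weightedVolume n σ
    refine ((hf j).const_smul c).congr ?_ ?_
    · filter_upwards [hac.ae_le (Lp.coeFn_smul c f.fst)] with x hx
      exact hx.symm
    · filter_upwards [hac.ae_le (Lp.coeFn_smul c f.snd)] with x hx
      exact (congrArg (fun v : EuclideanSpace ℂ (Fin n) => v j) hx).symm

/-- The underlying function of an element of `H¹_σ(ℝⁿ)`. -/
noncomputable def h1Fun {n : ℕ} {σ : ℝ} (f : WeightedH1 n σ) :
    EuclideanSpace ℝ (Fin n) → ℂ :=
  fun x => f.1.fst x

/-- The weak gradient of an element of `H¹_σ(ℝⁿ)`. -/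
noncomputable def h1Grad {n : ℕ} {σ : ℝ} (f : WeightedH1 n σ) :
    EuclideanSpace ℝ (Fin n) → EuclideanSpace ℂ (Fin n) :=
  fun x => f.1.snd x

/-! ### The outgoing fundamental solution -/

/-- The Bessel function `J_ν(z)` for `z > 0`, by its power series. -/
noncomputable def besselJ (ν z : ℝ) : ℝ :=
  ∑' m : ℕ, (-1) ^ m / ((m.factorial : ℝ) * Real.Gamma (m + ν + 1)) * (z / 2) ^ (2 * m + ν)

/-- The Bessel function of the second kind `Y_ν(z)` for `z > 0`, for `ν = 0` (Neumann's series)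
and for `ν ∉ ℤ`. -/
noncomputable def besselY (ν z : ℝ) : ℝ :=
  if ν = 0 then
    2 / Real.pi * (Real.log (z / 2) + Real.eulerMascheroniConstant) * besselJ 0 z
      + 2 / Real.pi * ∑' m : ℕ,
          (-1) ^ (m + 1) * (harmonic m : ℝ) / (m.factorial : ℝ) ^ 2 * (z ^ 2 / 4) ^ m
  else
    (besselJ ν z * Real.cos (ν * Real.pi) - besselJ (-ν) z) / Real.sin (ν * Real.pi)

/-- The Hankel function of the first kind `H^{(1)}_ν(z) = J_ν(z) + i Y_ν(z)` for `z > 0`. -/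
noncomputable def hankelOne (ν z : ℝ) : ℂ :=
  (besselJ ν z : ℂ) + I * (besselY ν z : ℂ)

/-- `G_k^+(r)`, the kernel of `(-Δ - k² - i0)⁻¹` in dimension `n = 2, 3`. It depends on `k`
through `k²` only, which is why `|k|` appears. -/
noncomputable def outgoingGreen (n : ℕ) (k r : ℝ) : ℂ :=
  I / 4 * (((|k| / (2 * Real.pi * r)) ^ (((n : ℝ) - 2) / 2) : ℝ) : ℂ)
    * hankelOne (((n : ℝ) - 2) / 2) (|k| * r)

/-! ### The Lippmann–Schwinger operator -/

/-- The vector field `W f` for a real vector field `W` and a complex function `f`. -/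
noncomputable def vectorTimes {n : ℕ} (W : EuclideanSpace ℝ (Fin n) → EuclideanSpace ℝ (Fin n))
    (f : EuclideanSpace ℝ (Fin n) → ℂ) :
    EuclideanSpace ℝ (Fin n) → EuclideanSpace ℂ (Fin n) :=
  fun x => WithLp.toLp 2 fun j => (W x j : ℂ) * f x

/-- `u = L_k f`, where
`L_k f(x) = ∫ G_k^+(|x-y|) (i ∇·(W f) + i W·∇f - (|W|² + V) f)(y) dy`.
Here `h` is the weak divergence `∇·(W f)`, which is unique up to null sets, and the integral
converges absolutely for almost every `x`. -/
def IsLippmannSchwingerImage {n : ℕ} {σ : ℝ} (k : ℝ)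
    (W : EuclideanSpace ℝ (Fin n) → EuclideanSpace ℝ (Fin n))
    (V : EuclideanSpace ℝ (Fin n) → ℝ) (f u : WeightedH1 n σ) : Prop :=
  ∃ h : EuclideanSpace ℝ (Fin n) → ℂ, HasWeakDivergence (vectorTimes W (h1Fun f)) h ∧
    ∀ᵐ x : EuclideanSpace ℝ (Fin n),
      Integrable (fun y => outgoingGreen n k ‖x - y‖ *
        (I * h y + I * ∑ j, (W y j : ℂ) * h1Grad f y j
          - ((‖W y‖ ^ 2 + V y : ℝ) : ℂ) * h1Fun f y)) ∧
      h1Fun u x = ∫ y, outgoingGreen n k ‖x - y‖ *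
        (I * h y + I * ∑ j, (W y j : ℂ) * h1Grad f y j
          - ((‖W y‖ ^ 2 + V y : ℝ) : ℂ) * h1Fun f y)

/-!
The outgoing fundamental solution `G_k` and its derivative are `O(r^{-(n-1)} + r^{-(n-1)/2})`; for
`n = 2` the decay of the Bessel functions follows from the boundedness of the energy of
`v = √z w`, where `w` solves Bessel's equation of order zero. Near the diagonal the kernels
`G_k(x - y)` and `∇G_k(x - y)` have small `L²` norm by Schur's test, and away from the diagonal they
are Hilbert–Schmidt once weighted by `⟨x⟩^{-δ}` and `⟨y⟩^{-δ}` with `δ > 1`. Convolution with `G_k`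
is therefore compact from `L²_δ` to `H¹_{-δ}`.

It remains to see that `f ↦ i ∇·(W f) + i W·∇f - (|W|² + V) f` is bounded from `H¹_{-δ}` to `L²_δ`,
where `2 δ = μ`: outside a ball its coefficients are `O(⟨x⟩^{-2δ})`, and inside the ball those in
`L^p` multiply `H¹` into `L²` by the Sobolev inequality.
-/

/-! ### Integral operators on L² -/

section KernelOperators

open scoped NNReal
open Filter

variable {𝕜 X Y : Type*} [RCLike 𝕜] [MeasurableSpace X] [MeasurableSpace Y]
  {μ : Measure X} {ν : Measure Y}

theorem eLpNorm_two_sq {E : Type*} [ENorm E] (f : X → E) :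
    eLpNorm f 2 μ ^ 2 = ∫⁻ x, ‖f x‖ₑ ^ 2 ∂μ := by
  simpa using eLpNorm_nnreal_pow_eq_lintegral (μ := μ) (f := f) (p := 2) two_ne_zero

theorem eLpNorm_two_le_of_lintegral_sq_le {E : Type*} [ENorm E] {f : X → E} {B : ℝ≥0∞}
    (h : ∫⁻ x, ‖f x‖ₑ ^ 2 ∂μ ≤ B ^ 2) : eLpNorm f 2 μ ≤ B := by
  rwa [← ENNReal.pow_le_pow_left_iff two_ne_zero, eLpNorm_two_sq]

theorem eLpNorm_two_lt_top_iff {E : Type*} [ENorm E] {f : X → E} :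
    eLpNorm f 2 μ < ⊤ ↔ ∫⁻ x, ‖f x‖ₑ ^ 2 ∂μ < ⊤ := by
  rw [← eLpNorm_two_sq, ENNReal.pow_lt_top_iff]
  simp

theorem ae_lt_top_of_eLpNorm_two_lt_top {f : X → ℝ≥0∞} (hf : Measurable f)
    (h : eLpNorm f 2 μ < ⊤) : ∀ᵐ x ∂μ, f x < ⊤ := by
  filter_upwards [ae_lt_top (hf.pow_const 2) (eLpNorm_two_lt_top_iff.1 h).ne] with x hx
  simpa using hx

theorem lintegral_mul_sq_le {f g : Y → ℝ≥0∞} (hf : AEMeasurable f ν) (hg : AEMeasurable g ν) :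
    (∫⁻ y, f y * g y ∂ν) ^ 2 ≤ (∫⁻ y, f y ^ 2 ∂ν) * ∫⁻ y, g y ^ 2 ∂ν := by
  have holder := ENNReal.lintegral_mul_le_Lp_mul_Lq ν Real.HolderConjugate.two_two hf hg
  refine (pow_le_pow_left' holder 2).trans_eq ?_
  rw [mul_pow, ← ENNReal.rpow_natCast, ← ENNReal.rpow_mul, ← ENNReal.rpow_natCast,
    ← ENNReal.rpow_mul]
  norm_num

/-- `k` is the kernel of an absolutely convergent integral operator `L²(ν) → L²(μ)`: already the
operator with kernel `|k|` is bounded, with norm at most `C`. -/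
structure IsL2Kernel (μ : Measure X) (ν : Measure Y) (k : X → Y → 𝕜) (C : ℝ≥0) : Prop where
  measurable : Measurable (Function.uncurry k)
  eLpNorm_lintegral_le : ∀ g : Y → ℝ≥0∞, Measurable g →
    eLpNorm (fun x => ∫⁻ y, ‖k x y‖ₑ * g y ∂ν) 2 μ ≤ C * eLpNorm g 2 ν

theorem measurable_lintegral_enorm_mul [SFinite ν] {k : X → Y → 𝕜}
    (hk : Measurable (Function.uncurry k)) {g : Y → ℝ≥0∞} (hg : Measurable g) :
    Measurable fun x => ∫⁻ y, ‖k x y‖ₑ * g y ∂ν :=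
  Measurable.lintegral_prod_right' (f := fun p : X × Y => ‖k p.1 p.2‖ₑ * g p.2)
    (hk.enorm.mul (hg.comp measurable_snd))

theorem measurable_lintegral_enorm_sq [SFinite ν] {k : X → Y → 𝕜}
    (hk : Measurable (Function.uncurry k)) : Measurable fun x => ∫⁻ y, ‖k x y‖ₑ ^ 2 ∂ν :=
  Measurable.lintegral_prod_right' (f := fun p : X × Y => ‖k p.1 p.2‖ₑ ^ 2)
    (hk.enorm.pow_const 2)

namespace IsL2Kernel

variable {k k' : X → Y → 𝕜} {C C' : ℝ≥0}

theorem add [SFinite ν] (h : IsL2Kernel μ ν k C) (h' : IsL2Kernel μ ν k' C') :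
    IsL2Kernel μ ν (k + k') (C + C') := by
  refine ⟨h.measurable.add h'.measurable, fun g hg => ?_⟩
  have triangle (x : X) : ∫⁻ y, ‖(k + k') x y‖ₑ * g y ∂ν
      ≤ (∫⁻ y, ‖k x y‖ₑ * g y ∂ν) + ∫⁻ y, ‖k' x y‖ₑ * g y ∂ν := by
    have hkx : Measurable fun y => ‖k x y‖ₑ * g y := h.measurable.of_uncurry_left.enorm.mul hg
    rw [← lintegral_add_left hkx]
    refine lintegral_mono fun y => ?_
    rw [← add_mul]
    exact mul_le_mul_left (enorm_add_le _ _) _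
  calc eLpNorm (fun x => ∫⁻ y, ‖(k + k') x y‖ₑ * g y ∂ν) 2 μ
      ≤ eLpNorm ((fun x => ∫⁻ y, ‖k x y‖ₑ * g y ∂ν) + fun x => ∫⁻ y, ‖k' x y‖ₑ * g y ∂ν) 2 μ :=
        eLpNorm_mono_enorm fun x => by simpa using triangle x
    _ ≤ eLpNorm (fun x => ∫⁻ y, ‖k x y‖ₑ * g y ∂ν) 2 μ
        + eLpNorm (fun x => ∫⁻ y, ‖k' x y‖ₑ * g y ∂ν) 2 μ :=
        eLpNorm_add_le (measurable_lintegral_enorm_mul h.measurable hg).aestronglyMeasurable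
          (measurable_lintegral_enorm_mul h'.measurable hg).aestronglyMeasurable one_le_two
    _ ≤ C * eLpNorm g 2 ν + C' * eLpNorm g 2 ν :=
        add_le_add (h.eLpNorm_lintegral_le g hg) (h'.eLpNorm_lintegral_le g hg)
    _ = (C + C' : ℝ≥0) * eLpNorm g 2 ν := by rw [ENNReal.coe_add, add_mul]

theorem eLpNorm_lintegral_enorm_lt_top (h : IsL2Kernel μ ν k C) (g : Lp 𝕜 2 ν) :
    eLpNorm (fun x => ∫⁻ y, ‖k x y‖ₑ * ‖g y‖ₑ ∂ν) 2 μ < ⊤ := by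
  refine (h.eLpNorm_lintegral_le _ (Lp.stronglyMeasurable g).measurable.enorm).trans_lt ?_
  rw [eLpNorm_enorm]
  exact ENNReal.mul_lt_top ENNReal.coe_lt_top (Lp.eLpNorm_lt_top g)

theorem ae_integrable [SFinite ν] (h : IsL2Kernel μ ν k C) (g : Lp 𝕜 2 ν) :
    ∀ᵐ x ∂μ, Integrable (fun y => k x y * g y) ν := by
  have hg : Measurable (g : Y → 𝕜) := (Lp.stronglyMeasurable g).measurable
  filter_upwards [ae_lt_top_of_eLpNorm_two_lt_top
    (measurable_lintegral_enorm_mul h.measurable hg.enorm)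
    (h.eLpNorm_lintegral_enorm_lt_top g)] with x hx
  refine ⟨(h.measurable.of_uncurry_left.mul hg).aestronglyMeasurable, ?_⟩
  simpa only [HasFiniteIntegral, enorm_mul] using hx

theorem eLpNorm_integral_le (h : IsL2Kernel μ ν k C) (g : Lp 𝕜 2 ν) :
    eLpNorm (fun x => ∫ y, k x y * g y ∂ν) 2 μ ≤ C * eLpNorm g 2 ν := by
  rw [← eLpNorm_enorm g]
  refine (eLpNorm_mono_enorm fun x => ?_).trans
    (h.eLpNorm_lintegral_le _ (Lp.stronglyMeasurable g).measurable.enorm)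
  simpa only [enorm_mul, enorm_eq_self] using
    enorm_integral_le_lintegral_enorm (μ := ν) fun y => k x y * g y

theorem memLp_integral [SFinite ν] (h : IsL2Kernel μ ν k C) (g : Lp 𝕜 2 ν) :
    MemLp (fun x => ∫ y, k x y * g y ∂ν) 2 μ := by
  have hg : Measurable (g : Y → 𝕜) := (Lp.stronglyMeasurable g).measurable
  refine ⟨?_, (h.eLpNorm_integral_le g).trans_lt
    (ENNReal.mul_lt_top ENNReal.coe_lt_top (Lp.eLpNorm_lt_top g))⟩
  exact (StronglyMeasurable.integral_prod_right' (f := fun p : X × Y => k p.1 p.2 * g p.2)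
    (h.measurable.mul (hg.comp measurable_snd)).stronglyMeasurable).aestronglyMeasurable

/-- The integral operator `g ↦ ∫ k(·, y) g(y) dν(y)` from `L²(ν)` to `L²(μ)`. -/
noncomputable def toCLM [SFinite ν] (h : IsL2Kernel μ ν k C) : Lp 𝕜 2 ν →L[𝕜] Lp 𝕜 2 μ :=
  LinearMap.mkContinuous
    { toFun := fun g => (h.memLp_integral g).toLp _
      map_add' := fun g g' => by
        rw [← MemLp.toLp_add]
        refine MemLp.toLp_congr _ _ ?_
        filter_upwards [h.ae_integrable g, h.ae_integrable g'] with x hx hx'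
        rw [Pi.add_apply, ← integral_add hx hx']
        refine integral_congr_ae ?_
        filter_upwards [Lp.coeFn_add g g'] with y hy
        rw [hy, Pi.add_apply, mul_add]
      map_smul' := fun c g => by
        rw [RingHom.id_apply, ← MemLp.toLp_const_smul]
        refine MemLp.toLp_congr _ _ (Eventually.of_forall fun x => ?_)
        rw [Pi.smul_apply, ← integral_smul]
        refine integral_congr_ae ?_
        filter_upwards [Lp.coeFn_smul c g] with y hy
        rw [hy, Pi.smul_apply, mul_smul_comm] }
    C fun g => by
      rw [LinearMap.coe_mk, AddHom.coe_mk, Lp.norm_toLp, Lp.norm_def]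
      simpa using ENNReal.toReal_mono
        (ENNReal.mul_ne_top ENNReal.coe_ne_top (Lp.eLpNorm_ne_top g)) (h.eLpNorm_integral_le g)

theorem coeFn_toCLM [SFinite ν] (h : IsL2Kernel μ ν k C) (g : Lp 𝕜 2 ν) :
    h.toCLM g =ᵐ[μ] fun x => ∫ y, k x y * g y ∂ν :=
  MemLp.coeFn_toLp (h.memLp_integral g)

theorem norm_toCLM_le [SFinite ν] (h : IsL2Kernel μ ν k C) : ‖h.toCLM‖ ≤ C :=
  LinearMap.mkContinuous_norm_le _ C.2 _

theorem toCLM_add [SFinite ν] {D : ℝ≥0} (h : IsL2Kernel μ ν k C) (h' : IsL2Kernel μ ν k' C')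
    (hs : IsL2Kernel μ ν (k + k') D) : hs.toCLM = h.toCLM + h'.toCLM := by
  ext1 g
  refine Lp.ext ((hs.coeFn_toCLM g).trans (EventuallyEq.trans ?_ (Lp.coeFn_add _ _).symm))
  filter_upwards [h.coeFn_toCLM g, h'.coeFn_toCLM g, h.ae_integrable g, h'.ae_integrable g]
    with x e e' i i'
  simp only [Pi.add_apply, add_mul]
  exact (integral_add i i').trans (congrArg₂ (· + ·) e e').symm

theorem of_schur [SFinite ν] [SFinite μ] (hk : Measurable (Function.uncurry k))
    (hrow : ∀ x, ∫⁻ y, ‖k x y‖ₑ ∂ν ≤ C) (hcol : ∀ y, ∫⁻ x, ‖k x y‖ₑ ∂μ ≤ C) :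
    IsL2Kernel μ ν k C := by
  refine ⟨hk, fun g hg => eLpNorm_two_le_of_lintegral_sq_le ?_⟩
  have sqrt_sq (a : ℝ≥0∞) : (a ^ (1 / 2 : ℝ)) ^ 2 = a := by
    rw [← ENNReal.rpow_natCast, ← ENNReal.rpow_mul]; norm_num
  -- Cauchy–Schwarz for `|k| g = |k|^{1/2} · |k|^{1/2} g`.
  have row_sq_le (x : X) :
      (∫⁻ y, ‖k x y‖ₑ * g y ∂ν) ^ 2 ≤ C * ∫⁻ y, ‖k x y‖ₑ * g y ^ 2 ∂ν := by
    have hkx : Measurable fun y => ‖k x y‖ₑ ^ (1 / 2 : ℝ) :=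
      hk.of_uncurry_left.enorm.pow_const _
    have cauchy := lintegral_mul_sq_le (ν := ν) hkx.aemeasurable (hkx.mul hg).aemeasurable
    simp only [Pi.mul_apply, mul_pow, ← mul_assoc, ← sq, sqrt_sq] at cauchy
    exact cauchy.trans (mul_le_mul_left (hrow x) _)
  calc ∫⁻ x, (∫⁻ y, ‖k x y‖ₑ * g y ∂ν) ^ 2 ∂μ
      ≤ ∫⁻ x, C * ∫⁻ y, ‖k x y‖ₑ * g y ^ 2 ∂ν ∂μ := lintegral_mono row_sq_le
    _ = C * ∫⁻ y, ∫⁻ x, ‖k x y‖ₑ * g y ^ 2 ∂μ ∂ν := by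
        rw [lintegral_const_mul' _ _ ENNReal.coe_ne_top, lintegral_lintegral_swap]
        exact (hk.enorm.mul ((hg.comp measurable_snd).pow_const 2)).aemeasurable
    _ ≤ C * ∫⁻ y, C * g y ^ 2 ∂ν := by
        gcongr with y
        have hky : Measurable fun x => ‖k x y‖ₑ := hk.of_uncurry_right.enorm
        rw [lintegral_mul_const _ hky]
        exact mul_le_mul_left (hcol y) _
    _ = (C * eLpNorm g 2 ν) ^ 2 := by
        rw [lintegral_const_mul' _ _ ENNReal.coe_ne_top, mul_pow, eLpNorm_two_sq]
        simp only [enorm_eq_self]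
        ring

theorem of_lintegral_sq_le [SFinite ν] (hk : Measurable (Function.uncurry k))
    (hC : ∫⁻ x, ∫⁻ y, ‖k x y‖ₑ ^ 2 ∂ν ∂μ ≤ (C : ℝ≥0∞) ^ 2) : IsL2Kernel μ ν k C := by
  refine ⟨hk, fun g hg => eLpNorm_two_le_of_lintegral_sq_le ?_⟩
  calc ∫⁻ x, (∫⁻ y, ‖k x y‖ₑ * g y ∂ν) ^ 2 ∂μ
      ≤ ∫⁻ x, (∫⁻ y, ‖k x y‖ₑ ^ 2 ∂ν) * ∫⁻ y, g y ^ 2 ∂ν ∂μ :=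
        lintegral_mono fun x => lintegral_mul_sq_le
          hk.of_uncurry_left.enorm.aemeasurable hg.aemeasurable
    _ = (∫⁻ x, ∫⁻ y, ‖k x y‖ₑ ^ 2 ∂ν ∂μ) * ∫⁻ y, g y ^ 2 ∂ν :=
        lintegral_mul_const _ (measurable_lintegral_enorm_sq hk)
    _ ≤ (C : ℝ≥0∞) ^ 2 * ∫⁻ y, g y ^ 2 ∂ν := mul_le_mul_left hC _
    _ = (C * eLpNorm g 2 ν) ^ 2 := by
        rw [mul_pow, eLpNorm_two_sq]
        simp only [enorm_eq_self]

theorem exists_of_lintegral_sq_lt_top [SFinite ν] (hk : Measurable (Function.uncurry k))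
    (hfin : ∫⁻ x, ∫⁻ y, ‖k x y‖ₑ ^ 2 ∂ν ∂μ < ⊤) : ∃ C, IsL2Kernel μ ν k C := by
  set I := ∫⁻ x, ∫⁻ y, ‖k x y‖ₑ ^ 2 ∂ν ∂μ
  have hC : (I ^ (1 / 2 : ℝ)).toNNReal = I ^ (1 / 2 : ℝ) :=
    ENNReal.coe_toNNReal (ENNReal.rpow_ne_top_of_nonneg (by norm_num) hfin.ne)
  refine ⟨_, of_lintegral_sq_le hk (C := (I ^ (1 / 2 : ℝ)).toNNReal) ?_⟩
  rw [hC, ← ENNReal.rpow_natCast, ← ENNReal.rpow_mul]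
  norm_num [I]

end IsL2Kernel

theorem measurable_of_edist {M : Type*} [PseudoEMetricSpace M] [SecondCountableTopology M]
    [MeasurableSpace M] [BorelSpace M] {f : X → M} (h : ∀ c, Measurable fun x => edist (f x) c) :
    Measurable f := by
  refine measurable_of_isOpen fun U hU => ?_
  choose! r hr0 hr using fun c (hc : c ∈ U) => EMetric.isOpen_iff.1 hU c hc
  obtain ⟨T, hT_countable, hT⟩ := TopologicalSpace.isOpen_iUnion_countable
    (fun c : U => Metric.eball (c : M) (r c)) fun c => Metric.isOpen_eball
  have hU_eq : U = ⋃ c ∈ T, Metric.eball (c : M) (r c) := by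
    rw [hT]
    ext z
    simp only [Set.mem_iUnion]
    exact ⟨fun hz => ⟨⟨z, hz⟩, Metric.mem_eball_self (hr0 z hz)⟩, fun ⟨c, hc⟩ => hr c c.2 hc⟩
  rw [hU_eq, Set.preimage_iUnion₂]
  exact MeasurableSet.biUnion hT_countable fun c _ => measurableSet_lt (h c) measurable_const

section LpFunctionals

variable {H : Type*} [NormedAddCommGroup H] [NormedSpace 𝕜 H] {p : ℝ≥0∞} [Fact (1 ≤ p)]

/-- The operator `g ↦ (x ↦ Φ x g)` attached to a family `Φ` of continuous linear functionals on
`H` whose norms are `p`-integrable, as a continuous linear function of `Φ`. -/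
noncomputable def lpFunctionals (p : ℝ≥0∞) [Fact (1 ≤ p)] (μ : Measure X) :
    Lp (H →L[𝕜] 𝕜) p μ →L[𝕜] H →L[𝕜] Lp 𝕜 p μ :=
  LinearMap.mkContinuous₂
    (LinearMap.mk₂ 𝕜 (fun (Φ : Lp (H →L[𝕜] 𝕜) p μ) (g : H) =>
        (ContinuousLinearMap.apply 𝕜 𝕜 g).compLp Φ)
      (fun Φ Ψ g => ((ContinuousLinearMap.apply 𝕜 𝕜 g).compLpL p μ).map_add Φ Ψ)
      (fun c Φ g => ((ContinuousLinearMap.apply 𝕜 𝕜 g).compLpL p μ).map_smul c Φ)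
      (fun Φ g g' => by rw [map_add, ContinuousLinearMap.add_compLp])
      (fun c Φ g => by rw [map_smul, ContinuousLinearMap.smul_compLp]))
    1 fun Φ g => by
      rw [one_mul, mul_comm]
      refine (ContinuousLinearMap.norm_compLp_le _ _).trans ?_
      gcongr
      refine ContinuousLinearMap.opNorm_le_bound _ (norm_nonneg _) fun φ => ?_
      rw [ContinuousLinearMap.apply_apply, mul_comm]
      exact φ.le_opNorm g

theorem coeFn_lpFunctionals (Φ : Lp (H →L[𝕜] 𝕜) p μ) (g : H) :
    lpFunctionals p μ Φ g =ᵐ[μ] fun x => Φ x g :=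
  ContinuousLinearMap.coeFn_compLp (ContinuousLinearMap.apply 𝕜 𝕜 g) Φ

theorem lpFunctionals_indicatorConstLp {s : Set X} (hs : MeasurableSet s) (hμs : μ s ≠ ⊤)
    (φ : H →L[𝕜] 𝕜) : lpFunctionals p μ (indicatorConstLp p hs hμs φ)
      = (ContinuousLinearMap.toSpanSingleton 𝕜 (indicatorConstLp p hs hμs (1 : 𝕜))).comp φ := by
  ext1 g
  refine Lp.ext ((coeFn_lpFunctionals _ g).trans ?_)
  rw [ContinuousLinearMap.comp_apply, ContinuousLinearMap.toSpanSingleton_apply]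
  refine EventuallyEq.trans ?_ (Lp.coeFn_smul _ _).symm
  filter_upwards [indicatorConstLp_coeFn (p := p) (hs := hs) (hμs := hμs) (c := φ),
    indicatorConstLp_coeFn (p := p) (hs := hs) (hμs := hμs) (c := (1 : 𝕜))] with x hφ h_one
  rw [hφ, Pi.smul_apply, h_one]
  by_cases hx : x ∈ s <;> simp [hx]

theorem isCompactOperator_lpFunctionals (hp : p ≠ ⊤) (Φ : Lp (H →L[𝕜] 𝕜) p μ) :
    IsCompactOperator (lpFunctionals p μ Φ) := by
  refine Lp.induction hp (motive := fun Φ => IsCompactOperator (lpFunctionals p μ Φ)) ?_ ?_ ?_ Φ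
  · intro φ s hs hμs
    have hφ : IsCompactOperator φ := isCompactOperator_of_locallyCompactSpace_dom φ
    rw [Lp.simpleFunc.coe_indicatorConst, lpFunctionals_indicatorConstLp]
    exact hφ.clm_comp (ContinuousLinearMap.toSpanSingleton 𝕜 (indicatorConstLp p hs hμs.ne 1))
  · intro f g hf hg _ hf_compact hg_compact
    rw [map_add]
    exact hf_compact.add hg_compact
  · have h_closed : IsClosed {T : H →L[𝕜] Lp 𝕜 p μ | IsCompactOperator T} :=
      isClosed_setOfPred_isCompactOperator
    exact h_closed.preimage (lpFunctionals p μ).continuous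

end LpFunctionals

section KernelRows

open scoped Classical in
/-- The class of `f` in `L²(ν)`, with the junk value `0` if `f ∉ L²(ν)`. -/
noncomputable def toL2OrZero (ν : Measure Y) (f : Y → 𝕜) : Lp 𝕜 2 ν :=
  if hf : MemLp f 2 ν then hf.toLp f else 0

section Function

variable {f : Y → 𝕜}

theorem toL2OrZero_of_memLp (hf : MemLp f 2 ν) : toL2OrZero ν f = hf.toLp f :=
  dif_pos hf

theorem toL2OrZero_of_not_memLp (hf : ¬MemLp f 2 ν) : toL2OrZero ν f = 0 :=
  dif_neg hf

theorem enorm_toL2OrZero_sq_le : ‖toL2OrZero ν f‖ₑ ^ 2 ≤ ∫⁻ y, ‖f y‖ₑ ^ 2 ∂ν := by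
  by_cases hf : MemLp f 2 ν
  · rw [toL2OrZero_of_memLp hf, Lp.enorm_toLp, eLpNorm_two_sq]
  · simp [toL2OrZero_of_not_memLp hf]

theorem edist_toL2OrZero_of_memLp (hf : MemLp f 2 ν) (c : Lp 𝕜 2 ν) :
    edist (toL2OrZero ν f) c = (∫⁻ y, ‖f y - c y‖ₑ ^ 2 ∂ν) ^ (1 / 2 : ℝ) := by
  have h_sub : (fun y => f y - c y) =ᵐ[ν] ⇑(hf.toLp f) - ⇑c := by
    filter_upwards [hf.coeFn_toLp] with y hy
    rw [Pi.sub_apply, hy]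
  rw [toL2OrZero_of_memLp hf, Lp.edist_def, ← eLpNorm_congr_ae h_sub, ← eLpNorm_two_sq,
    ← ENNReal.rpow_natCast, ← ENNReal.rpow_mul]
  norm_num

end Function

variable {k : X → Y → 𝕜}

theorem memLp_row_iff (hk : Measurable (Function.uncurry k)) (x : X) :
    MemLp (k x) 2 ν ↔ ∫⁻ y, ‖k x y‖ₑ ^ 2 ∂ν < ⊤ := by
  rw [← eLpNorm_two_lt_top_iff]
  exact and_iff_right hk.of_uncurry_left.aestronglyMeasurable

theorem measurable_toL2OrZero_row [SigmaFinite ν] [MeasurableSpace.CountablyGenerated Y]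
    [MeasurableSpace (Lp 𝕜 2 ν)] [BorelSpace (Lp 𝕜 2 ν)]
    (hk : Measurable (Function.uncurry k)) : Measurable fun x => toL2OrZero ν (k x) := by
  classical
  have : Fact ((2 : ℝ≥0∞) ≠ ⊤) := ⟨ENNReal.ofNat_ne_top⟩
  refine measurable_of_edist fun c => ?_
  have hc : Measurable (c : Y → 𝕜) := (Lp.stronglyMeasurable c).measurable
  have h_edist : (fun x => edist (toL2OrZero ν (k x)) c) = fun x => if MemLp (k x) 2 ν then
      (∫⁻ y, ‖k x y - c y‖ₑ ^ 2 ∂ν) ^ (1 / 2 : ℝ) else edist 0 c := by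
    funext x
    split_ifs with hx
    · exact edist_toL2OrZero_of_memLp hx c
    · rw [toL2OrZero_of_not_memLp hx]
  have h_set : MeasurableSet {x | MemLp (k x) 2 ν} := by
    simp only [memLp_row_iff hk]
    exact measurableSet_lt (measurable_lintegral_enorm_sq hk) measurable_const
  rw [h_edist]
  refine Measurable.ite h_set (Measurable.pow_const ?_ _) measurable_const
  exact measurable_lintegral_enorm_sq (k := fun x y => k x y - c y)
    (hk.sub (hc.comp measurable_snd))

theorem memLp_innerSL_toL2OrZero_row [SigmaFinite ν] [MeasurableSpace.CountablyGenerated Y]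
    (hk : Measurable (Function.uncurry k)) (hfin : ∫⁻ x, ∫⁻ y, ‖k x y‖ₑ ^ 2 ∂ν ∂μ < ⊤) :
    MemLp (fun x => innerSL 𝕜 (toL2OrZero ν (k x))) 2 μ := by
  have : Fact ((2 : ℝ≥0∞) ≠ ⊤) := ⟨ENNReal.ofNat_ne_top⟩
  borelize ↥(Lp 𝕜 2 ν)
  refine ⟨(innerSL 𝕜 (E := Lp 𝕜 2 ν)).continuous.comp_aestronglyMeasurable
    (measurable_toL2OrZero_row hk).stronglyMeasurable.aestronglyMeasurable, ?_⟩
  refine eLpNorm_two_lt_top_iff.2 (lt_of_le_of_lt (lintegral_mono fun x => ?_) hfin)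
  rw [← ofReal_norm, innerSL_apply_norm, ofReal_norm]
  exact enorm_toL2OrZero_sq_le

end KernelRows

namespace IsL2Kernel

variable {k : X → Y → 𝕜} {C : ℝ≥0} [SigmaFinite ν] [MeasurableSpace.CountablyGenerated Y]

/- Every row of `k` acts as the inner product with its conjugate, so the operator comes from a
square integrable family of functionals; it is a limit of those with simple families, which have
finite rank. -/
theorem isCompactOperator_of_lintegral_sq_lt_top (h : IsL2Kernel μ ν k C)
    (hfin : ∫⁻ x, ∫⁻ y, ‖k x y‖ₑ ^ 2 ∂ν ∂μ < ⊤) : IsCompactOperator h.toCLM := by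
  let kc : X → Y → 𝕜 := fun x y => starRingEnd 𝕜 (k x y)
  have hkc : Measurable (Function.uncurry kc) := RCLike.continuous_conj.measurable.comp h.measurable
  have hkc_fin : ∫⁻ x, ∫⁻ y, ‖kc x y‖ₑ ^ 2 ∂ν ∂μ < ⊤ := by
    simpa only [kc, ← ofReal_norm, RCLike.norm_conj] using hfin
  have hΦ := memLp_innerSL_toL2OrZero_row hkc hkc_fin
  suffices h.toCLM = lpFunctionals 2 μ (hΦ.toLp _) by
    rw [this]
    exact isCompactOperator_lpFunctionals ENNReal.ofNat_ne_top _
  ext1 g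
  refine Lp.ext ((h.coeFn_toCLM g).trans (EventuallyEq.trans ?_ (coeFn_lpFunctionals _ g).symm))
  filter_upwards [hΦ.coeFn_toLp, ae_lt_top (measurable_lintegral_enorm_sq hkc) hkc_fin.ne]
    with x hx hx_fin
  have hx_mem := (memLp_row_iff hkc x).2 hx_fin
  rw [hx, innerSL_apply_apply, L2.inner_def, toL2OrZero_of_memLp hx_mem]
  refine integral_congr_ae ?_
  filter_upwards [hx_mem.coeFn_toLp] with y hy
  rw [hy, RCLike.inner_apply, RCLike.conj_conj, mul_comm]

theorem exists_isCompactOperator_of_forall_eq_add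
    (hk : ∀ ε : ℝ≥0, 0 < ε → ∃ a b : X → Y → 𝕜, k = a + b ∧ IsL2Kernel μ ν a ε ∧
      Measurable (Function.uncurry b) ∧ ∫⁻ x, ∫⁻ y, ‖b x y‖ₑ ^ 2 ∂ν ∂μ < ⊤) :
    ∃ (C : ℝ≥0) (h : IsL2Kernel μ ν k C), IsCompactOperator h.toCLM := by
  choose! a b hk_eq ha hb hb_fin using hk
  choose! D hD using fun (ε : ℝ≥0) hε => exists_of_lintegral_sq_lt_top (hb ε hε) (hb_fin ε hε)
  have hk : IsL2Kernel μ ν k (1 + D 1) := hk_eq 1 one_pos ▸ (ha 1 one_pos).add (hD 1 one_pos)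
  have h_closed : IsClosed {T : Lp 𝕜 2 ν →L[𝕜] Lp 𝕜 2 μ | IsCompactOperator T} :=
    isClosed_setOfPred_isCompactOperator
  refine ⟨_, hk, h_closed.closure_subset (Metric.mem_closure_iff.2 fun ε hε => ?_)⟩
  lift ε to ℝ≥0 using hε.le
  have hε2 : 0 < ε / 2 := half_pos (NNReal.coe_pos.1 hε)
  refine ⟨(hD _ hε2).toCLM,
    (hD _ hε2).isCompactOperator_of_lintegral_sq_lt_top (hb_fin _ hε2), ?_⟩
  have hab : IsL2Kernel μ ν (a (ε / 2) + b (ε / 2)) (1 + D 1) := hk_eq _ hε2 ▸ hk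
  have h_eq : hk.toCLM = hab.toCLM := by congr 1; exact hk_eq _ hε2
  rw [dist_eq_norm, h_eq, (ha _ hε2).toCLM_add (hD _ hε2) hab, add_sub_cancel_right]
  exact (ha _ hε2).norm_toCLM_le.trans_lt
    (NNReal.coe_lt_coe.2 (NNReal.half_lt_self (NNReal.coe_pos.1 hε).ne'))

end IsL2Kernel

end KernelOperators

/-! ### Bounds for the outgoing fundamental solution -/

section EntireSeries

open Nat

/-- The sum of the power series with coefficients `a`. -/
noncomputable def powerSum (a : ℕ → ℝ) (t : ℝ) : ℝ := ∑' m, a m * t ^ m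

/-- The coefficients of the termwise derivative of the power series with coefficients `a`. -/
def derivCoeff (a : ℕ → ℝ) (m : ℕ) : ℝ := (m + 1) * a (m + 1)

variable {a : ℕ → ℝ}

theorem summable_mul_pow_of_abs_le_inv_factorial (ha : ∀ m, |a m| ≤ 1 / m !) (t : ℝ) :
    Summable fun m => a m * t ^ m := by
  refine Summable.of_norm_bounded (Real.summable_pow_div_factorial |t|) fun m => ?_
  rw [norm_mul, norm_pow, Real.norm_eq_abs, Real.norm_eq_abs, div_eq_inv_mul, ← one_div]
  exact mul_le_mul_of_nonneg_right (ha m) (by positivity)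

theorem abs_derivCoeff_le_inv_factorial (ha : ∀ m, |a m| ≤ 1 / m !) (m : ℕ) :
    |derivCoeff a m| ≤ 1 / m ! := by
  rw [derivCoeff, abs_mul, abs_of_nonneg (by positivity : (0 : ℝ) ≤ m + 1)]
  calc ((m : ℝ) + 1) * |a (m + 1)| ≤ (m + 1) * (1 / (m + 1)!) := by gcongr; exact ha (m + 1)
    _ = 1 / m ! := by
      rw [Nat.factorial_succ]
      push_cast
      field_simp

theorem tsum_mul_deriv_pow_eq_powerSum_derivCoeff (ha : ∀ m, |a m| ≤ 1 / m !) (t : ℝ) :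
    ∑' m, a m * (m * t ^ (m - 1)) = powerSum (derivCoeff a) t := by
  have hshift : ∀ m : ℕ, a (m + 1) * ((m + 1 : ℕ) * t ^ (m + 1 - 1)) = derivCoeff a m * t ^ m :=
    fun m => by
      rw [derivCoeff, Nat.add_sub_cancel]
      push_cast
      ring
  have hsum : Summable fun m : ℕ => a m * (m * t ^ (m - 1)) := by
    rw [← summable_nat_add_iff 1]
    simpa only [hshift] using
      summable_mul_pow_of_abs_le_inv_factorial (abs_derivCoeff_le_inv_factorial ha) t
  rw [hsum.tsum_eq_zero_add, Nat.cast_zero, zero_mul, mul_zero, zero_add, powerSum]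
  exact tsum_congr hshift

theorem hasDerivAt_powerSum (ha : ∀ m, |a m| ≤ 1 / m !) (t : ℝ) :
    HasDerivAt (powerSum a) (powerSum (derivCoeff a) t) t := by
  set R : ℝ := |t| + 1
  have hR : 0 < R := by positivity
  have hbound : Summable fun m : ℕ => (m : ℝ) * (1 / m !) * R ^ (m - 1) := by
    rw [← summable_nat_add_iff 1]
    refine (Real.summable_pow_div_factorial R).congr fun m => ?_
    rw [Nat.factorial_succ, Nat.add_sub_cancel]
    push_cast
    field_simp
  have hterm : ∀ m : ℕ, ∀ y ∈ Metric.ball 0 R,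
      ‖a m * (m * y ^ (m - 1))‖ ≤ m * (1 / m !) * R ^ (m - 1) := fun m y hy => by
    rw [mem_ball_zero_iff, Real.norm_eq_abs] at hy
    rw [norm_mul, norm_mul, norm_pow, Real.norm_eq_abs, Real.norm_eq_abs, Real.norm_eq_abs,
      Nat.abs_cast, ← mul_assoc, mul_comm (|a m|)]
    gcongr
    exact ha m
  rw [← tsum_mul_deriv_pow_eq_powerSum_derivCoeff ha]
  refine hasDerivAt_tsum_of_isPreconnected hbound Metric.isOpen_ball
    (convex_ball _ _).isPreconnected (fun m y _ => (hasDerivAt_pow m y).const_mul (a m)) hterm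
    (Metric.mem_ball_self hR) (summable_mul_pow_of_abs_le_inv_factorial ha 0) ?_
  rw [mem_ball_zero_iff, Real.norm_eq_abs]
  exact lt_add_one _

theorem mul_powerSum_derivCoeff_add_powerSum (ha : ∀ m, |a m| ≤ 1 / m !) (t : ℝ) :
    t * powerSum (derivCoeff (derivCoeff a)) t + powerSum (derivCoeff a) t + powerSum a t
      = powerSum (fun m => (m + 1) ^ 2 * a (m + 1) + a m) t := by
  have ha' := abs_derivCoeff_le_inv_factorial ha
  have hsnd : HasSum (fun m : ℕ => m * derivCoeff a m * t ^ m)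
      (t * powerSum (derivCoeff (derivCoeff a)) t) := by
    rw [← hasSum_nat_add_iff' 1, Finset.sum_range_one, Nat.cast_zero, zero_mul, zero_mul, sub_zero]
    convert! (summable_mul_pow_of_abs_le_inv_factorial
      (abs_derivCoeff_le_inv_factorial ha') t).hasSum.mul_left t using 1
    funext m
    rw [derivCoeff.eq_def (derivCoeff a)]
    push_cast
    ring
  have hsum := (hsnd.add (summable_mul_pow_of_abs_le_inv_factorial ha' t).hasSum).add
    (summable_mul_pow_of_abs_le_inv_factorial ha t).hasSum
  rw [powerSum, powerSum, powerSum, ← powerSum, ← hsum.tsum_eq, powerSum]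
  refine tsum_congr fun m => ?_
  rw [derivCoeff]
  ring

/-- The even entire function `z ↦ ∑ a_m (z² / 4)^m`, the form in which Frobenius' method produces
solutions of Bessel's equation of order zero. -/
noncomputable def evenSum (a : ℕ → ℝ) (z : ℝ) : ℝ := powerSum a (z ^ 2 / 4)

/-- The derivative of `evenSum a`. -/
noncomputable def evenSumDeriv (a : ℕ → ℝ) (z : ℝ) : ℝ :=
  powerSum (derivCoeff a) (z ^ 2 / 4) * (z / 2)

theorem hasDerivAt_powerSum_sq_div_four (ha : ∀ m, |a m| ≤ 1 / m !) (z : ℝ) :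
    HasDerivAt (fun z => powerSum a (z ^ 2 / 4))
      (powerSum (derivCoeff a) (z ^ 2 / 4) * (z / 2)) z := by
  have hsq : HasDerivAt (fun z : ℝ => z ^ 2 / 4) (z / 2) z := by
    convert! (hasDerivAt_pow 2 z).div_const 4 using 1
    norm_num
    ring
  exact (hasDerivAt_powerSum ha _).comp z hsq

theorem hasDerivAt_evenSum (ha : ∀ m, |a m| ≤ 1 / m !) (z : ℝ) :
    HasDerivAt (evenSum a) (evenSumDeriv a z) z :=
  hasDerivAt_powerSum_sq_div_four ha z

theorem hasDerivAt_evenSumDeriv (ha : ∀ m, |a m| ≤ 1 / m !) {z : ℝ} (hz : z ≠ 0) :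
    HasDerivAt (evenSumDeriv a) (-evenSumDeriv a z / z - evenSum a z
      + evenSum (fun m => (m + 1) ^ 2 * a (m + 1) + a m) z) z := by
  have hderiv := (hasDerivAt_powerSum_sq_div_four (abs_derivCoeff_le_inv_factorial ha) z).mul
    ((hasDerivAt_id z).div_const 2)
  convert! hderiv using 1
  simp only [evenSum, evenSumDeriv, ← mul_powerSum_derivCoeff_add_powerSum ha, id]
  field_simp
  ring

theorem continuous_evenSum (ha : ∀ m, |a m| ≤ 1 / m !) : Continuous (evenSum a) :=
  continuous_iff_continuousAt.2 fun z => (hasDerivAt_evenSum ha z).continuousAt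

theorem continuous_evenSumDeriv (ha : ∀ m, |a m| ≤ 1 / m !) : Continuous (evenSumDeriv a) :=
  (continuous_iff_continuousAt.2 fun z => (hasDerivAt_powerSum_sq_div_four
    (abs_derivCoeff_le_inv_factorial ha) z).continuousAt).mul (by fun_prop)

theorem exists_abs_evenSum_le (ha : ∀ m, |a m| ≤ 1 / m !) :
    ∃ C, 0 ≤ C ∧ ∀ z, 0 < z → z ≤ 1 → |evenSum a z| ≤ C ∧ |evenSumDeriv a z| ≤ C := by
  obtain ⟨C, hC⟩ := isCompact_Icc.exists_bound_of_continuousOn (s := Set.Icc (0 : ℝ) 1)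
    ((continuous_evenSum ha).prodMk (continuous_evenSumDeriv ha)).continuousOn
  exact ⟨C, (norm_nonneg _).trans (hC 0 (by simp)), fun z hz hz1 =>
    ⟨(norm_fst_le _).trans (hC z ⟨hz.le, hz1⟩), (norm_snd_le _).trans (hC z ⟨hz.le, hz1⟩)⟩⟩

end EntireSeries

section RadialProfile

open Set

variable {E F : Type*} [NormedAddCommGroup E] [NormedSpace ℝ E]
  [NormedAddCommGroup F] [NormedSpace ℝ F] {a b : ℝ} {g g' h h' : ℝ → E}

/-- `g` is continuously differentiable on `(0, ∞)` with derivative `g'`, and both are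
`O(r⁻ᵃ + r⁻ᵇ)` there. For the fundamental solution in dimension `n` the exponent `a = n - 1`
describes the singularity of the gradient and `b = (n - 1) / 2` the decay at infinity. -/
structure IsRadialProfile (a b : ℝ) (g g' : ℝ → E) : Prop where
  hasDerivAt : ∀ r, 0 < r → HasDerivAt g (g' r) r
  continuousOn_deriv : ContinuousOn g' (Ioi 0)
  exists_bound : ∃ C, 0 ≤ C ∧ ∀ r, 0 < r →
    ‖g r‖ ≤ C * (r ^ (-a) + r ^ (-b)) ∧ ‖g' r‖ ≤ C * (r ^ (-a) + r ^ (-b))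

namespace IsRadialProfile

theorem continuousOn (hg : IsRadialProfile a b g g') : ContinuousOn g (Ioi 0) :=
  fun r hr => (hg.hasDerivAt r hr).continuousAt.continuousWithinAt

theorem add (hg : IsRadialProfile a b g g') (hh : IsRadialProfile a b h h') :
    IsRadialProfile a b (g + h) (g' + h') where
  hasDerivAt r hr := (hg.hasDerivAt r hr).add (hh.hasDerivAt r hr)
  continuousOn_deriv := hg.continuousOn_deriv.add hh.continuousOn_deriv
  exists_bound := by
    obtain ⟨C, hC, hgC⟩ := hg.exists_bound
    obtain ⟨D, hD, hhD⟩ := hh.exists_bound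
    refine ⟨C + D, by positivity, fun r hr => ?_⟩
    rw [add_mul]
    exact ⟨norm_add_le_of_le (hgC r hr).1 (hhD r hr).1,
      norm_add_le_of_le (hgC r hr).2 (hhD r hr).2⟩

theorem clm_comp (hg : IsRadialProfile a b g g') (L : E →L[ℝ] F) :
    IsRadialProfile a b (L ∘ g) (L ∘ g') where
  hasDerivAt r hr := L.hasFDerivAt.comp_hasDerivAt r (hg.hasDerivAt r hr)
  continuousOn_deriv := L.continuous.comp_continuousOn hg.continuousOn_deriv
  exists_bound := by
    obtain ⟨C, hC, hbound⟩ := hg.exists_bound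
    refine ⟨‖L‖ * C, by positivity, fun r hr => ?_⟩
    rw [mul_assoc]
    exact ⟨L.le_opNorm_of_le (hbound r hr).1, L.le_opNorm_of_le (hbound r hr).2⟩

theorem comp_mul_left (hg : IsRadialProfile a b g g') {c : ℝ} (hc : 0 < c) :
    IsRadialProfile a b (fun r => g (c * r)) (fun r => c • g' (c * r)) where
  hasDerivAt r hr := by
    have hlin : HasDerivAt (fun r => c * r) c r := by simpa using (hasDerivAt_id r).const_mul c
    exact (hg.hasDerivAt (c * r) (mul_pos hc hr)).scomp r hlin
  continuousOn_deriv := (hg.continuousOn_deriv.comp (by fun_prop)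
    fun r hr => mul_pos hc hr).const_smul c
  exists_bound := by
    obtain ⟨C, hC, hbound⟩ := hg.exists_bound
    set m := c ^ (-a) + c ^ (-b)
    have hscale : ∀ r, 0 < r →
        C * ((c * r) ^ (-a) + (c * r) ^ (-b)) ≤ C * m * (r ^ (-a) + r ^ (-b)) := fun r hr => by
      have hcr : 0 ≤ c ^ (-b) * r ^ (-a) + c ^ (-a) * r ^ (-b) := by positivity
      rw [Real.mul_rpow hc.le hr.le, Real.mul_rpow hc.le hr.le, mul_assoc]
      gcongr
      simp only [m]
      linarith
    refine ⟨(1 + c) * (C * m), by positivity, fun r hr => ?_⟩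
    obtain ⟨hval, hderiv⟩ := hbound (c * r) (mul_pos hc hr)
    have hpos : 0 ≤ C * m * (r ^ (-a) + r ^ (-b)) := by positivity
    refine ⟨(hval.trans (hscale r hr)).trans (by nlinarith), ?_⟩
    rw [norm_smul, Real.norm_of_nonneg hc.le]
    nlinarith [hderiv.trans (hscale r hr)]

end IsRadialProfile

end RadialProfile

section BesselEquation

open Set

/-- `w`, with derivative `w'`, solves Bessel's equation `w'' + w' / z + w = 0` of order zero on
`(0, ∞)`. -/
structure IsBesselSolution (w w' : ℝ → ℝ) : Prop where
  hasDerivAt : ∀ z, 0 < z → HasDerivAt w (w' z) z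
  hasDerivAt_deriv : ∀ z, 0 < z → HasDerivAt w' (-w' z / z - w z) z

/-- The energy `(v')² + (1 + 1 / (4 z²)) v²` of the Liouville transform `v = √z w`. -/
noncomputable def besselEnergy (w w' : ℝ → ℝ) (z : ℝ) : ℝ :=
  z * (w' z + w z / (2 * z)) ^ 2 + (1 + 1 / (4 * z ^ 2)) * (z * w z ^ 2)

variable {w w' : ℝ → ℝ}

theorem IsBesselSolution.hasDerivAt_besselEnergy (hw : IsBesselSolution w w') {z : ℝ}
    (hz : 0 < z) : HasDerivAt (besselEnergy w w') (-(w z ^ 2 / (2 * z ^ 2))) z := by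
  have hw1 := hw.hasDerivAt z hz
  have hcross : HasDerivAt (fun z => w' z + w z / (2 * z))
      (-w' z / z - w z + (w' z * (2 * z) - w z * (2 * 1)) / (2 * z) ^ 2) z :=
    (hw.hasDerivAt_deriv z hz).add (hw1.div ((hasDerivAt_id z).const_mul 2) (by positivity))
  have hpotential : HasDerivAt (fun z : ℝ => 1 + 1 / (4 * z ^ 2))
      ((0 * (4 * z ^ 2) - 1 * (4 * (2 * z))) / (4 * z ^ 2) ^ 2) z := by
    simpa using ((hasDerivAt_const z (1 : ℝ)).div ((hasDerivAt_pow 2 z).const_mul 4)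
      (by positivity)).const_add (1 : ℝ)
  convert! ((hasDerivAt_id z).mul (hcross.pow 2)).add
    (hpotential.mul ((hasDerivAt_id z).mul (hw1.pow 2))) using 1
  simp only [id, Nat.cast_ofNat, Pi.pow_apply, Pi.mul_apply, Nat.add_one_sub_one, pow_one]
  field_simp
  ring

theorem IsBesselSolution.antitoneOn_besselEnergy (hw : IsBesselSolution w w') :
    AntitoneOn (besselEnergy w w') (Ioi 0) := by
  refine antitoneOn_of_hasDerivWithinAt_nonpos (convex_Ioi 0)
    (fun z hz => (hw.hasDerivAt_besselEnergy hz).continuousAt.continuousWithinAt)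
    (fun z hz => (hw.hasDerivAt_besselEnergy (interior_subset hz)).hasDerivWithinAt) fun z _ => ?_
  exact neg_nonpos.2 (by positivity)

theorem abs_le_sqrt_mul_rpow_neg_half {z u e : ℝ} (hz : 0 < z) (h : z * u ^ 2 ≤ e) :
    |u| ≤ √e * z ^ (-(1 / 2) : ℝ) := by
  rw [Real.rpow_neg hz.le, ← Real.sqrt_eq_rpow, ← div_eq_mul_inv, le_div_iff₀ (Real.sqrt_pos.2 hz)]
  refine Real.le_sqrt_of_sq_le ?_
  rwa [mul_pow, Real.sq_sqrt hz.le, sq_abs, mul_comm]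

theorem IsBesselSolution.exists_bound (hw : IsBesselSolution w w') :
    ∃ C, 0 ≤ C ∧ ∀ z, 1 ≤ z →
      |w z| ≤ C * z ^ (-(1 / 2) : ℝ) ∧ |w' z| ≤ C * z ^ (-(1 / 2) : ℝ) := by
  set e := besselEnergy w w' 1
  refine ⟨2 * √e, by positivity, fun z hz => ?_⟩
  have hz0 : 0 < z := one_pos.trans_le hz
  have henergy : besselEnergy w w' z ≤ e := hw.antitoneOn_besselEnergy (mem_Ioi.2 one_pos) hz0 hz
  rw [besselEnergy, one_add_mul] at henergy
  have hcross : 0 ≤ z * (w' z + w z / (2 * z)) ^ 2 := by positivity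
  have hsq : 0 ≤ z * w z ^ 2 := by positivity
  have hpotential : 0 ≤ 1 / (4 * z ^ 2) * (z * w z ^ 2) := by positivity
  have hwz : |w z| ≤ √e * z ^ (-(1 / 2) : ℝ) :=
    abs_le_sqrt_mul_rpow_neg_half hz0 (by linarith)
  have hsum : |w' z + w z / (2 * z)| ≤ √e * z ^ (-(1 / 2) : ℝ) :=
    abs_le_sqrt_mul_rpow_neg_half hz0 (by linarith)
  have hquot : |w z / (2 * z)| ≤ |w z| := by
    rw [abs_div, abs_of_pos (by positivity : 0 < 2 * z)]
    exact div_le_self (abs_nonneg _) (by linarith)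
  have htri : |w' z| ≤ |w' z + w z / (2 * z)| + |w z / (2 * z)| := by
    simpa using abs_sub (w' z + w z / (2 * z)) (w z / (2 * z))
  constructor <;> linarith [abs_nonneg (w z)]

theorem IsBesselSolution.isRadialProfile (hw : IsBesselSolution w w') {C : ℝ}
    (h0 : ∀ z, 0 < z → z ≤ 1 → |w z| ≤ C * z⁻¹ ∧ |w' z| ≤ C * z⁻¹) :
    IsRadialProfile 1 (1 / 2) w w' where
  hasDerivAt := hw.hasDerivAt
  continuousOn_deriv z hz := (hw.hasDerivAt_deriv z hz).continuousAt.continuousWithinAt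
  exists_bound := by
    obtain ⟨D, hD, hinfty⟩ := hw.exists_bound
    refine ⟨max C D, le_max_of_le_right hD, fun z hz => ?_⟩
    rcases le_total z 1 with hz1 | hz1
    · have hle : C * z⁻¹ ≤ max C D * (z ^ (-1 : ℝ) + z ^ (-(1 / 2) : ℝ)) := by
        rw [Real.rpow_neg_one]
        gcongr
        · exact le_max_left C D
        · exact le_add_of_nonneg_right (by positivity)
      exact ⟨(h0 z hz hz1).1.trans hle, (h0 z hz hz1).2.trans hle⟩
    · have hle : D * z ^ (-(1 / 2) : ℝ) ≤ max C D * (z ^ (-1 : ℝ) + z ^ (-(1 / 2) : ℝ)) := by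
        gcongr
        · exact le_max_right C D
        · exact le_add_of_nonneg_left (by positivity)
      exact ⟨(hinfty z hz1).1.trans hle, (hinfty z hz1).2.trans hle⟩

end BesselEquation

section BesselZero

open Real Nat

/-- The coefficients of `J₀` in powers of `z² / 4`. -/
noncomputable def besselCoeff (m : ℕ) : ℝ := (-1) ^ m / (m ! : ℝ) ^ 2

/-- The coefficients of the power series in Neumann's formula for `Y₀`, in powers of `z² / 4`. -/
noncomputable def neumannCoeff (m : ℕ) : ℝ := (-1) ^ (m + 1) * (harmonic m : ℝ) / (m ! : ℝ) ^ 2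

theorem abs_besselCoeff_le (m : ℕ) : |besselCoeff m| ≤ 1 / m ! := by
  rw [besselCoeff, abs_div, abs_pow, abs_neg, abs_one, one_pow, abs_of_nonneg (by positivity)]
  have : (1 : ℝ) ≤ m ! := by exact_mod_cast m.factorial_pos
  gcongr
  nlinarith

theorem harmonic_le_self (m : ℕ) : harmonic m ≤ m := by
  refine (Finset.sum_le_card_nsmul _ _ 1 fun i _ => ?_).trans_eq (by simp)
  exact inv_le_one_of_one_le₀ (by exact_mod_cast i.succ_pos)

theorem abs_neumannCoeff_le (m : ℕ) : |neumannCoeff m| ≤ 1 / m ! := by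
  have hnonneg : (0 : ℝ) ≤ harmonic m := by
    exact_mod_cast Finset.sum_nonneg fun i _ => by positivity
  have hle : (harmonic m : ℝ) ≤ m ! := by
    exact_mod_cast (harmonic_le_self m).trans (by exact_mod_cast m.self_le_factorial)
  rw [neumannCoeff, abs_div, abs_mul, abs_pow, abs_neg, abs_one, one_pow, one_mul,
    abs_of_nonneg hnonneg, abs_of_nonneg (by positivity),
    div_le_div_iff₀ (by positivity) (by positivity)]
  nlinarith [(by positivity : (0 : ℝ) ≤ m !)]

theorem besselCoeff_succ (m : ℕ) : ((m : ℝ) + 1) ^ 2 * besselCoeff (m + 1) + besselCoeff m = 0 := by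
  simp only [besselCoeff, Nat.factorial_succ]
  push_cast
  field_simp
  ring

theorem neumannCoeff_succ (m : ℕ) :
    ((m : ℝ) + 1) ^ 2 * neumannCoeff (m + 1) + neumannCoeff m = -derivCoeff besselCoeff m := by
  simp only [neumannCoeff, besselCoeff, derivCoeff, Nat.factorial_succ, harmonic_succ]
  push_cast
  field_simp
  ring

theorem besselJ_zero_eq : besselJ 0 = evenSum besselCoeff := by
  funext z
  refine tsum_congr fun m => ?_
  rw [add_zero, add_zero, Real.Gamma_nat_eq_factorial, besselCoeff,
    show (2 * (m : ℝ)) = ((2 * m : ℕ) : ℝ) by push_cast; ring, Real.rpow_natCast, pow_mul, ← sq,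
    show (z / 2) ^ 2 = z ^ 2 / 4 by ring]

theorem besselY_zero_eq : besselY 0 = fun z =>
    2 / π * ((Real.log (z / 2) + eulerMascheroniConstant) * evenSum besselCoeff z
      + evenSum neumannCoeff z) := by
  funext z
  rw [besselY, if_pos rfl, besselJ_zero_eq, mul_assoc, mul_add]
  rfl

/-- The derivative of `Y₀`, by the product rule in Neumann's formula. -/
noncomputable def besselYZeroDeriv (z : ℝ) : ℝ :=
  2 / π * (z⁻¹ * evenSum besselCoeff z
    + (Real.log (z / 2) + eulerMascheroniConstant) * evenSumDeriv besselCoeff z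
    + evenSumDeriv neumannCoeff z)

theorem hasDerivAt_log_half_add {z : ℝ} (hz : z ≠ 0) (c : ℝ) :
    HasDerivAt (fun z => Real.log (z / 2) + c) z⁻¹ z := by
  convert! (((hasDerivAt_id z).div_const 2).log (by simpa using hz)).add_const c using 1
  simp only [id]
  field_simp

theorem isBesselSolution_besselJ_zero :
    IsBesselSolution (besselJ 0) (evenSumDeriv besselCoeff) where
  hasDerivAt z _ := besselJ_zero_eq ▸ hasDerivAt_evenSum abs_besselCoeff_le z
  hasDerivAt_deriv z hz := by
    convert! hasDerivAt_evenSumDeriv abs_besselCoeff_le hz.ne' using 1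
    rw [besselJ_zero_eq]
    simp [besselCoeff_succ, evenSum, powerSum]

theorem isBesselSolution_besselY_zero : IsBesselSolution (besselY 0) besselYZeroDeriv where
  hasDerivAt z hz := by
    rw [besselY_zero_eq]
    exact (((hasDerivAt_log_half_add hz.ne' _).mul (hasDerivAt_evenSum abs_besselCoeff_le z)).add
      (hasDerivAt_evenSum abs_neumannCoeff_le z)).const_mul (2 / π)
  hasDerivAt_deriv z hz := by
    have hlog := hasDerivAt_log_half_add hz.ne' eulerMascheroniConstant
    have hJ := hasDerivAt_evenSum abs_besselCoeff_le z
    have hJ' := hasDerivAt_evenSumDeriv abs_besselCoeff_le hz.ne'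
    have hQ' := hasDerivAt_evenSumDeriv abs_neumannCoeff_le hz.ne'
    have hJ_source : evenSum (fun m => ((m : ℝ) + 1) ^ 2 * besselCoeff (m + 1) + besselCoeff m) z
        = 0 := by simp [besselCoeff_succ, evenSum, powerSum]
    have hQ_source : evenSum (fun m => ((m : ℝ) + 1) ^ 2 * neumannCoeff (m + 1) + neumannCoeff m) z
        = -(2 / z) * evenSumDeriv besselCoeff z := by
      simp only [neumannCoeff_succ, evenSum, evenSumDeriv, powerSum, neg_mul, tsum_neg]
      field_simp
    rw [hJ_source] at hJ'
    rw [hQ_source] at hQ'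
    convert! ((((hasDerivAt_inv hz.ne').mul hJ).add (hlog.mul hJ')).add hQ').const_mul (2 / π)
      using 1
    rw [besselY_zero_eq, besselYZeroDeriv]
    field_simp
    ring

theorem abs_log_half_add_eulerMascheroniConstant_le {z : ℝ} (hz : 0 < z) (hz1 : z ≤ 1) :
    |Real.log (z / 2) + eulerMascheroniConstant| ≤ 2 * z⁻¹ := by
  have hlog : |Real.log z| ≤ z⁻¹ := by
    have := (Real.abs_log_mul_self_lt z hz hz1).le
    rwa [abs_mul, abs_of_pos hz, ← le_div_iff₀ hz, one_div] at this
  have hconst : |Real.log 2 - eulerMascheroniConstant| ≤ 1 := by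
    rw [abs_le]
    constructor <;> linarith [log_two_lt_d9, Real.log_pos (one_lt_two (α := ℝ)),
      one_half_lt_eulerMascheroniConstant, eulerMascheroniConstant_lt_two_thirds]
  rw [Real.log_div hz.ne' two_ne_zero, sub_add]
  linarith [abs_sub (Real.log z) (Real.log 2 - eulerMascheroniConstant), (one_le_inv₀ hz).2 hz1]

theorem isRadialProfile_besselJ_zero :
    IsRadialProfile 1 (1 / 2) (besselJ 0) (evenSumDeriv besselCoeff) := by
  obtain ⟨C, hC, hbound⟩ := exists_abs_evenSum_le abs_besselCoeff_le
  refine isBesselSolution_besselJ_zero.isRadialProfile (C := C) fun z hz hz1 => ?_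
  have hle : C ≤ C * z⁻¹ := le_mul_of_one_le_right hC ((one_le_inv₀ hz).2 hz1)
  rw [besselJ_zero_eq]
  exact ⟨(hbound z hz hz1).1.trans hle, (hbound z hz hz1).2.trans hle⟩

theorem isRadialProfile_besselY_zero :
    IsRadialProfile 1 (1 / 2) (besselY 0) besselYZeroDeriv := by
  obtain ⟨C, hC, hJ⟩ := exists_abs_evenSum_le abs_besselCoeff_le
  obtain ⟨D, hD, hQ⟩ := exists_abs_evenSum_le abs_neumannCoeff_le
  refine isBesselSolution_besselY_zero.isRadialProfile (C := 2 / π * (3 * C + D))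
    fun z hz hz1 => ?_
  have hlog := abs_log_half_add_eulerMascheroniConstant_le hz hz1
  have hDz : D ≤ D * z⁻¹ := le_mul_of_one_le_right hD ((one_le_inv₀ hz).2 hz1)
  obtain ⟨hJz, hJ'z⟩ := hJ z hz hz1
  obtain ⟨hQz, hQ'z⟩ := hQ z hz hz1
  have hlogJ := mul_le_mul hlog hJz (abs_nonneg _) (by positivity)
  have hlogJ' := mul_le_mul hlog hJ'z (abs_nonneg _) (by positivity)
  have hinvJ := mul_le_mul_of_nonneg_left hJz (inv_pos.2 hz).le
  have hCz : 0 ≤ C * z⁻¹ := by positivity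
  rw [besselY_zero_eq, besselYZeroDeriv, abs_mul, abs_mul, abs_of_pos (by positivity : 0 < 2 / π),
    mul_assoc]
  constructor
  · gcongr
    refine (abs_add_le _ _).trans ?_
    rw [abs_mul]
    linarith
  · gcongr
    refine (abs_add_three _ _ _).trans ?_
    rw [abs_mul, abs_mul, abs_of_pos (inv_pos.2 hz)]
    linarith

end BesselZero

section BesselHalf

open Real Nat

theorem factorial_mul_Gamma_add_half (m : ℕ) :
    (m ! : ℝ) * Real.Gamma (m + 1 / 2) * 2 ^ (2 * m) = (2 * m)! * √π := by
  induction m with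
  | zero => simpa using Real.Gamma_one_half_eq
  | succ m ih =>
    have hGamma : Real.Gamma ((m + 1 : ℕ) + 1 / 2) = (m + 1 / 2) * Real.Gamma (m + 1 / 2) := by
      rw [← Real.Gamma_add_one (by positivity)]
      push_cast
      ring_nf
    rw [hGamma, show 2 * (m + 1) = 2 * m + 1 + 1 by ring, Nat.factorial_succ, Nat.factorial_succ,
      Nat.factorial_succ]
    push_cast
    linear_combination (4 * (m + 1) * (m + 1 / 2)) * ih

theorem besselJ_neg_half {z : ℝ} (hz : 0 < z) :
    besselJ (-(1 / 2)) z = (z / 2) ^ (-(1 / 2) : ℝ) / √π * Real.cos z := by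
  rw [besselJ, Real.cos_eq_tsum, ← tsum_mul_left]
  refine tsum_congr fun m => ?_
  have hdup := factorial_mul_Gamma_add_half m
  rw [show (m : ℝ) + -(1 / 2) + 1 = m + 1 / 2 by ring, rpow_add (by positivity),
    show (2 * (m : ℝ)) = ((2 * m : ℕ) : ℝ) by push_cast; ring, rpow_natCast, div_pow]
  field_simp at hdup ⊢
  linear_combination -hdup

theorem besselJ_half {z : ℝ} (hz : 0 < z) :
    besselJ (1 / 2) z = (z / 2) ^ (-(1 / 2) : ℝ) / √π * Real.sin z := by
  rw [besselJ, Real.sin_eq_tsum, ← tsum_mul_left]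
  refine tsum_congr fun m => ?_
  have hGamma : (0 : ℝ) < Real.Gamma (m + 1 / 2) := Real.Gamma_pos_of_pos (by positivity)
  have hdup := factorial_mul_Gamma_add_half m
  rw [show (m : ℝ) + 1 / 2 + 1 = (m + 1 / 2) + 1 by ring, Real.Gamma_add_one (by positivity),
    show (2 * (m : ℝ)) + 1 / 2 = ((2 * m + 1 : ℕ) : ℝ) + -(1 / 2) by push_cast; ring,
    rpow_add (by positivity), rpow_natCast, div_pow, Nat.factorial_succ]
  push_cast
  generalize Real.Gamma (m + 1 / 2) = Γ at hGamma hdup ⊢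
  field_simp
  rw [pow_succ]
  linear_combination -2 * hdup

theorem hankelOne_half {z : ℝ} (hz : 0 < z) :
    hankelOne (1 / 2) z = -I * ((z / 2) ^ (-(1 / 2) : ℝ) / √π : ℝ) * exp (I * z) := by
  have hY : besselY (1 / 2) z = -besselJ (-(1 / 2)) z := by
    rw [besselY, if_neg (by norm_num), show (1 / 2 : ℝ) * π = π / 2 by ring, Real.cos_pi_div_two,
      Real.sin_pi_div_two, mul_zero, zero_sub, div_one]
  rw [hankelOne, hY, besselJ_half hz, besselJ_neg_half hz, mul_comm I (z : ℂ), Complex.exp_mul_I]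
  rw [ofReal_mul, ofReal_neg, ofReal_mul, ofReal_sin, ofReal_cos]
  linear_combination (((z / 2) ^ (-(1 / 2) : ℝ) / √π : ℝ) * Complex.sin z) * I_sq

end BesselHalf

section OutgoingGreen

open Real Set

theorem outgoingGreen_two (k : ℝ) :
    outgoingGreen 2 k
      = (ContinuousLinearMap.toSpanSingleton ℝ (I / 4)) ∘ (fun r => besselJ 0 (|k| * r))
        + (ContinuousLinearMap.toSpanSingleton ℝ (-1 / 4 : ℂ)) ∘ fun r => besselY 0 (|k| * r) := by
  funext r
  have hν : (((2 : ℕ) : ℝ) - 2) / 2 = 0 := by norm_num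
  simp only [outgoingGreen, hν, hankelOne, rpow_zero, ofReal_one, mul_one, Pi.add_apply,
    Function.comp_apply, ContinuousLinearMap.toSpanSingleton_apply, real_smul]
  linear_combination (besselY 0 (|k| * r) / 4 : ℂ) * I_sq

theorem outgoingGreen_three {k r : ℝ} (hk : k ≠ 0) (hr : 0 < r) :
    outgoingGreen 3 k r = exp (I * (|k| * r : ℝ)) / (4 * π * r : ℝ) := by
  have hν : (((3 : ℕ) : ℝ) - 2) / 2 = 1 / 2 := by norm_num
  have hprefactor : (|k| / (2 * π * r)) ^ (1 / 2 : ℝ) * ((|k| * r / 2) ^ (-(1 / 2) : ℝ) / √π)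
      = 1 / (π * r) := by
    rw [rpow_neg (by positivity), ← sqrt_eq_rpow, ← sqrt_eq_rpow,
      show |k| / (2 * π * r) = |k| * r / 2 * π / (π * r) ^ 2 by field_simp,
      sqrt_div' _ (by positivity), sqrt_sq (by positivity), sqrt_mul (by positivity)]
    field_simp
  have hprefactor' : (((|k| / (2 * π * r)) ^ (1 / 2 : ℝ) : ℝ) : ℂ)
      * ((|k| * r / 2) ^ (-(1 / 2) : ℝ) / √π : ℝ) = 4 / (4 * π * r : ℝ) := by
    rw [← ofReal_mul, hprefactor]
    push_cast
    field_simp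
  rw [outgoingGreen, hν, hankelOne_half (by positivity)]
  linear_combination (exp (I * (|k| * r : ℝ)) / 4) * hprefactor'
    - (exp (I * (|k| * r : ℝ)) / 4 * ((|k| / (2 * π * r)) ^ (1 / 2 : ℝ) : ℝ)
      * ((|k| * r / 2) ^ (-(1 / 2) : ℝ) / √π : ℝ)) * I_sq

theorem hasDerivAt_outgoingGreen_three {k r : ℝ} (hk : k ≠ 0) (hr : 0 < r) :
    HasDerivAt (outgoingGreen 3 k) ((I * |k| - (r : ℂ)⁻¹) * outgoingGreen 3 k r) r := by
  have hr' : (r : ℂ) ≠ 0 := ofReal_ne_zero.2 hr.ne'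
  have hpi : (π : ℂ) ≠ 0 := ofReal_ne_zero.2 pi_ne_zero
  have hid : HasDerivAt (fun r : ℝ => (r : ℂ)) 1 r := (hasDerivAt_id r).ofReal_comp
  have hquot := (((hid.const_mul ((|k| : ℝ) : ℂ)).const_mul I).cexp).div
    (hid.const_mul (4 * π : ℂ)) (by simp [hr', hpi])
  have hgreen : HasDerivAt (outgoingGreen 3 k) _ r := hquot.congr_of_eventuallyEq <| by
    filter_upwards [lt_mem_nhds hr] with y hy
    rw [outgoingGreen_three hk hy]
    push_cast
    rfl
  convert! hgreen using 1
  rw [outgoingGreen_three hk hr]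
  push_cast
  field_simp

theorem norm_outgoingGreen_three_le {k r : ℝ} (hk : k ≠ 0) (hr : 0 < r) :
    ‖outgoingGreen 3 k r‖ ≤ r⁻¹ := by
  rw [outgoingGreen_three hk hr, norm_div, mul_comm I, norm_exp_ofReal_mul_I, norm_real,
    Real.norm_of_nonneg (by positivity), ← one_div]
  gcongr
  nlinarith [pi_gt_three]

theorem isRadialProfile_outgoingGreen_three {k : ℝ} (hk : k ≠ 0) :
    IsRadialProfile 2 1 (outgoingGreen 3 k)
      fun r => (I * |k| - (r : ℂ)⁻¹) * outgoingGreen 3 k r where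
  hasDerivAt _ hr := hasDerivAt_outgoingGreen_three hk hr
  continuousOn_deriv := by
    have hcont : ContinuousOn (outgoingGreen 3 k) (Ioi 0) := fun r hr =>
      (hasDerivAt_outgoingGreen_three hk hr).continuousAt.continuousWithinAt
    have hinv : ContinuousOn (fun r : ℝ => (r : ℂ)⁻¹) (Ioi 0) :=
      continuous_ofReal.continuousOn.inv₀ fun r hr => ofReal_ne_zero.2 (ne_of_gt hr)
    exact (continuousOn_const.sub hinv).mul hcont
  exists_bound := by
    refine ⟨1 + |k|, by positivity, fun r hr => ?_⟩
    have hG := norm_outgoingGreen_three_le hk hr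
    have hfactor : ‖I * ((|k| : ℝ) : ℂ) - (r : ℂ)⁻¹‖ ≤ |k| + r⁻¹ := by
      refine (norm_sub_le _ _).trans_eq ?_
      rw [norm_mul, norm_I, one_mul, norm_real, norm_inv, norm_real, norm_eq_abs, abs_abs,
        norm_eq_abs, abs_of_pos hr]
    have hinv : 0 < r⁻¹ := inv_pos.2 hr
    rw [rpow_neg hr.le, rpow_two, ← inv_pow, rpow_neg_one, norm_mul]
    constructor
    · nlinarith [abs_nonneg k, mul_nonneg (abs_nonneg k) hinv.le, sq_nonneg r⁻¹,
        mul_nonneg (abs_nonneg k) (sq_nonneg r⁻¹)]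
    · refine (mul_le_mul hfactor hG (norm_nonneg _) (by positivity)).trans ?_
      nlinarith [mul_nonneg (abs_nonneg k) (sq_nonneg r⁻¹)]

theorem exists_isRadialProfile_outgoingGreen {n : ℕ} (hn : n = 2 ∨ n = 3) {k : ℝ} (hk : k ≠ 0) :
    ∃ g', IsRadialProfile ((n : ℝ) - 1) (((n : ℝ) - 1) / 2) (outgoingGreen n k) g' := by
  have hk' : 0 < |k| := abs_pos.2 hk
  rcases hn with rfl | rfl
  · norm_num only
    rw [outgoingGreen_two]
    exact ⟨_, ((isRadialProfile_besselJ_zero.comp_mul_left hk').clm_comp _).add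
      ((isRadialProfile_besselY_zero.comp_mul_left hk').clm_comp _)⟩
  · norm_num only
    exact ⟨_, isRadialProfile_outgoingGreen_three hk⟩

end OutgoingGreen

/-! ### Weighted convolution kernels -/

section DoubleIntegrals

variable {E : Type*} [NormedAddCommGroup E] [MeasurableSpace E] [BorelSpace E]
  {μ : Measure E} {A B : E → ℝ≥0∞}

theorem lintegral_lintegral_mul_sub_left [μ.IsAddLeftInvariant] [μ.IsNegInvariant]
    (hA : Measurable A) (hB : Measurable B) :
    ∫⁻ x, ∫⁻ y, A x * B (x - y) ∂μ ∂μ = (∫⁻ x, A x ∂μ) * ∫⁻ y, B y ∂μ := by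
  have inner_eq (x : E) : ∫⁻ y, A x * B (x - y) ∂μ = A x * ∫⁻ y, B y ∂μ := by
    rw [lintegral_const_mul _ (by fun_prop), lintegral_sub_left_eq_self (fun y => B y) x]
  simp_rw [inner_eq]
  exact lintegral_mul_const _ hA

theorem lintegral_lintegral_mul_sub_right [SecondCountableTopology E] [SFinite μ]
    [μ.IsAddRightInvariant] (hA : Measurable A) (hB : Measurable B) :
    ∫⁻ x, ∫⁻ y, A y * B (x - y) ∂μ ∂μ = (∫⁻ x, A x ∂μ) * ∫⁻ y, B y ∂μ := by
  rw [lintegral_lintegral_swap (by fun_prop)]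
  have inner_eq (y : E) : ∫⁻ x, A y * B (x - y) ∂μ = A y * ∫⁻ y, B y ∂μ := by
    rw [lintegral_const_mul _ (by fun_prop), lintegral_sub_right_eq_self (fun y => B y) y]
  simp_rw [inner_eq]
  exact lintegral_mul_const _ hA

theorem lintegral_lintegral_add_lt_top {X Y : Type*} [MeasurableSpace X] [MeasurableSpace Y]
    {μ : Measure X} {ν : Measure Y} [SFinite ν] {F G : X → Y → ℝ≥0∞}
    (hF : Measurable (Function.uncurry F)) (hF_fin : ∫⁻ x, ∫⁻ y, F x y ∂ν ∂μ < ⊤)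
    (hG_fin : ∫⁻ x, ∫⁻ y, G x y ∂ν ∂μ < ⊤) : ∫⁻ x, ∫⁻ y, (F x y + G x y) ∂ν ∂μ < ⊤ := by
  have inner_eq (x : X) : ∫⁻ y, (F x y + G x y) ∂ν = (∫⁻ y, F x y ∂ν) + ∫⁻ y, G x y ∂ν :=
    lintegral_add_left (hF.comp measurable_prodMk_left) _
  simp_rw [inner_eq]
  rw [lintegral_add_left (Measurable.lintegral_prod_right hF)]
  exact ENNReal.add_lt_top.2 ⟨hF_fin, hG_fin⟩

end DoubleIntegrals

section Weights

open Set

variable {E : Type*} [NormedAddCommGroup E]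

theorem one_add_norm_sq_pos (x : E) : 0 < 1 + ‖x‖ ^ 2 := by positivity

theorem bracket_rpow_le_one (x : E) {s : ℝ} (hs : s ≤ 0) : (1 + ‖x‖ ^ 2) ^ s ≤ 1 :=
  Real.rpow_le_one_of_one_le_of_nonpos (by linarith [sq_nonneg ‖x‖]) hs

theorem measurable_bracket [MeasurableSpace E] [OpensMeasurableSpace E] (s : ℝ) :
    Measurable fun x : E => (1 + ‖x‖ ^ 2) ^ s := by
  fun_prop

theorem rpow_neg_norm_le_bracket {z : E} (hz : 1 ≤ ‖z‖) {m : ℝ} (hm : 0 ≤ m) :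
    ‖z‖ ^ (-m) ≤ 2 ^ (m / 2) * (1 + ‖z‖ ^ 2) ^ (-(m / 2)) := by
  have hz_pos : 0 < ‖z‖ := by linarith
  have sq_rpow : ‖z‖ ^ (-m) = (‖z‖ ^ 2) ^ (-(m / 2)) := by
    rw [← Real.rpow_natCast, ← Real.rpow_mul hz_pos.le]
    ring_nf
  rw [sq_rpow, Real.rpow_neg (by positivity), Real.rpow_neg (by positivity), ← div_eq_mul_inv,
    ← Real.div_rpow (by positivity) (by positivity), ← Real.inv_rpow (by positivity)]
  refine Real.rpow_le_rpow (by positivity) ?_ (by positivity)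
  rw [inv_eq_one_div, div_le_div_iff₀ (by positivity) (by positivity)]
  nlinarith

theorem rpow_mul_rpow_mul_rpow_le {X Y Z δ m : ℝ} (hX : 0 < X) (hY : 0 < Y) (hZ : 0 < Z)
    (hm : 0 ≤ m) (hδ : 0 < δ) (hmδ : m ≤ 4 * δ) :
    X ^ (-δ) * Z ^ (-(m / 2)) * Y ^ (-δ) ≤ X ^ (-(δ + m / 4)) * Y ^ (-(δ + m / 4))
      + X ^ (-(δ + m / 4)) * Z ^ (-(δ + m / 4)) + Y ^ (-(δ + m / 4)) * Z ^ (-(δ + m / 4)) := by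
  set β := δ + m / 4 with hβ
  have hβ_pos : 0 < β := by positivity
  set θ := m / (4 * β) with hθ
  have hθ_nonneg : 0 ≤ θ := by positivity
  have hθ_le : 0 ≤ 1 - 2 * θ := by
    rw [hθ, sub_nonneg, ← mul_div_assoc, div_le_one (by positivity), hβ]
    linarith
  have hβθ : β * θ = m / 4 := by rw [hθ]; field_simp
  have factor : (X ^ (-β) * Y ^ (-β)) ^ (1 - 2 * θ) * (X ^ (-β) * Z ^ (-β)) ^ θ
      * (Y ^ (-β) * Z ^ (-β)) ^ θ = X ^ (-δ) * Z ^ (-(m / 2)) * Y ^ (-δ) := by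
    have split (t : ℝ) (ht : 0 < t) : t ^ (-δ) = t ^ (-β * (1 - 2 * θ)) * t ^ (-β * θ) := by
      rw [← Real.rpow_add ht]; congr 1; linear_combination -hβθ - hβ
    have split_Z : Z ^ (-(m / 2)) = Z ^ (-β * θ) * Z ^ (-β * θ) := by
      rw [← Real.rpow_add hZ]; congr 1; linear_combination 2 * hβθ
    rw [Real.mul_rpow (by positivity) (by positivity),
      Real.mul_rpow (by positivity) (by positivity), Real.mul_rpow (by positivity) (by positivity),
      split X hX, split Y hY, split_Z]
    simp only [← Real.rpow_mul hX.le, ← Real.rpow_mul hY.le, ← Real.rpow_mul hZ.le]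
    ring
  -- AM–GM with weights `1 - 2θ, θ, θ` for the products of pairs of `X ^ (-β), Y ^ (-β), Z ^ (-β)`.
  have amgm := Real.geom_mean_le_arith_mean3_weighted hθ_le hθ_nonneg hθ_nonneg
    (by positivity : 0 ≤ X ^ (-β) * Y ^ (-β)) (by positivity : 0 ≤ X ^ (-β) * Z ^ (-β))
    (by positivity : 0 ≤ Y ^ (-β) * Z ^ (-β)) (by ring)
  rw [factor] at amgm
  refine amgm.trans (add_le_add (add_le_add ?_ ?_) ?_) <;>
    exact mul_le_of_le_one_left (by positivity) (by linarith)

variable {n : ℕ}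

/-- The weight `⟨x⟩^{-2 s} = (1 + |x|²)^{-s}` as an extended nonnegative real. -/
noncomputable def decayWeight (n : ℕ) (s : ℝ) (x : EuclideanSpace ℝ (Fin n)) : ℝ≥0∞ :=
  ENNReal.ofReal ((1 + ‖x‖ ^ 2) ^ (-s))

@[fun_prop]
theorem measurable_decayWeight (s : ℝ) : Measurable (decayWeight n s) :=
  (measurable_bracket _).ennreal_ofReal

theorem lintegral_decayWeight_lt_top {s : ℝ} (hs : (n : ℝ) < 2 * s) :
    ∫⁻ x, decayWeight n s x < ⊤ := by
  have h := integrable_rpow_neg_one_add_norm_sq (E := EuclideanSpace ℝ (Fin n)) (μ := volume)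
    (r := 2 * s) (by simpa using hs)
  rw [show -(2 * s) / 2 = -s by ring] at h
  exact h.lintegral_lt_top

/-- The function `|x|^{-(n-1)}` cut off to the ball of radius `ε`: the singularity of the gradient
of the fundamental solution. -/
noncomputable def nearSingularity (n : ℕ) (ε : ℝ) (x : EuclideanSpace ℝ (Fin n)) : ℝ :=
  (Iic ε).indicator (fun r : ℝ => r ^ (-((n : ℝ) - 1))) ‖x‖

theorem nearSingularity_of_le {ε : ℝ} {x : EuclideanSpace ℝ (Fin n)} (hx : ‖x‖ ≤ ε) :
    nearSingularity n ε x = ‖x‖ ^ (-((n : ℝ) - 1)) :=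
  indicator_of_mem (mem_Iic.2 hx) _

theorem nearSingularity_nonneg (ε : ℝ) (x : EuclideanSpace ℝ (Fin n)) :
    0 ≤ nearSingularity n ε x :=
  indicator_apply_nonneg fun _ => by positivity

@[fun_prop]
theorem measurable_nearSingularity (ε : ℝ) : Measurable (nearSingularity n ε) :=
  Measurable.comp (g := (Iic ε).indicator fun r : ℝ => r ^ (-((n : ℝ) - 1)))
    (Measurable.indicator (by fun_prop) measurableSet_Iic) measurable_norm

theorem pow_smul_indicator_rpow (hn : 0 < n) {ε r : ℝ} (hr : 0 < r) :
    r ^ (n - 1) • (Iic ε).indicator (fun r : ℝ => r ^ (-((n : ℝ) - 1))) r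
      = (Iic ε).indicator (fun _ => 1) r := by
  by_cases hrε : r ∈ Iic ε
  · rw [indicator_of_mem hrε, indicator_of_mem hrε, smul_eq_mul, ← Real.rpow_natCast,
      ← Real.rpow_add hr, Nat.cast_sub hn]
    simp
  · rw [indicator_of_notMem hrε, indicator_of_notMem hrε, smul_zero]

theorem integrable_nearSingularity (hn : 0 < n) (ε : ℝ) : Integrable (nearSingularity n ε) := by
  have : Nonempty (Fin n) := ⟨⟨0, hn⟩⟩
  have one_integrable : IntegrableOn ((Iic ε).indicator fun _ => (1 : ℝ)) (Ioi 0) := by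
    rw [integrableOn_indicator_iff measurableSet_Iic, Iic_inter_Ioi]
    simp
  refine (integrable_fun_norm_addHaar volume).2 (one_integrable.congr_fun (fun r hr => ?_)
    measurableSet_Ioi)
  rw [finrank_euclideanSpace_fin, pow_smul_indicator_rpow hn hr]

theorem lintegral_nearSingularity (hn : 0 < n) {ε : ℝ} (hε : 0 ≤ ε) :
    ∫⁻ x, ENNReal.ofReal (nearSingularity n ε x)
      = ENNReal.ofReal (n * (volume.real (Metric.ball (0 : EuclideanSpace ℝ (Fin n)) 1) * ε)) := by
  have : Nonempty (Fin n) := ⟨⟨0, hn⟩⟩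
  have radial : ∫ r in Ioi (0 : ℝ), r ^ (n - 1) •
      (Iic ε).indicator (fun r : ℝ => r ^ (-((n : ℝ) - 1))) r = ε := by
    rw [setIntegral_congr_fun measurableSet_Ioi fun r hr => pow_smul_indicator_rpow hn hr,
      setIntegral_indicator measurableSet_Iic, Ioi_inter_Iic]
    simp [hε]
  rw [← ofReal_integral_eq_lintegral_ofReal (integrable_nearSingularity hn ε)
    (.of_forall (nearSingularity_nonneg ε))]
  simp only [nearSingularity]
  rw [integral_fun_norm_addHaar volume ((Iic ε).indicator fun r : ℝ => r ^ (-((n : ℝ) - 1))),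
    finrank_euclideanSpace_fin, radial]
  simp

variable {δ : ℝ}

theorem weighted_rpow_norm_le_near (x y : EuclideanSpace ℝ (Fin n)) (hxy : ‖x - y‖ ≤ 1) :
    ENNReal.ofReal ((1 + ‖x‖ ^ 2) ^ (-δ) * ‖x - y‖ ^ (-((n : ℝ) - 1)) * (1 + ‖y‖ ^ 2) ^ (-δ))
      ≤ decayWeight n (2 * δ) x * ENNReal.ofReal (nearSingularity n 1 (x - y))
        + decayWeight n (2 * δ) y * ENNReal.ofReal (nearSingularity n 1 (x - y)) := by
  have sq_weight (z : EuclideanSpace ℝ (Fin n)) :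
      (1 + ‖z‖ ^ 2) ^ (-(2 * δ)) = (1 + ‖z‖ ^ 2) ^ (-δ) * (1 + ‖z‖ ^ 2) ^ (-δ) := by
    rw [← Real.rpow_add (one_add_norm_sq_pos z)]; ring_nf
  rw [← add_mul, nearSingularity_of_le hxy, decayWeight, decayWeight,
    ← ENNReal.ofReal_add (by positivity) (by positivity), ← ENNReal.ofReal_mul (by positivity),
    sq_weight, sq_weight, mul_right_comm]
  gcongr
  nlinarith [sq_nonneg ((1 + ‖x‖ ^ 2) ^ (-δ) - (1 + ‖y‖ ^ 2) ^ (-δ))]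

theorem weighted_rpow_norm_le_far (x y : EuclideanSpace ℝ (Fin n)) (hxy : 1 ≤ ‖x - y‖) {m : ℝ}
    (hm : 0 ≤ m) (hδ : 0 < δ) (hmδ : m ≤ 4 * δ) :
    ENNReal.ofReal ((1 + ‖x‖ ^ 2) ^ (-δ) * ‖x - y‖ ^ (-m) * (1 + ‖y‖ ^ 2) ^ (-δ))
      ≤ ENNReal.ofReal (2 ^ (m / 2)) *
        (decayWeight n (δ + m / 4) x * decayWeight n (δ + m / 4) y
          + decayWeight n (δ + m / 4) x * decayWeight n (δ + m / 4) (x - y)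
          + decayWeight n (δ + m / 4) y * decayWeight n (δ + m / 4) (x - y)) := by
  simp only [decayWeight]
  rw [← ENNReal.ofReal_mul (by positivity), ← ENNReal.ofReal_mul (by positivity),
    ← ENNReal.ofReal_mul (by positivity), ← ENNReal.ofReal_add (by positivity) (by positivity),
    ← ENNReal.ofReal_add (by positivity) (by positivity), ← ENNReal.ofReal_mul (by positivity)]
  refine ENNReal.ofReal_le_ofReal ?_
  calc (1 + ‖x‖ ^ 2) ^ (-δ) * ‖x - y‖ ^ (-m) * (1 + ‖y‖ ^ 2) ^ (-δ)
      ≤ (1 + ‖x‖ ^ 2) ^ (-δ) * (2 ^ (m / 2) * (1 + ‖x - y‖ ^ 2) ^ (-(m / 2)))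
          * (1 + ‖y‖ ^ 2) ^ (-δ) := by gcongr; exact rpow_neg_norm_le_bracket hxy hm
    _ = 2 ^ (m / 2) * ((1 + ‖x‖ ^ 2) ^ (-δ) * (1 + ‖x - y‖ ^ 2) ^ (-(m / 2))
          * (1 + ‖y‖ ^ 2) ^ (-δ)) := by ring
    _ ≤ _ := by
        gcongr
        exact rpow_mul_rpow_mul_rpow_le (one_add_norm_sq_pos x) (one_add_norm_sq_pos y)
          (one_add_norm_sq_pos (x - y)) hm hδ hmδ

theorem lintegral_lintegral_near_lt_top (hn : 0 < n) {s : ℝ} (hs : (n : ℝ) < 2 * s) :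
    ∫⁻ x, ∫⁻ y, (decayWeight n s x * ENNReal.ofReal (nearSingularity n 1 (x - y))
      + decayWeight n s y * ENNReal.ofReal (nearSingularity n 1 (x - y))) < ⊤ := by
  have weight_fin := lintegral_decayWeight_lt_top hs
  have singularity_fin : ∫⁻ x, ENNReal.ofReal (nearSingularity n 1 x) < ⊤ := by
    rw [lintegral_nearSingularity hn zero_le_one]; exact ENNReal.ofReal_lt_top
  refine lintegral_lintegral_add_lt_top (by fun_prop) ?_ ?_
  · rw [lintegral_lintegral_mul_sub_left (by fun_prop)
      (measurable_nearSingularity 1).ennreal_ofReal]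
    exact ENNReal.mul_lt_top weight_fin singularity_fin
  · rw [lintegral_lintegral_mul_sub_right (by fun_prop)
      (measurable_nearSingularity 1).ennreal_ofReal]
    exact ENNReal.mul_lt_top weight_fin singularity_fin

theorem lintegral_lintegral_far_lt_top {s : ℝ} (hs : (n : ℝ) < 2 * s) {c : ℝ≥0∞} (hc : c ≠ ⊤) :
    ∫⁻ x, ∫⁻ y, c * (decayWeight n s x * decayWeight n s y
      + decayWeight n s x * decayWeight n s (x - y)
      + decayWeight n s y * decayWeight n s (x - y)) < ⊤ := by
  simp_rw [lintegral_const_mul' c _ hc]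
  have weight_fin := lintegral_decayWeight_lt_top hs
  have hm := measurable_decayWeight (n := n) s
  refine ENNReal.mul_lt_top hc.lt_top (lintegral_lintegral_add_lt_top (by fun_prop)
    (lintegral_lintegral_add_lt_top (by fun_prop) ?_ ?_) ?_)
  · rw [lintegral_lintegral_mul hm.aemeasurable hm.aemeasurable]; finiteness
  · rw [lintegral_lintegral_mul_sub_left hm hm]; finiteness
  · rw [lintegral_lintegral_mul_sub_right hm hm]; finiteness

theorem lintegral_lintegral_weighted_lt_top (hn : 0 < n) (hδ : (n : ℝ) + 1 < 4 * δ) :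
    ∫⁻ x : EuclideanSpace ℝ (Fin n), ∫⁻ y : EuclideanSpace ℝ (Fin n),
      ENNReal.ofReal ((1 + ‖x‖ ^ 2) ^ (-δ) * ‖x - y‖ ^ (-((n : ℝ) - 1)) * (1 + ‖y‖ ^ 2) ^ (-δ))
      < ⊤ := by
  have hn' : (1 : ℝ) ≤ n := by exact_mod_cast hn
  have near := lintegral_lintegral_near_lt_top hn (show (n : ℝ) < 2 * (2 * δ) by linarith)
  have far := lintegral_lintegral_far_lt_top
    (show (n : ℝ) < 2 * (δ + ((n : ℝ) - 1) / 4) by linarith)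
    (ENNReal.ofReal_ne_top (r := 2 ^ (((n : ℝ) - 1) / 2)))
  refine (lintegral_mono fun x => lintegral_mono fun y => ?_).trans_lt
    (lintegral_lintegral_add_lt_top (by fun_prop) near far)
  rcases le_total ‖x - y‖ 1 with hxy | hxy
  · exact (weighted_rpow_norm_le_near x y hxy).trans le_self_add
  · exact (weighted_rpow_norm_le_far x y hxy (by linarith) (by linarith) (by linarith)).trans
      le_add_self

end Weights

section WeightedKernels

open scoped NNReal
open Set

variable {n : ℕ} {δ : ℝ} {K : EuclideanSpace ℝ (Fin n) → ℂ}

theorem lintegral_weightedVolume (σ : ℝ) {g : EuclideanSpace ℝ (Fin n) → ℝ≥0∞}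
    (hg : Measurable g) :
    ∫⁻ x, g x ∂weightedVolume n σ = ∫⁻ x, ENNReal.ofReal ((1 + ‖x‖ ^ 2) ^ σ) * g x := by
  rw [weightedVolume, lintegral_withDensity_eq_lintegral_mul _
    (measurable_bracket σ).ennreal_ofReal hg]
  rfl

instance sFinite_weightedVolume (σ : ℝ) : SFinite (weightedVolume n σ) := by
  rw [weightedVolume]
  infer_instance

theorem weightedVolume_le {σ : ℝ} (hσ : σ ≤ 0) : weightedVolume n σ ≤ volume := by
  refine Measure.le_iff.2 fun s hs => ?_
  rw [weightedVolume, withDensity_apply _ hs]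
  refine (lintegral_mono (g := fun _ => 1) fun x => ?_).trans (by simp)
  exact ENNReal.ofReal_le_one.2 (bracket_rpow_le_one x hσ)

/-- The kernel `K(x - y) ⟨y⟩^{-δ}` on `L²`: convolution with `K`, once `L²_δ` is identified with
`L²` through multiplication by `⟨y⟩^δ`. -/
noncomputable def weightedKernel (K : EuclideanSpace ℝ (Fin n) → ℂ) (δ : ℝ)
    (x y : EuclideanSpace ℝ (Fin n)) : ℂ :=
  K (x - y) * (((1 + ‖y‖ ^ 2) ^ (-(δ / 2)) : ℝ) : ℂ)

theorem norm_weightedKernel (x y : EuclideanSpace ℝ (Fin n)) :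
    ‖weightedKernel K δ x y‖ = ‖K (x - y)‖ * (1 + ‖y‖ ^ 2) ^ (-(δ / 2)) := by
  rw [weightedKernel, norm_mul, norm_real, Real.norm_of_nonneg (by positivity)]

theorem weightedKernel_add (K K' : EuclideanSpace ℝ (Fin n) → ℂ) (δ : ℝ) :
    weightedKernel (K + K') δ = weightedKernel K δ + weightedKernel K' δ := by
  funext x y
  simp only [weightedKernel, Pi.add_apply, add_mul]

theorem measurable_weightedKernel (hK : Measurable K) (δ : ℝ) :
    Measurable (Function.uncurry (weightedKernel K δ)) :=
  (hK.comp (measurable_fst.sub measurable_snd)).mul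
    (measurable_ofReal.comp ((measurable_bracket _).comp measurable_snd))

theorem norm_weightedKernel_sq_le {C : ℝ}
    (hKC : ∀ z, ‖K z‖ ≤ C * ‖z‖ ^ (-(((n : ℝ) - 1) / 2))) (x y : EuclideanSpace ℝ (Fin n)) :
    ‖weightedKernel K δ x y‖ ^ 2
      ≤ C ^ 2 * ‖x - y‖ ^ (-((n : ℝ) - 1)) * (1 + ‖y‖ ^ 2) ^ (-δ) := by
  have rpow_half_sq (t s : ℝ) (ht : 0 ≤ t) : (t ^ (-(s / 2))) ^ 2 = t ^ (-s) := by
    rw [← Real.rpow_natCast, ← Real.rpow_mul ht]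
    ring_nf
  rw [norm_weightedKernel, mul_pow, rpow_half_sq _ δ (one_add_norm_sq_pos y).le]
  gcongr
  calc ‖K (x - y)‖ ^ 2 ≤ (C * ‖x - y‖ ^ (-(((n : ℝ) - 1) / 2))) ^ 2 :=
        pow_le_pow_left₀ (norm_nonneg _) (hKC _) 2
    _ = C ^ 2 * ‖x - y‖ ^ (-((n : ℝ) - 1)) := by
        rw [mul_pow, rpow_half_sq _ _ (norm_nonneg _)]

theorem lintegral_sq_weightedKernel_lt_top (hn : 0 < n) (hδ : (n : ℝ) + 1 < 4 * δ)
    (hK : Measurable K) {C : ℝ} (hKC : ∀ z, ‖K z‖ ≤ C * ‖z‖ ^ (-(((n : ℝ) - 1) / 2))) :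
    ∫⁻ x, ∫⁻ y, ‖weightedKernel K δ x y‖ₑ ^ 2 ∂volume ∂weightedVolume n (-δ) < ⊤ := by
  rw [lintegral_weightedVolume _ (measurable_lintegral_enorm_sq (measurable_weightedKernel hK δ))]
  refine lt_of_le_of_lt ?_ (ENNReal.mul_lt_top (ENNReal.ofReal_lt_top (r := C ^ 2))
    (lintegral_lintegral_weighted_lt_top hn hδ))
  simp_rw [← lintegral_const_mul' _ _ ENNReal.ofReal_ne_top]
  refine lintegral_mono fun x => lintegral_mono fun y => ?_
  rw [← ofReal_norm, ← ENNReal.ofReal_pow (norm_nonneg _), ← ENNReal.ofReal_mul (by positivity),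
    ← ENNReal.ofReal_mul (by positivity)]
  refine ENNReal.ofReal_le_ofReal ?_
  calc (1 + ‖x‖ ^ 2) ^ (-δ) * ‖weightedKernel K δ x y‖ ^ 2
      ≤ (1 + ‖x‖ ^ 2) ^ (-δ) * (C ^ 2 * ‖x - y‖ ^ (-((n : ℝ) - 1)) * (1 + ‖y‖ ^ 2) ^ (-δ)) := by
        gcongr; exact norm_weightedKernel_sq_le hKC x y
    _ = _ := by ring

theorem isL2Kernel_weightedKernel_of_le_nearSingularity (hn : 0 < n) (hδ : 0 ≤ δ)
    (hK : Measurable K) {C ε : ℝ} (hε : 0 ≤ ε) (hC : 0 ≤ C)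
    (hKC : ∀ z, ‖K z‖ ≤ C * nearSingularity n ε z) {D : ℝ≥0}
    (hD : C * (n * (volume.real (Metric.ball (0 : EuclideanSpace ℝ (Fin n)) 1) * ε)) ≤ D) :
    IsL2Kernel (weightedVolume n (-δ)) volume (weightedKernel K δ) D := by
  set S : EuclideanSpace ℝ (Fin n) → ℝ≥0∞ := fun x => ENNReal.ofReal (C * nearSingularity n ε x)
  have kernel_le (x y) : ‖weightedKernel K δ x y‖ₑ ≤ S (x - y) := by
    rw [← ofReal_norm, norm_weightedKernel]
    refine ENNReal.ofReal_le_ofReal ((mul_le_of_le_one_right (norm_nonneg _) ?_).trans (hKC _))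
    exact bracket_rpow_le_one y (by linarith)
  have lintegral_S_le : ∫⁻ x, S x ≤ D := by
    simp only [S, ENNReal.ofReal_mul hC]
    rw [lintegral_const_mul' _ _ ENNReal.ofReal_ne_top, lintegral_nearSingularity hn hε,
      ← ENNReal.ofReal_mul hC]
    exact ENNReal.ofReal_le_of_le_toReal hD
  refine IsL2Kernel.of_schur (measurable_weightedKernel hK δ) (fun x => ?_) fun y => ?_
  · exact (lintegral_mono fun y => kernel_le x y).trans
      ((lintegral_sub_left_eq_self S x).trans_le lintegral_S_le)
  · exact (lintegral_mono' (weightedVolume_le (by linarith)) fun x => kernel_le x y).trans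
      ((lintegral_sub_right_eq_self S y).trans_le lintegral_S_le)

theorem rpow_neg_half_le_rpow_neg {r m : ℝ} (hr : 0 ≤ r) (hr' : r ≤ 1) (hm : 0 ≤ m) :
    r ^ (-(m / 2)) ≤ r ^ (-m) := by
  rcases hr.eq_or_lt with rfl | hr
  · rcases hm.eq_or_lt with rfl | hm
    · simp
    · rw [Real.zero_rpow (by linarith), Real.zero_rpow (by linarith)]
  · exact Real.rpow_le_rpow_of_exponent_ge hr hr' (by linarith)

theorem rpow_neg_le_rpow_neg_half {ε r m : ℝ} (hε : 0 < ε) (hr : ε ≤ r) (hm : 0 ≤ m) :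
    r ^ (-m) ≤ ε ^ (-(m / 2)) * r ^ (-(m / 2)) := by
  have hr_pos : 0 < r := hε.trans_le hr
  calc r ^ (-m) = r ^ (-(m / 2)) * r ^ (-(m / 2)) := by rw [← Real.rpow_add hr_pos]; ring_nf
    _ ≤ ε ^ (-(m / 2)) * r ^ (-(m / 2)) := by
        gcongr ?_ * _
        exact Real.rpow_le_rpow_of_nonpos hε hr (by linarith)

variable {C : ℝ}

theorem norm_indicator_closedBall_le_nearSingularity (hn : 0 < n) (hC : 0 ≤ C)
    (hKC : ∀ z, ‖K z‖ ≤ C * (‖z‖ ^ (-((n : ℝ) - 1)) + ‖z‖ ^ (-(((n : ℝ) - 1) / 2)))) {ε : ℝ}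
    (hε : ε ≤ 1) (z : EuclideanSpace ℝ (Fin n)) :
    ‖(Metric.closedBall 0 ε).indicator K z‖ ≤ 2 * C * nearSingularity n ε z := by
  have hn' : (1 : ℝ) ≤ n := by exact_mod_cast hn
  by_cases hz : z ∈ Metric.closedBall (0 : EuclideanSpace ℝ (Fin n)) ε
  · have hz' : ‖z‖ ≤ ε := mem_closedBall_zero_iff.1 hz
    rw [indicator_of_mem hz, nearSingularity_of_le hz']
    calc ‖K z‖ ≤ C * (‖z‖ ^ (-((n : ℝ) - 1)) + ‖z‖ ^ (-(((n : ℝ) - 1) / 2))) := hKC z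
      _ ≤ C * (‖z‖ ^ (-((n : ℝ) - 1)) + ‖z‖ ^ (-((n : ℝ) - 1))) := by
          gcongr C * (_ + ?_)
          exact rpow_neg_half_le_rpow_neg (norm_nonneg z) (hz'.trans hε) (by linarith)
      _ = 2 * C * ‖z‖ ^ (-((n : ℝ) - 1)) := by ring
  · rw [indicator_of_notMem hz, norm_zero]
    exact mul_nonneg (by positivity) (nearSingularity_nonneg ε z)

theorem norm_indicator_compl_closedBall_le (hn : 0 < n) (hC : 0 ≤ C)
    (hKC : ∀ z, ‖K z‖ ≤ C * (‖z‖ ^ (-((n : ℝ) - 1)) + ‖z‖ ^ (-(((n : ℝ) - 1) / 2)))) {ε : ℝ}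
    (hε : 0 < ε) (z : EuclideanSpace ℝ (Fin n)) :
    ‖(Metric.closedBall 0 ε)ᶜ.indicator K z‖
      ≤ C * (ε ^ (-(((n : ℝ) - 1) / 2)) + 1) * ‖z‖ ^ (-(((n : ℝ) - 1) / 2)) := by
  have hn' : (1 : ℝ) ≤ n := by exact_mod_cast hn
  by_cases hz : z ∈ (Metric.closedBall (0 : EuclideanSpace ℝ (Fin n)) ε)ᶜ
  · have hz' : ε ≤ ‖z‖ := (not_le.1 fun h => hz (mem_closedBall_zero_iff.2 h)).le
    rw [indicator_of_mem hz, mul_assoc, add_mul, one_mul]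
    refine (hKC z).trans ?_
    gcongr C * (?_ + _)
    exact rpow_neg_le_rpow_neg_half hε hz' (by linarith)
  · rw [indicator_of_notMem hz, norm_zero]
    positivity

theorem exists_isCompactOperator_weightedKernel (hn : 0 < n) (hδ : (n : ℝ) + 1 < 4 * δ)
    (hK : Measurable K) (hC : 0 ≤ C)
    (hKC : ∀ z, ‖K z‖ ≤ C * (‖z‖ ^ (-((n : ℝ) - 1)) + ‖z‖ ^ (-(((n : ℝ) - 1) / 2)))) :
    ∃ (D : ℝ≥0) (h : IsL2Kernel (weightedVolume n (-δ)) volume (weightedKernel K δ) D),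
      IsCompactOperator h.toCLM := by
  refine IsL2Kernel.exists_isCompactOperator_of_forall_eq_add fun D hD => ?_
  set c := 2 * C * (n * volume.real (Metric.ball (0 : EuclideanSpace ℝ (Fin n)) 1))
  have hc : 0 ≤ c := by positivity
  set ε := min 1 (D / (c + 1) : ℝ)
  have hε : 0 < ε := by positivity
  have hcε : c * ε ≤ D := calc
    c * ε ≤ (c + 1) * (D / (c + 1)) := by
      gcongr
      · linarith
      · exact min_le_right _ _
    _ = D := by field_simp
  have hδ' : 0 ≤ δ := by linarith [(n.cast_nonneg : (0 : ℝ) ≤ n)]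
  have near_bound :=
    norm_indicator_closedBall_le_nearSingularity hn hC hKC (min_le_left _ _ : ε ≤ 1)
  have far_measurable := hK.indicator (measurableSet_closedBall (x := 0) (ε := ε)).compl
  refine ⟨weightedKernel ((Metric.closedBall 0 ε).indicator K) δ,
    weightedKernel ((Metric.closedBall 0 ε)ᶜ.indicator K) δ, ?_,
    isL2Kernel_weightedKernel_of_le_nearSingularity hn hδ' (hK.indicator measurableSet_closedBall)
      hε.le (by positivity) near_bound ?_, measurable_weightedKernel far_measurable δ,
    lintegral_sq_weightedKernel_lt_top hn hδ far_measurable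
      (norm_indicator_compl_closedBall_le hn hC hKC hε)⟩
  · rw [← weightedKernel_add, indicator_self_add_compl]
  · calc 2 * C * (n * (volume.real (Metric.ball (0 : EuclideanSpace ℝ (Fin n)) 1) * ε))
        = c * ε := by ring
      _ ≤ D := hcε

end WeightedKernels

/-! ### Mollification and weak products -/

section Mollification

open scoped NNReal Topology
open Filter Set

theorem tendsto_zero_of_add_le_of_le_liminf {a b : ℕ → ℝ≥0∞} {c : ℝ≥0∞} (hc : c ≠ ⊤)
    (hab : ∀ i, a i + b i ≤ c) (ha : c ≤ liminf a atTop) : Tendsto b atTop (𝓝 0) := by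
  rw [ENNReal.tendsto_nhds_zero]
  intro ε hε
  rcases eq_or_ne c 0 with rfl | hc0
  · exact Eventually.of_forall fun i => (le_add_self.trans (hab i)).trans zero_le
  · have hlt : c - ε < liminf a atTop := (ENNReal.sub_lt_self hc hc0 hε.ne').trans_le ha
    filter_upwards [eventually_lt_of_lt_liminf hlt] with i hi
    have ha_top : a i ≠ ⊤ := ne_top_of_le_ne_top hc (le_self_add.trans (hab i))
    exact (ENNReal.add_le_add_iff_left ha_top).1 ((hab i).trans (tsub_le_iff_right.1 hi.le))

variable {X : Type*} [MeasurableSpace X] {μ : Measure X}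

-- Fatou, applied to `G i - F i`.
theorem tendsto_lintegral_zero_of_le {F G : ℕ → X → ℝ≥0∞} {H : X → ℝ≥0∞}
    (hF : ∀ i, AEMeasurable (F i) μ) (hG : ∀ i, AEMeasurable (G i) μ) (hFG : ∀ i x, F i x ≤ G i x)
    (hFlim : ∀ᵐ x ∂μ, Tendsto (fun i => F i x) atTop (𝓝 0))
    (hGlim : ∀ᵐ x ∂μ, Tendsto (fun i => G i x) atTop (𝓝 (H x)))
    (hGH : ∀ i, ∫⁻ x, G i x ∂μ ≤ ∫⁻ x, H x ∂μ) (hH : ∫⁻ x, H x ∂μ ≠ ⊤) :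
    Tendsto (fun i => ∫⁻ x, F i x ∂μ) atTop (𝓝 0) := by
  have hmeas : ∀ i, AEMeasurable (fun x => G i x - F i x) μ := fun i => (hG i).sub (hF i)
  refine tendsto_zero_of_add_le_of_le_liminf (a := fun i => ∫⁻ x, G i x - F i x ∂μ) hH
    (fun i => ?_) ?_
  · rw [← lintegral_add_left' (hmeas i)]
    exact (lintegral_congr fun x => tsub_add_cancel_of_le (hFG i x)).trans_le (hGH i)
  · refine le_trans (lintegral_mono_ae ?_) (lintegral_liminf_le' hmeas)
    filter_upwards [hFlim, hGlim] with x hFx hGx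
    have hsub : Tendsto (fun i => G i x - F i x) atTop (𝓝 (H x - 0)) :=
      ENNReal.Tendsto.sub hGx hFx (Or.inr ENNReal.zero_ne_top)
    rw [hsub.liminf_eq, tsub_zero]

theorem enorm_sub_sq_le {F : Type*} [SeminormedAddCommGroup F] (a b : F) :
    ‖a - b‖ₑ ^ 2 ≤ 2 * ‖b‖ₑ ^ 2 + 2 * ‖a‖ₑ ^ 2 := by
  have h : ‖a - b‖ ^ 2 ≤ 2 * ‖b‖ ^ 2 + 2 * ‖a‖ ^ 2 := by
    have := pow_le_pow_left₀ (norm_nonneg _) (norm_sub_le a b) 2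
    nlinarith [sq_nonneg (‖a‖ - ‖b‖)]
  simp only [← ofReal_norm, ← ENNReal.ofReal_pow (norm_nonneg _)]
  rw [← ENNReal.ofReal_ofNat 2, ← ENNReal.ofReal_mul (by norm_num),
    ← ENNReal.ofReal_mul (by norm_num), ← ENNReal.ofReal_add (by positivity) (by positivity)]
  exact ENNReal.ofReal_le_ofReal h

theorem tendsto_eLpNorm_two_sub_of_ae {F : Type*} [NormedAddCommGroup F] {f : ℕ → X → F}
    {g : X → F} (hf : ∀ i, AEStronglyMeasurable (f i) μ) (hg : MemLp g 2 μ)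
    (hle : ∀ i, eLpNorm (f i) 2 μ ≤ eLpNorm g 2 μ)
    (hlim : ∀ᵐ x ∂μ, Tendsto (fun i => f i x) atTop (𝓝 (g x))) :
    Tendsto (fun i => eLpNorm (f i - g) 2 μ) atTop (𝓝 0) := by
  have hgm : AEMeasurable (fun x => 2 * ‖g x‖ₑ ^ 2) μ := (hg.1.enorm.pow_const 2).const_mul 2
  have hsq : Tendsto (fun i => ∫⁻ x, ‖f i x - g x‖ₑ ^ 2 ∂μ) atTop (𝓝 0) := by
    refine tendsto_lintegral_zero_of_le (G := fun i x => 2 * ‖g x‖ₑ ^ 2 + 2 * ‖f i x‖ₑ ^ 2)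
      (H := fun x => 2 * ‖g x‖ₑ ^ 2 + 2 * ‖g x‖ₑ ^ 2)
      (fun i => ((hf i).sub hg.1).enorm.pow_const 2)
      (fun i => hgm.add (((hf i).enorm.pow_const 2).const_mul 2))
      (fun i x => enorm_sub_sq_le _ _) ?_ ?_ (fun i => ?_) ?_
    · filter_upwards [hlim] with x hx
      have := (ENNReal.continuous_pow 2).continuousAt.tendsto.comp (hx.sub_const (g x)).enorm
      simpa [Function.comp_def] using this
    · filter_upwards [hlim] with x hx
      exact tendsto_const_nhds.add (ENNReal.Tendsto.const_mul
        ((ENNReal.continuous_pow 2).continuousAt.tendsto.comp hx.enorm) (Or.inr (by simp)))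
    · rw [lintegral_add_left' hgm, lintegral_add_left' hgm, lintegral_const_mul' _ _ (by simp),
        lintegral_const_mul' _ _ (by simp), ← eLpNorm_two_sq, ← eLpNorm_two_sq]
      gcongr
      exact hle i
    · rw [lintegral_add_left' hgm, lintegral_const_mul' _ _ (by simp), ← eLpNorm_two_sq]
      simp [ENNReal.mul_eq_top, hg.2.ne]
  have hroot := (ENNReal.continuous_rpow_const (y := (1 / 2 : ℝ))).continuousAt.tendsto.comp hsq
  rw [ENNReal.zero_rpow_of_pos (by norm_num)] at hroot
  refine hroot.congr fun i => ?_
  have hnorm := eLpNorm_two_sq (μ := μ) (f i - g)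
  simp only [Pi.sub_apply] at hnorm
  rw [Function.comp_apply, ← hnorm, ← ENNReal.rpow_natCast, ← ENNReal.rpow_mul]
  norm_num

variable {n : ℕ}

/-- A sequence of bump functions that shrinks to the origin, used as an approximate identity. -/
noncomputable def shrinkingBump (n i : ℕ) : ContDiffBump (0 : EuclideanSpace ℝ (Fin n)) :=
  ⟨1 / ((i : ℝ) + 1), 2 / ((i : ℝ) + 1), by positivity, by gcongr; norm_num⟩

/-- Mollification of `u` at scale `2 / (i + 1)`. -/
noncomputable def mollify (i : ℕ) (u : EuclideanSpace ℝ (Fin n) → ℂ) :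
    EuclideanSpace ℝ (Fin n) → ℂ :=
  convolution ((shrinkingBump n i).normed volume) u (ContinuousLinearMap.lsmul ℝ ℝ) volume

theorem mollify_apply (i : ℕ) (u : EuclideanSpace ℝ (Fin n) → ℂ) (x : EuclideanSpace ℝ (Fin n)) :
    mollify i u x = ∫ y, (shrinkingBump n i).normed volume (x - y) • u y := by
  rw [mollify, convolution_eq_swap]
  rfl

theorem contDiff_mollify (i : ℕ) {u : EuclideanSpace ℝ (Fin n) → ℂ} (hu : LocallyIntegrable u) :
    ContDiff ℝ ∞ (mollify i u) :=
  ((shrinkingBump n i).hasCompactSupport_normed (μ := volume)).contDiff_convolution_left _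
    ((shrinkingBump n i).contDiff_normed) hu

theorem ae_tendsto_mollify {u : EuclideanSpace ℝ (Fin n) → ℂ} (hu : LocallyIntegrable u) :
    ∀ᵐ x, Tendsto (fun i => mollify i u x) atTop (𝓝 (u x)) := by
  refine ContDiffBump.ae_convolution_tendsto_right_of_locallyIntegrable (K := 2)
    (φ := fun i => shrinkingBump n i) ?_ (Eventually.of_forall fun i => ?_) hu
  · have := (tendsto_one_div_add_atTop_nhds_zero_nat (𝕜 := ℝ)).const_mul 2
    rw [mul_zero] at this
    refine this.congr fun i => ?_
    simp [shrinkingBump, div_eq_mul_inv]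
  · simp [shrinkingBump, div_eq_mul_inv]

theorem lintegral_enorm_normed {E : Type*} [NormedAddCommGroup E] [NormedSpace ℝ E]
    [HasContDiffBump E] [MeasurableSpace E] [BorelSpace E] [FiniteDimensional ℝ E]
    {ν : Measure E} [IsLocallyFiniteMeasure ν] [ν.IsOpenPosMeasure] {c : E} (ρ : ContDiffBump c) :
    ∫⁻ z, ‖ρ.normed ν z‖ₑ ∂ν = 1 := by
  have h := ofReal_integral_eq_lintegral_ofReal (ρ.integrable_normed (μ := ν))
    (Eventually.of_forall ρ.nonneg_normed)
  rw [ρ.integral_normed, ENNReal.ofReal_one] at h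
  rw [h]
  exact lintegral_congr fun z => Real.enorm_of_nonneg (ρ.nonneg_normed z)

theorem isL2Kernel_normed {c : EuclideanSpace ℝ (Fin n)} (ρ : ContDiffBump c) :
    IsL2Kernel (volume : Measure (EuclideanSpace ℝ (Fin n))) volume
      (fun x y => ((ρ.normed volume (x - y) : ℝ) : ℂ)) 1 := by
  have hm : Measurable (ρ.normed volume) := ρ.continuous_normed.measurable
  have henorm : ∀ r : ℝ, ‖(r : ℂ)‖ₑ = ‖r‖ₑ := fun r => by simp [← ofReal_norm]
  refine IsL2Kernel.of_schur (by fun_prop) (fun x => ?_) fun y => ?_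
  · simp only [henorm]
    rw [lintegral_sub_left_eq_self (fun z => ‖ρ.normed volume z‖ₑ) x, lintegral_enorm_normed,
      ENNReal.coe_one]
  · simp only [henorm]
    rw [lintegral_sub_right_eq_self (fun z => ‖ρ.normed volume z‖ₑ) y, lintegral_enorm_normed,
      ENNReal.coe_one]

theorem eLpNorm_mollify_le (i : ℕ) {u : EuclideanSpace ℝ (Fin n) → ℂ} (hu : MemLp u 2) :
    eLpNorm (mollify i u) 2 ≤ eLpNorm u 2 := by
  have h := (isL2Kernel_normed (shrinkingBump n i)).eLpNorm_integral_le (hu.toLp u)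
  rw [ENNReal.coe_one, one_mul, eLpNorm_congr_ae hu.coeFn_toLp] at h
  convert h using 3 with x
  rw [mollify_apply]
  refine integral_congr_ae ?_
  filter_upwards [hu.coeFn_toLp] with y hy
  rw [hy, Complex.real_smul]

theorem memLp_mollify (i : ℕ) {u : EuclideanSpace ℝ (Fin n) → ℂ} (hu : MemLp u 2) :
    MemLp (mollify i u) 2 :=
  ⟨(contDiff_mollify i (hu.locallyIntegrable one_le_two)).continuous.aestronglyMeasurable,
    (eLpNorm_mollify_le i hu).trans_lt hu.2⟩

theorem tendsto_eLpNorm_mollify_sub {u : EuclideanSpace ℝ (Fin n) → ℂ} (hu : MemLp u 2) :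
    Tendsto (fun i => eLpNorm (mollify i u - u) 2) atTop (𝓝 0) :=
  tendsto_eLpNorm_two_sub_of_ae (fun i => (memLp_mollify i hu).1) hu
    (fun i => eLpNorm_mollify_le i hu) (ae_tendsto_mollify (hu.locallyIntegrable one_le_two))

theorem fderiv_comp_const_sub {E F : Type*} [NormedAddCommGroup E] [NormedSpace ℝ E]
    [NormedAddCommGroup F] [NormedSpace ℝ F] {ρ : E → F} (hρ : Differentiable ℝ ρ) (x y e : E) :
    fderiv ℝ (fun z => ρ (x - z)) y e = -fderiv ℝ ρ (x - y) e := by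
  have h := (hρ (x - y)).hasFDerivAt.comp y ((hasFDerivAt_id y).const_sub x)
  rw [show fderiv ℝ (fun z => ρ (x - z)) y = _ from h.fderiv]
  simp

theorem fderiv_mollify {j : Fin n} {u v : EuclideanSpace ℝ (Fin n) → ℂ}
    (h : HasWeakPartial j u v) (i : ℕ) (x : EuclideanSpace ℝ (Fin n)) :
    fderiv ℝ (mollify i u) x (EuclideanSpace.single j 1) = mollify i v x := by
  set ρ := (shrinkingBump n i).normed volume
  have hρc : HasCompactSupport ρ := (shrinkingBump n i).hasCompactSupport_normed
  have hρs : ContDiff ℝ ∞ ρ := (shrinkingBump n i).contDiff_normed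
  have hd := hρc.hasFDerivAt_convolution_left (ContinuousLinearMap.lsmul ℝ ℝ : ℝ →L[ℝ] ℂ →L[ℝ] ℂ)
    (hρs.of_le (by simp)) h.1 x
  have hex : ConvolutionExistsAt (fderiv ℝ ρ) u x
      ((ContinuousLinearMap.lsmul ℝ ℝ : ℝ →L[ℝ] ℂ →L[ℝ] ℂ).precompL (EuclideanSpace ℝ (Fin n)))
      volume := (hρc.fderiv ℝ).convolutionExists_left _ (hρs.continuous_fderiv (by simp)) h.1 x
  have hweak := h.2.2 (fun y => ρ (x - y)) (hρs.comp (contDiff_const.sub contDiff_id))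
    (hρc.comp_homeomorph (Homeomorph.subLeft x))
  simp only [fderiv_comp_const_sub (hρs.differentiable (by simp)), neg_smul, integral_neg,
    neg_inj] at hweak
  rw [show mollify i u = convolution ρ u (ContinuousLinearMap.lsmul ℝ ℝ) volume from rfl,
    hd.fderiv, convolution_eq_swap, ContinuousLinearMap.integral_apply
      (by simpa using hex.integrable_swap), mollify_apply]
  exact hweak

theorem support_mollify_subset (i : ℕ) {u : EuclideanSpace ℝ (Fin n) → ℂ} {R : ℝ}
    (hu : Function.support u ⊆ Metric.closedBall 0 R) :
    Function.support (mollify i u) ⊆ Metric.closedBall 0 (R + 2) := by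
  refine (support_convolution_subset _).trans ?_
  rintro _ ⟨a, ha, b, hb, rfl⟩
  rw [(shrinkingBump n i).support_normed_eq] at ha
  have ha' : ‖a‖ ≤ 2 := by
    have h1 : ‖a‖ < 2 / ((i : ℝ) + 1) := by simpa [shrinkingBump] using ha
    refine h1.le.trans (div_le_self (by norm_num) ?_)
    linarith [(Nat.cast_nonneg i : (0 : ℝ) ≤ i)]
  have hb' : ‖b‖ ≤ R := by simpa using hu hb
  rw [mem_closedBall_zero_iff]
  linarith [norm_add_le a b]

end Mollification

section WeakProducts

open scoped NNReal Topology
open Filter Set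

variable {n : ℕ} {F : Type} [NormedAddCommGroup F]

theorem MemLocalLp.mono_exponent {f : EuclideanSpace ℝ (Fin n) → F} {p q : ℝ≥0∞}
    (h : MemLocalLp f q) (hpq : p ≤ q) : MemLocalLp f p := fun K hK => by
  have : IsFiniteMeasure (volume.restrict K) := ⟨by simpa using hK.measure_lt_top⟩
  exact (h K hK).mono_exponent hpq

theorem MemLocalLp.aestronglyMeasurable {f : EuclideanSpace ℝ (Fin n) → F} {p : ℝ≥0∞}
    (h : MemLocalLp f p) : AEStronglyMeasurable f := by
  have hcover : (⋃ m : ℕ, Metric.closedBall (0 : EuclideanSpace ℝ (Fin n)) m) = univ :=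
    Metric.iUnion_closedBall_nat 0
  rw [← Measure.restrict_univ (μ := volume), ← hcover, aestronglyMeasurable_iUnion_iff]
  exact fun m => (h _ (isCompact_closedBall _ _)).1

theorem MemLocalLp.locallyIntegrable {f : EuclideanSpace ℝ (Fin n) → F} {p : ℝ≥0∞}
    (h : MemLocalLp f p) (hp : 1 ≤ p) : LocallyIntegrable f :=
  locallyIntegrable_iff.2 fun K hK => memLp_one_iff_integrable.1 (h.mono_exponent hp K hK)

theorem MemLocalLp.locallyIntegrable_mul {𝕜 : Type} [RCLike 𝕜]
    {f g : EuclideanSpace ℝ (Fin n) → 𝕜} (hf : MemLocalLp f 2) (hg : MemLocalLp g 2) :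
    LocallyIntegrable fun x => f x * g x :=
  locallyIntegrable_iff.2 fun K hK => (hf K hK).integrable_mul (hg K hK)

theorem MemLocalLp.memLp_smul [NormedSpace ℝ F] {f : EuclideanSpace ℝ (Fin n) → F} {p : ℝ≥0∞}
    (h : MemLocalLp f p) {χ : EuclideanSpace ℝ (Fin n) → ℝ} (hχ : Continuous χ)
    (hχc : HasCompactSupport χ) : MemLp (fun x => χ x • f x) p := by
  obtain ⟨M, hM⟩ := hχc.exists_bound_of_continuous hχ
  have hrestrict : MemLp (fun x => χ x • f x) p (volume.restrict (tsupport χ)) := by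
    refine (h _ hχc).of_le_mul (c := M) (hχ.aestronglyMeasurable.smul (h _ hχc).1)
      (Eventually.of_forall fun x => ?_)
    rw [norm_smul]
    gcongr
    exact hM x
  rw [← memLp_indicator_iff_restrict (isClosed_tsupport χ).measurableSet] at hrestrict
  refine hrestrict.ae_eq (Eventually.of_forall fun x => ?_)
  by_cases hx : x ∈ tsupport χ
  · simp [hx]
  · simp [hx, image_eq_zero_of_notMem_tsupport hx]

theorem tendsto_integral_mul_of_tendsto_eLpNorm {X 𝕜 : Type*} [RCLike 𝕜] [MeasurableSpace X]
    {μ : Measure X} {a b : X → 𝕜} {c : ℕ → X → 𝕜} (ha : MemLp a 2 μ) (hb : MemLp b 2 μ)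
    (hc : ∀ i, MemLp (c i) 2 μ) (h : Tendsto (fun i => eLpNorm (c i - b) 2 μ) atTop (𝓝 0)) :
    Tendsto (fun i => ∫ x, a x * c i x ∂μ) atTop (𝓝 (∫ x, a x * b x ∂μ)) := by
  refine tendsto_integral_of_L1 (fun x => a x * b x) (ha.integrable_mul hb).aestronglyMeasurable
    (Eventually.of_forall fun i => ha.integrable_mul (hc i)) ?_
  have hbound : ∀ i, ∫⁻ x, ‖a x * c i x - a x * b x‖ₑ ∂μ
      ≤ eLpNorm a 2 μ * eLpNorm (c i - b) 2 μ := fun i => by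
    have := eLpNorm_smul_le_mul_eLpNorm (p := 2) (q := 2) (r := 1) (μ := μ)
      ((hc i).1.sub hb.1) ha.1
    rw [eLpNorm_one_eq_lintegral_enorm] at this
    refine le_trans (le_of_eq (lintegral_congr fun x => ?_)) this
    simp [mul_sub]
  refine tendsto_of_tendsto_of_tendsto_of_le_of_le tendsto_const_nhds ?_ (fun _ => zero_le) hbound
  simpa using ENNReal.Tendsto.const_mul (a := eLpNorm a 2 μ) h (Or.inr ha.2.ne)

theorem continuous_fderiv_apply_const {E G : Type*} [NormedAddCommGroup E] [NormedSpace ℝ E]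
    [NormedAddCommGroup G] [NormedSpace ℝ G] {φ : E → G} (hφ : ContDiff ℝ ∞ φ) (e : E) :
    Continuous fun x => fderiv ℝ φ x e :=
  (hφ.continuous_fderiv (by simp)).clm_apply continuous_const

variable {j : Fin n} {u v : EuclideanSpace ℝ (Fin n) → ℂ}

theorem HasWeakPartial.ofReal {w dw : EuclideanSpace ℝ (Fin n) → ℝ} (h : HasWeakPartial j w dw) :
    HasWeakPartial j (fun x => (w x : ℂ)) fun x => (dw x : ℂ) := by
  have hloc : ∀ {g : EuclideanSpace ℝ (Fin n) → ℝ}, LocallyIntegrable g →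
      LocallyIntegrable fun x => (g x : ℂ) := fun hg =>
    hg.mono (continuous_ofReal.comp_aestronglyMeasurable hg.aestronglyMeasurable)
      (Eventually.of_forall fun x => by simp)
  refine ⟨hloc h.1, hloc h.2.1, fun φ hφ hφc => ?_⟩
  have hweak := congrArg (fun r : ℝ => (r : ℂ)) (h.2.2 φ hφ hφc)
  simpa only [smul_eq_mul, ofReal_neg, ← integral_complex_ofReal, ofReal_mul,
    ← Complex.real_smul] using hweak

theorem HasWeakPartial.smul_smooth (h : HasWeakPartial j u v) {χ : EuclideanSpace ℝ (Fin n) → ℝ}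
    (hχ : ContDiff ℝ ∞ χ) :
    HasWeakPartial j (fun x => χ x • u x)
      (fun x => χ x • v x + fderiv ℝ χ x (EuclideanSpace.single j 1) • u x) := by
  have hχu := h.1.continuous_smul hχ.continuous
  have hχv := h.2.1.continuous_smul hχ.continuous
  have hdχu := h.1.continuous_smul (continuous_fderiv_apply_const hχ (EuclideanSpace.single j 1))
  refine ⟨hχu, hχv.add hdχu, fun φ hφ hφc => ?_⟩
  have hprod : ∀ x, fderiv ℝ (fun x => φ x * χ x) x (EuclideanSpace.single j 1) • u x
      = φ x • (fderiv ℝ χ x (EuclideanSpace.single j 1) • u x)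
        + fderiv ℝ φ x (EuclideanSpace.single j 1) • (χ x • u x) := fun x => by
    rw [fderiv_fun_mul (hφ.differentiable (by simp) x) (hχ.differentiable (by simp) x)]
    simp only [_root_.add_apply, _root_.smul_apply, add_smul,
      smul_smul, smul_eq_mul, mul_comm (χ x)]
  have hφdχu := integrable_test_smul hφ.continuous hφc hdχu
  have hweak := h.2.2 (fun x => φ x * χ x) (hφ.mul hχ) hφc.mul_right
  simp only [hprod, ← smul_smul (φ _) (χ _)] at hweak
  rw [integral_add hφdχu (integrable_test_smul (continuous_fderiv_apply_const hφ _)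
    (hφc.fderiv_apply ℝ _) hχu)] at hweak
  simp only [smul_add]
  rw [integral_add (integrable_test_smul hφ.continuous hφc hχv) hφdχu]
  linear_combination hweak

theorem HasWeakPartial.mul_smooth (h : HasWeakPartial j u v) {ψ : EuclideanSpace ℝ (Fin n) → ℂ}
    (hψ : ContDiff ℝ ∞ ψ) :
    HasWeakPartial j (fun x => u x * ψ x)
      (fun x => v x * ψ x + u x * fderiv ℝ ψ x (EuclideanSpace.single j 1)) := by
  have hfderiv : ∀ (L : ℂ →L[ℝ] ℝ) x, fderiv ℝ (L ∘ ψ) x (EuclideanSpace.single j 1)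
      = L (fderiv ℝ ψ x (EuclideanSpace.single j 1)) := fun L x => by
    rw [fderiv_comp x L.differentiableAt (hψ.differentiable (by simp) x), L.fderiv]
    rfl
  have hre := h.smul_smooth (reCLM.contDiff.comp hψ)
  have him := (h.smul_smooth (imCLM.contDiff.comp hψ)).const_smul I
  refine (hre.add him).congr (Eventually.of_forall fun x => ?_) (Eventually.of_forall fun x => ?_)
  · simp only [Pi.add_apply, Pi.smul_apply, Function.comp_apply, reCLM_apply, imCLM_apply,
      real_smul, smul_eq_mul]
    linear_combination u x * re_add_im (ψ x)
  · simp only [hfderiv, Pi.add_apply, Pi.smul_apply, Function.comp_apply, reCLM_apply,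
      imCLM_apply, real_smul, smul_eq_mul]
    linear_combination v x * re_add_im (ψ x)
      + u x * re_add_im (fderiv ℝ ψ x (EuclideanSpace.single j 1))

theorem HasWeakPartial.of_tendsto_integral {U V : ℕ → EuclideanSpace ℝ (Fin n) → ℂ}
    (hUV : ∀ i, HasWeakPartial j (U i) (V i)) (hu : LocallyIntegrable u)
    (hv : LocallyIntegrable v)
    (hU : ∀ φ : EuclideanSpace ℝ (Fin n) → ℝ, Continuous φ → HasCompactSupport φ →
      Tendsto (fun i => ∫ x, φ x • U i x) atTop (𝓝 (∫ x, φ x • u x)))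
    (hV : ∀ φ : EuclideanSpace ℝ (Fin n) → ℝ, Continuous φ → HasCompactSupport φ →
      Tendsto (fun i => ∫ x, φ x • V i x) atTop (𝓝 (∫ x, φ x • v x))) :
    HasWeakPartial j u v :=
  ⟨hu, hv, fun φ hφ hφc => tendsto_nhds_unique
    (hU _ (continuous_fderiv_apply_const hφ _) (hφc.fderiv_apply ℝ _))
    ((hV φ hφ.continuous hφc).neg.congr fun i => ((hUV i).2.2 φ hφ hφc).symm)⟩

theorem HasWeakPartial.of_forall_eqOn_closedBall
    (h : ∀ R : ℝ, ∃ u' v', HasWeakPartial j u' v' ∧ EqOn u u' (Metric.closedBall 0 R) ∧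
      EqOn v v' (Metric.closedBall 0 R)) : HasWeakPartial j u v := by
  have hloc : ∀ g : EuclideanSpace ℝ (Fin n) → ℂ, (∀ R : ℝ, ∃ g', LocallyIntegrable g' ∧
      EqOn g g' (Metric.closedBall 0 R)) → LocallyIntegrable g := fun g hg =>
    locallyIntegrable_iff.2 fun K hK => by
      obtain ⟨R, hKR⟩ := hK.isBounded.subset_closedBall 0
      obtain ⟨g', hg', hgg'⟩ := hg R
      exact (hg'.integrableOn_isCompact hK).congr_fun_ae
        ((ae_restrict_mem hK.measurableSet).mono fun x hx => (hgg' (hKR hx)).symm)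
  refine ⟨hloc u fun R => ?_, hloc v fun R => ?_, fun φ hφ hφc => ?_⟩
  · obtain ⟨u', v', huv, hu, -⟩ := h R
    exact ⟨u', huv.1, hu⟩
  · obtain ⟨u', v', huv, -, hv⟩ := h R
    exact ⟨v', huv.2.1, hv⟩
  · obtain ⟨R, hR⟩ := hφc.isCompact.isBounded.subset_closedBall (0 : EuclideanSpace ℝ (Fin n))
    obtain ⟨u', v', huv, hu, hv⟩ := h R
    have hdφ : ∀ x ∉ tsupport φ, fderiv ℝ φ x = 0 := fun x hx =>
      Function.notMem_support.1 fun h0 => hx (support_fderiv_subset ℝ h0)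
    convert huv.2.2 φ hφ hφc using 2
    · funext x
      by_cases hx : x ∈ tsupport φ
      · rw [hu (hR hx)]
      · simp [hdφ x hx]
    · congr 1 with x
      by_cases hx : x ∈ tsupport φ
      · rw [hv (hR hx)]
      · simp [image_eq_zero_of_notMem_tsupport hx]

/-- A smooth cutoff function that is one on the ball of radius `R` and is supported in the ball of
radius `|R| + 2`; the absolute value makes it meaningful for all real `R`. -/
noncomputable def ballCutoff (n : ℕ) (R : ℝ) : ContDiffBump (0 : EuclideanSpace ℝ (Fin n)) :=
  ⟨|R| + 1, |R| + 2, by positivity, by linarith⟩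

theorem ballCutoff_eq_one {R : ℝ} {x : EuclideanSpace ℝ (Fin n)} (hx : ‖x‖ ≤ R) :
    ballCutoff n R x = 1 :=
  (ballCutoff n R).one_of_mem_closedBall (by
    simp only [ballCutoff, mem_closedBall_zero_iff]; linarith [le_abs_self R])

theorem fderiv_ballCutoff {R : ℝ} {x : EuclideanSpace ℝ (Fin n)} (hx : ‖x‖ ≤ R) :
    fderiv ℝ (ballCutoff n R) x = 0 := by
  have hx' : x ∈ Metric.ball (0 : EuclideanSpace ℝ (Fin n)) (|R| + 1) := by
    rw [mem_ball_zero_iff]; linarith [le_abs_self R]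
  have hone : (ballCutoff n R : EuclideanSpace ℝ (Fin n) → ℝ) =ᶠ[𝓝 x] fun _ => 1 := by
    filter_upwards [Metric.isOpen_ball.mem_nhds hx'] with y hy
    exact (ballCutoff n R).one_of_mem_closedBall (Metric.ball_subset_closedBall hy)
  rw [hone.fderiv_eq, fderiv_const_apply]

theorem memLp_ballCutoff_smul (R : ℝ) [NormedSpace ℝ F] {f : EuclideanSpace ℝ (Fin n) → F}
    {p : ℝ≥0∞} (hf : MemLocalLp f p) : MemLp (fun x => ballCutoff n R x • f x) p :=
  hf.memLp_smul (ballCutoff n R).continuous (ballCutoff n R).hasCompactSupport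

theorem memLp_fderiv_ballCutoff_smul (R : ℝ) (e : EuclideanSpace ℝ (Fin n)) [NormedSpace ℝ F]
    {f : EuclideanSpace ℝ (Fin n) → F} {p : ℝ≥0∞} (hf : MemLocalLp f p) :
    MemLp (fun x => fderiv ℝ (ballCutoff n R) x e • f x) p :=
  hf.memLp_smul (continuous_fderiv_apply_const (ballCutoff n R).contDiff e)
    ((ballCutoff n R).hasCompactSupport.fderiv_apply ℝ e)

variable {a da : EuclideanSpace ℝ (Fin n) → ℂ}

theorem HasWeakPartial.mul_of_memLp (ha : HasWeakPartial j a da) (ha2 : MemLocalLp a 2)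
    (hda2 : MemLocalLp da 2) (huv : HasWeakPartial j u v) (hu : MemLp u 2) (hv : MemLp v 2) :
    HasWeakPartial j (fun x => a x * u x) (fun x => da x * u x + a x * v x) := by
  have hlocal : ∀ {g : EuclideanSpace ℝ (Fin n) → ℂ}, MemLp g 2 → MemLocalLp g 2 :=
    fun hg K _ => hg.restrict K
  have hlim : ∀ {b g : EuclideanSpace ℝ (Fin n) → ℂ}, MemLocalLp b 2 → MemLp g 2 →
      ∀ φ : EuclideanSpace ℝ (Fin n) → ℝ, Continuous φ → HasCompactSupport φ →
      Tendsto (fun i => ∫ x, φ x • (b x * mollify i g x)) atTop (𝓝 (∫ x, φ x • (b x * g x))) := by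
    intro b g hb hg φ hφ hφc
    simpa only [smul_mul_assoc] using tendsto_integral_mul_of_tendsto_eLpNorm
      (hb.memLp_smul hφ hφc) hg (fun i => memLp_mollify i hg) (tendsto_eLpNorm_mollify_sub hg)
  have hintegrable : ∀ {b g : EuclideanSpace ℝ (Fin n) → ℂ}, MemLocalLp b 2 → MemLp g 2 →
      ∀ φ : EuclideanSpace ℝ (Fin n) → ℝ, Continuous φ → HasCompactSupport φ →
      Integrable fun x => φ x • (b x * g x) := fun hb hg φ hφ hφc =>
    integrable_test_smul hφ hφc (hb.locallyIntegrable_mul (hlocal hg))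
  have hmollified : ∀ i, HasWeakPartial j (fun x => a x * mollify i u x)
      (fun x => da x * mollify i u x + a x * mollify i v x) := fun i => by
    simpa only [fderiv_mollify huv] using ha.mul_smooth (contDiff_mollify i huv.1)
  refine .of_tendsto_integral hmollified (ha2.locallyIntegrable_mul (hlocal hu))
    ((hda2.locallyIntegrable_mul (hlocal hu)).add (ha2.locallyIntegrable_mul (hlocal hv)))
    (hlim ha2 hu) fun φ hφ hφc => ?_
  simp only [smul_add]
  rw [integral_add (hintegrable hda2 hu φ hφ hφc) (hintegrable ha2 hv φ hφ hφc)]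
  refine ((hlim hda2 hu φ hφ hφc).add (hlim ha2 hv φ hφ hφc)).congr fun i => ?_
  rw [integral_add (hintegrable hda2 (memLp_mollify i hu) φ hφ hφc)
    (hintegrable ha2 (memLp_mollify i hv) φ hφ hφc)]

theorem HasWeakPartial.mul (ha : HasWeakPartial j a da) (ha2 : MemLocalLp a 2)
    (hda2 : MemLocalLp da 2) (huv : HasWeakPartial j u v) (hu : MemLocalLp u 2)
    (hv : MemLocalLp v 2) :
    HasWeakPartial j (fun x => a x * u x) (fun x => da x * u x + a x * v x) := by
  refine .of_forall_eqOn_closedBall fun R => ⟨_, _, ha.mul_of_memLp ha2 hda2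
    (huv.smul_smooth (ballCutoff n R).contDiff) (memLp_ballCutoff_smul R hu)
    ((memLp_ballCutoff_smul R hv).add (memLp_fderiv_ballCutoff_smul R _ hu)),
    fun x hx => ?_, fun x hx => ?_⟩ <;>
  simp [ballCutoff_eq_one (mem_closedBall_zero_iff.1 hx),
    fderiv_ballCutoff (mem_closedBall_zero_iff.1 hx)]

end WeakProducts

/-! ### The local Sobolev inequality -/

section Sobolev

open scoped NNReal Topology
open Filter Set Metric

theorem eLpNorm_fun_sum_le {X ι F : Type*} [MeasurableSpace X] {μ : Measure X} {p : ℝ≥0∞}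
    [NormedAddCommGroup F] (hp : 1 ≤ p) {f : ι → X → F} {s : Finset ι}
    (hf : ∀ j ∈ s, AEStronglyMeasurable (f j) μ) :
    eLpNorm (fun x => ∑ j ∈ s, f j x) p μ ≤ ∑ j ∈ s, eLpNorm (f j) p μ := by
  rw [← Finset.sum_fn]
  exact eLpNorm_sum_le hf hp

theorem eLpNorm_le_mul_rpow_measure_of_support_subset {X F : Type*} [MeasurableSpace X]
    {μ : Measure X} [NormedAddCommGroup F] {p q : ℝ≥0∞} (hpq : p ≤ q) {f : X → F}
    (hf : AEStronglyMeasurable f μ) {s : Set X} (hs : Function.support f ⊆ s) :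
    eLpNorm f p μ ≤ eLpNorm f q μ * μ s ^ (1 / p.toReal - 1 / q.toReal) := by
  have hnorm : Function.support (fun x => ‖f x‖) ⊆ s := by
    simpa only [Function.support, ne_eq, norm_eq_zero] using hs
  have hrestrict : ∀ r : ℝ≥0∞, eLpNorm f r μ = eLpNorm f r (μ.restrict s) := fun r => by
    rw [← eLpNorm_norm, ← eLpNorm_norm f (μ := μ.restrict s),
      eLpNorm_restrict_eq_of_support_subset hnorm]
  rw [hrestrict p, hrestrict q, ← Measure.restrict_apply_univ]
  exact eLpNorm_le_eLpNorm_mul_rpow_measure_univ hpq hf.restrict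

variable {n : ℕ}

theorem norm_le_sum_norm_single {F : Type*} [NormedAddCommGroup F] [NormedSpace ℝ F]
    (L : EuclideanSpace ℝ (Fin n) →L[ℝ] F) : ‖L‖ ≤ ∑ j, ‖L (EuclideanSpace.single j 1)‖ := by
  refine L.opNorm_le_bound (Finset.sum_nonneg fun _ _ => norm_nonneg _) fun x => ?_
  have hx : x = ∑ j, x j • EuclideanSpace.single j (1 : ℝ) := by
    ext i
    simp [Pi.single_apply]
  calc ‖L x‖ = ‖∑ j, x j • L (EuclideanSpace.single j 1)‖ := by
        conv_lhs => rw [hx, map_sum]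
        simp only [map_smul]
    _ ≤ ∑ j, ‖x j‖ * ‖L (EuclideanSpace.single j 1)‖ := by
        simpa only [norm_smul] using
          norm_sum_le Finset.univ fun j => x j • L (EuclideanSpace.single j 1)
    _ ≤ ∑ j, ‖x‖ * ‖L (EuclideanSpace.single j 1)‖ := by
        gcongr with j
        exact PiLp.norm_apply_le x j
    _ = _ := by rw [← Finset.mul_sum, mul_comm]

theorem eLpNorm_fderiv_le_sum {F : Type*} [NormedAddCommGroup F] [NormedSpace ℝ F] {p : ℝ≥0∞}
    (hp : 1 ≤ p) {w : EuclideanSpace ℝ (Fin n) → F} (hw : ContDiff ℝ ∞ w) :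
    eLpNorm (fderiv ℝ w) p volume
      ≤ ∑ j, eLpNorm (fun x => fderiv ℝ w x (EuclideanSpace.single j 1)) p volume := by
  have hle : eLpNorm (fderiv ℝ w) p volume
      ≤ eLpNorm (fun x => ∑ j, ‖fderiv ℝ w x (EuclideanSpace.single j 1)‖) p volume :=
    eLpNorm_mono_real fun x => norm_le_sum_norm_single (fderiv ℝ w x)
  simpa only [eLpNorm_norm] using hle.trans (eLpNorm_fun_sum_le hp fun j _ =>
    (continuous_fderiv_apply_const hw _).norm.aestronglyMeasurable)

theorem exists_sobolev_bound_of_contDiff {r t : ℝ≥0} (ht1 : 1 ≤ t) (ht2 : t ≤ 2) (htn : t < n)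
    (hrt : (t : ℝ)⁻¹ - (n : ℝ)⁻¹ ≤ (r : ℝ)⁻¹) (R : ℝ) :
    ∃ C : ℝ≥0, ∀ w : EuclideanSpace ℝ (Fin n) → ℂ, ContDiff ℝ ∞ w →
      Function.support w ⊆ closedBall 0 R →
      eLpNorm w r volume
        ≤ C * ∑ j, eLpNorm (fun x => fderiv ℝ w x (EuclideanSpace.single j 1)) 2 volume := by
  obtain ⟨s, hs⟩ : ∃ s : Set (EuclideanSpace ℝ (Fin n)), s = closedBall 0 R := ⟨_, rfl⟩
  obtain ⟨e, he⟩ : ∃ e : ℝ, e = 1 / (t : ℝ) - 1 / 2 := ⟨_, rfl⟩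
  have he0 : 0 ≤ e := he ▸
    sub_nonneg.2 (one_div_le_one_div_of_le (by exact_mod_cast one_pos.trans_le ht1)
      (by exact_mod_cast ht2))
  have hsfin : volume s ≠ ⊤ := hs ▸ measure_closedBall_lt_top.ne
  rw [← hs]
  refine ⟨eLpNormLESNormFDerivOfLeConst ℂ volume s t r * (volume s).toNNReal ^ e,
    fun w hw hws => ?_⟩
  have hfderiv : Function.support (fderiv ℝ w) ⊆ s :=
    (support_fderiv_subset ℝ).trans (closure_minimal hws (hs ▸ isClosed_closedBall))
  have hsobolev : eLpNorm w r volume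
      ≤ eLpNormLESNormFDerivOfLeConst ℂ volume s t r * eLpNorm (fderiv ℝ w) t volume :=
    eLpNorm_le_eLpNorm_fderiv_of_le volume (hw.of_le (by simp)) hws ht1
      (by rwa [finrank_euclideanSpace_fin]) (by rwa [finrank_euclideanSpace_fin])
      (hs ▸ isBounded_closedBall)
  have hexponent : eLpNorm (fderiv ℝ w) t volume
      ≤ eLpNorm (fderiv ℝ w) 2 volume * volume s ^ e := by
    simpa [he] using eLpNorm_le_mul_rpow_measure_of_support_subset (p := t) (q := 2)
      (by exact_mod_cast ht2) (hw.continuous_fderiv (by simp)).aestronglyMeasurable hfderiv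
  rw [ENNReal.coe_mul, ENNReal.coe_rpow_of_nonneg _ he0, ENNReal.coe_toNNReal hsfin, mul_assoc,
    mul_comm (volume s ^ e)]
  refine hsobolev.trans (mul_le_mul_right (hexponent.trans ?_) _)
  exact mul_le_mul_left (eLpNorm_fderiv_le_sum one_le_two hw) _

theorem exists_sobolev_bound {r t : ℝ≥0} (ht1 : 1 ≤ t) (ht2 : t ≤ 2) (htn : t < n)
    (hrt : (t : ℝ)⁻¹ - (n : ℝ)⁻¹ ≤ (r : ℝ)⁻¹) (R : ℝ) :
    ∃ C : ℝ≥0, ∀ (u : EuclideanSpace ℝ (Fin n) → ℂ) (v : Fin n → EuclideanSpace ℝ (Fin n) → ℂ),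
      (∀ j, HasWeakPartial j u (v j)) → (∀ j, MemLp (v j) 2) →
      Function.support u ⊆ closedBall 0 R →
      eLpNorm u r ≤ C * ∑ j, eLpNorm (v j) 2 volume := by
  obtain ⟨C, hC⟩ := exists_sobolev_bound_of_contDiff ht1 ht2 htn hrt (R + 2)
  refine ⟨C, fun u v huv hv hsupp => ?_⟩
  have hu : LocallyIntegrable u := (huv ⟨0, by
    exact_mod_cast (one_pos.trans_le ht1).trans htn⟩).1
  have hmollify : ∀ i, eLpNorm (mollify i u) r ≤ C * ∑ j, eLpNorm (v j) 2 volume := fun i => by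
    refine (hC _ (contDiff_mollify i hu) (support_mollify_subset i hsupp)).trans ?_
    gcongr with j
    simpa only [fderiv_mollify (huv j)] using eLpNorm_mollify_le i (hv j)
  exact (Lp.eLpNorm_lim_le_liminf_eLpNorm
    (fun i => (contDiff_mollify i hu).continuous.aestronglyMeasurable) u
    (ae_tendsto_mollify hu)).trans
    (liminf_le_of_frequently_le' (Frequently.of_forall hmollify))

theorem holderTriple_coe_two {q r : ℝ≥0} (hq : 0 < q) (hr : 0 < r)
    (h : (q : ℝ)⁻¹ + (r : ℝ)⁻¹ = 2⁻¹) : ENNReal.HolderTriple q r 2 := by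
  have hqr : NNReal.HolderTriple q r 2 := ⟨NNReal.eq (by push_cast; exact h), hq, hr⟩
  exact_mod_cast hqr.coe_ennreal two_ne_zero

theorem exists_sobolev_exponents_two {q : ℝ≥0} (hq : 2 < q) :
    ∃ r t : ℝ≥0, ENNReal.HolderTriple q r 2 ∧ 1 ≤ t ∧ t < 2 ∧
      (t : ℝ)⁻¹ - 2⁻¹ = (r : ℝ)⁻¹ := by
  have hq0 : (0 : ℝ) < q := by exact_mod_cast two_pos.trans hq
  have hqinv : (q : ℝ)⁻¹ < 2⁻¹ := inv_strictAnti₀ two_pos (by exact_mod_cast hq)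
  have hqinv0 : 0 < (q : ℝ)⁻¹ := inv_pos.2 hq0
  have hr0 : 0 < (2⁻¹ - (q : ℝ)⁻¹)⁻¹ := inv_pos.2 (by linarith)
  have ht0 : 0 < (1 - (q : ℝ)⁻¹)⁻¹ := inv_pos.2 (by linarith)
  lift (2⁻¹ - (q : ℝ)⁻¹)⁻¹ to ℝ≥0 using hr0.le with r hr
  lift (1 - (q : ℝ)⁻¹)⁻¹ to ℝ≥0 using ht0.le with t ht
  refine ⟨r, t, holderTriple_coe_two (by exact_mod_cast hq0) (by exact_mod_cast hr0) ?_, ?_, ?_, ?_⟩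
  · rw [hr, inv_inv]
    ring
  · rw [← NNReal.coe_le_coe, ht]
    exact (one_le_inv₀ (by linarith)).2 (by linarith)
  · rw [← NNReal.coe_lt_coe, ht]
    exact (inv_lt_comm₀ (by linarith) two_pos).2 (by norm_num; linarith)
  · rw [hr, ht, inv_inv, inv_inv]
    ring

theorem exists_sobolev_exponents {p : ℝ≥0∞} (hnp : (n = 2 ∧ 2 < p) ∨ (n = 3 ∧ 3 ≤ p)) :
    ∃ q r t : ℝ≥0, (q : ℝ≥0∞) ≤ p ∧ ENNReal.HolderTriple q r 2 ∧ 1 ≤ t ∧ t ≤ 2 ∧ t < n ∧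
      (t : ℝ)⁻¹ - (n : ℝ)⁻¹ ≤ (r : ℝ)⁻¹ := by
  rcases hnp with ⟨rfl, hp⟩ | ⟨rfl, hp⟩
  · obtain ⟨q, hq2, hqp⟩ := ENNReal.lt_iff_exists_nnreal_btwn.1 hp
    obtain ⟨r, t, hqr, ht1, ht2, hrt⟩ :=
      exists_sobolev_exponents_two (q := q) (by exact_mod_cast hq2)
    exact ⟨q, r, t, hqp.le, hqr, ht1, ht2.le, ht2, hrt.le⟩
  · exact ⟨3, 6, 2, hp, holderTriple_coe_two (by norm_num) (by norm_num) (by norm_num),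
      one_le_two, le_rfl, by norm_num, by norm_num⟩

theorem support_ballCutoff_subset (R : ℝ) :
    Function.support (ballCutoff n R) ⊆ closedBall 0 (|R| + 2) := by
  rw [(ballCutoff n R).support_eq]
  exact ball_subset_closedBall

theorem exists_norm_fderiv_ballCutoff_le (n : ℕ) (R : ℝ) :
    ∃ M : ℝ≥0, ∀ x, ‖fderiv ℝ (ballCutoff n R) x‖ ≤ M := by
  obtain ⟨M, hM⟩ := ((ballCutoff n R).hasCompactSupport.fderiv ℝ).exists_bound_of_continuous
    ((ballCutoff n R).contDiff.continuous_fderiv one_ne_zero)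
  exact ⟨M.toNNReal, fun x => (hM x).trans (Real.le_coe_toNNReal M)⟩

theorem exists_eLpNorm_ballCutoff_partial_le (n : ℕ) (R : ℝ) :
    ∃ M : ℝ≥0, ∀ (j : Fin n) (u v : EuclideanSpace ℝ (Fin n) → ℂ),
      AEStronglyMeasurable u → AEStronglyMeasurable v →
      eLpNorm (fun x => ballCutoff n R x • v x
          + fderiv ℝ (ballCutoff n R) x (EuclideanSpace.single j 1) • u x) 2 volume
        ≤ eLpNorm v 2 (volume.restrict (closedBall 0 (|R| + 2)))
          + M * eLpNorm u 2 (volume.restrict (closedBall 0 (|R| + 2))) := by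
  obtain ⟨M, hM⟩ := exists_norm_fderiv_ballCutoff_le n R
  refine ⟨M, fun j u v hu hv => ?_⟩
  set χ := ballCutoff n R
  have hsupport : Function.support (fun x => χ x • v x
      + fderiv ℝ χ x (EuclideanSpace.single j 1) • u x) ⊆ closedBall 0 (|R| + 2) := by
    intro x hx
    by_contra hxS
    have hχ : χ x = 0 := Function.notMem_support.1 fun h => hxS (support_ballCutoff_subset R h)
    have hdχ : fderiv ℝ χ x = 0 := Function.notMem_support.1 fun h =>
      hxS (closure_minimal (support_ballCutoff_subset R) isClosed_closedBall
        (support_fderiv_subset ℝ h))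
    exact hx (by simp [hχ, hdχ])
  rw [← eLpNorm_restrict_eq_of_support_subset hsupport]
  refine (eLpNorm_add_le (χ.continuous.aestronglyMeasurable.smul hv.restrict)
    ((continuous_fderiv_apply_const χ.contDiff _).aestronglyMeasurable.smul hu.restrict)
    one_le_two).trans (add_le_add (eLpNorm_mono fun x => ?_) ?_)
  · rw [Pi.smul_apply', norm_smul, Real.norm_of_nonneg χ.nonneg]
    exact mul_le_of_le_one_left (norm_nonneg _) χ.le_one
  · refine eLpNorm_le_nnreal_smul_eLpNorm_of_ae_le_mul (.of_forall fun x => ?_) 2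
    change ‖(_ : ℝ) • u x‖ ≤ M * ‖u x‖
    rw [norm_smul]
    gcongr
    exact ((fderiv ℝ χ x).le_opNorm _).trans (by simpa using hM x)

theorem exists_local_sobolev_bound {r t : ℝ≥0} (ht1 : 1 ≤ t) (ht2 : t ≤ 2) (htn : t < n)
    (hrt : (t : ℝ)⁻¹ - (n : ℝ)⁻¹ ≤ (r : ℝ)⁻¹) (R : ℝ) :
    ∃ C : ℝ≥0, ∀ (u : EuclideanSpace ℝ (Fin n) → ℂ) (v : Fin n → EuclideanSpace ℝ (Fin n) → ℂ),
      (∀ j, HasWeakPartial j u (v j)) → MemLocalLp u 2 → (∀ j, MemLocalLp (v j) 2) →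
      eLpNorm u r (volume.restrict (closedBall 0 R))
        ≤ C * (eLpNorm u 2 (volume.restrict (closedBall 0 (|R| + 2)))
          + ∑ j, eLpNorm (v j) 2 (volume.restrict (closedBall 0 (|R| + 2)))) := by
  obtain ⟨C, hC⟩ := exists_sobolev_bound ht1 ht2 htn hrt (|R| + 2)
  obtain ⟨M, hM⟩ := exists_eLpNorm_ballCutoff_partial_le n R
  refine ⟨C * (1 + n * M), fun u v huv hu hv => ?_⟩
  set S : Set (EuclideanSpace ℝ (Fin n)) := closedBall 0 (|R| + 2)
  set U := eLpNorm u 2 (volume.restrict S)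
  set V := ∑ j, eLpNorm (v j) 2 (volume.restrict S)
  set χu : EuclideanSpace ℝ (Fin n) → ℂ := fun x => ballCutoff n R x • u x
  have hsupport : Function.support χu ⊆ S :=
    (Function.support_smul_subset_left _ _).trans (support_ballCutoff_subset R)
  have heq : u =ᵐ[volume.restrict (closedBall 0 R)] χu := by
    filter_upwards [ae_restrict_mem measurableSet_closedBall] with x hx
    simp [χu, ballCutoff_eq_one (mem_closedBall_zero_iff.1 hx)]
  calc eLpNorm u r (volume.restrict (closedBall 0 R))
      = eLpNorm χu r (volume.restrict (closedBall 0 R)) := eLpNorm_congr_ae heq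
    _ ≤ eLpNorm χu r volume := eLpNorm_mono_measure _ Measure.restrict_le_self
    _ ≤ C * ∑ j, eLpNorm (fun x => ballCutoff n R x • v j x
          + fderiv ℝ (ballCutoff n R) x (EuclideanSpace.single j 1) • u x) 2 volume :=
        hC _ _ (fun j => (huv j).smul_smooth (ballCutoff n R).contDiff)
          (fun j => (memLp_ballCutoff_smul R (hv j)).add (memLp_fderiv_ballCutoff_smul R _ hu))
          hsupport
    _ ≤ C * ∑ j, (eLpNorm (v j) 2 (volume.restrict S) + M * U) := by
        gcongr with j
        exact hM j u (v j) hu.aestronglyMeasurable (hv j).aestronglyMeasurable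
    _ = C * (V + n * M * U) := by
        rw [Finset.sum_add_distrib, Finset.sum_const, Finset.card_fin, nsmul_eq_mul, mul_assoc]
    _ ≤ C * ((V + n * M * U) + (U + n * M * V)) := by
        exact mul_le_mul_right le_self_add _
    _ = _ := by push_cast; ring

theorem exists_eLpNorm_mul_le {p : ℝ≥0∞} (hnp : (n = 2 ∧ 2 < p) ∨ (n = 3 ∧ 3 ≤ p))
    {B : EuclideanSpace ℝ (Fin n) → ℂ} (hB : MemLocalLp B p) (R : ℝ) :
    ∃ C : ℝ≥0, ∀ (u : EuclideanSpace ℝ (Fin n) → ℂ) (v : Fin n → EuclideanSpace ℝ (Fin n) → ℂ),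
      (∀ j, HasWeakPartial j u (v j)) → MemLocalLp u 2 → (∀ j, MemLocalLp (v j) 2) →
      eLpNorm (fun x => B x * u x) 2 (volume.restrict (closedBall 0 R))
        ≤ C * (eLpNorm u 2 (volume.restrict (closedBall 0 (|R| + 2)))
          + ∑ j, eLpNorm (v j) 2 (volume.restrict (closedBall 0 (|R| + 2)))) := by
  obtain ⟨q, r, t, hqp, hholder, ht1, ht2, htn, hrt⟩ := exists_sobolev_exponents hnp
  obtain ⟨C, hC⟩ := exists_local_sobolev_bound ht1 ht2 htn hrt R
  have hBq := hB.mono_exponent hqp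
  have hBfin := (hBq _ (isCompact_closedBall 0 R)).eLpNorm_ne_top
  refine ⟨(eLpNorm B q (volume.restrict (closedBall 0 R))).toNNReal * C,
    fun u v huv hu hv => ?_⟩
  rw [ENNReal.coe_mul, ENNReal.coe_toNNReal hBfin, mul_assoc]
  exact (eLpNorm_smul_le_mul_eLpNorm (p := q) (q := r) hu.aestronglyMeasurable.restrict
    hBq.aestronglyMeasurable.restrict).trans (mul_le_mul_right (hC u v huv hu hv) _)

end Sobolev

/-! ### Convolution with the fundamental solution -/

section GreenGradient

open scoped NNReal Topology
open Filter Set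

variable {n : ℕ} {j : Fin n}

theorem hasWeakPartial_of_differentiable {w : EuclideanSpace ℝ (Fin n) → ℂ}
    (hw : Differentiable ℝ w)
    (hw' : Continuous fun x => fderiv ℝ w x (EuclideanSpace.single j 1)) :
    HasWeakPartial j w fun x => fderiv ℝ w x (EuclideanSpace.single j 1) := by
  refine ⟨hw.continuous.locallyIntegrable, hw'.locallyIntegrable, fun φ hφ hφc => ?_⟩
  rw [integral_smul_fderiv_eq_neg_fderiv_smul_of_integrable
    (integrable_test_smul (continuous_fderiv_apply_const hφ _) (hφc.fderiv_apply ℝ _)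
      hw.continuous.locallyIntegrable)
    (integrable_test_smul hφ.continuous hφc hw'.locallyIntegrable)
    (integrable_test_smul hφ.continuous hφc hw.continuous.locallyIntegrable)
    (fun x _ => hφ.differentiable (by simp) x) fun x _ => hw x, neg_neg]

theorem tendsto_integral_smul_of_dominated {U : ℕ → EuclideanSpace ℝ (Fin n) → ℂ}
    {u : EuclideanSpace ℝ (Fin n) → ℂ} {m : EuclideanSpace ℝ (Fin n) → ℝ}
    (hm : LocallyIntegrable m) (hU : ∀ i, AEStronglyMeasurable (U i))
    (hUm : ∀ i, ∀ᵐ x, ‖U i x‖ ≤ m x) (hUu : ∀ᵐ x, Tendsto (fun i => U i x) atTop (𝓝 (u x)))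
    {φ : EuclideanSpace ℝ (Fin n) → ℝ} (hφ : Continuous φ) (hφc : HasCompactSupport φ) :
    Tendsto (fun i => ∫ x, φ x • U i x) atTop (𝓝 (∫ x, φ x • u x)) := by
  refine tendsto_integral_of_dominated_convergence (fun x => ‖φ x‖ * m x)
    (fun i => hφ.aestronglyMeasurable.smul (hU i))
    (hm.integrable_smul_left_of_hasCompactSupport hφ.norm hφc.norm) (fun i => ?_) ?_
  · filter_upwards [hUm i] with x hx
    rw [norm_smul]
    gcongr
  · filter_upwards [hUu] with x hx
    exact hx.const_smul _

theorem HasWeakPartial.of_tendsto_of_dominated {U V : ℕ → EuclideanSpace ℝ (Fin n) → ℂ}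
    {u v : EuclideanSpace ℝ (Fin n) → ℂ} {m : EuclideanSpace ℝ (Fin n) → ℝ}
    (hUV : ∀ i, HasWeakPartial j (U i) (V i)) (hm : LocallyIntegrable m)
    (hUm : ∀ i, ∀ᵐ x, ‖U i x‖ ≤ m x) (hVm : ∀ i, ∀ᵐ x, ‖V i x‖ ≤ m x)
    (hUu : ∀ᵐ x, Tendsto (fun i => U i x) atTop (𝓝 (u x)))
    (hVv : ∀ᵐ x, Tendsto (fun i => V i x) atTop (𝓝 (v x))) : HasWeakPartial j u v := by
  have hU := fun i => (hUV i).1.aestronglyMeasurable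
  have hV := fun i => (hUV i).2.1.aestronglyMeasurable
  have hlocal : ∀ {F : ℕ → EuclideanSpace ℝ (Fin n) → ℂ} {f : EuclideanSpace ℝ (Fin n) → ℂ},
      (∀ i, AEStronglyMeasurable (F i)) → (∀ i, ∀ᵐ x, ‖F i x‖ ≤ m x) →
      (∀ᵐ x, Tendsto (fun i => F i x) atTop (𝓝 (f x))) → LocallyIntegrable f := by
    intro F f hF hFm hFf
    refine hm.mono (aestronglyMeasurable_of_tendsto_ae atTop hF hFf) ?_
    filter_upwards [ae_all_iff.2 hFm, hFf] with x hx hlim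
    exact (le_of_tendsto' hlim.norm hx).trans (le_abs_self _)
  exact .of_tendsto_integral hUV (hlocal hU hUm hUu) (hlocal hV hVm hVv)
    (fun φ => tendsto_integral_smul_of_dominated hm hU hUm hUu)
    fun φ => tendsto_integral_smul_of_dominated hm hV hVm hVv

/-- The regularised norm `√(|x|² + ε)`, which is smooth for `ε > 0`. -/
noncomputable def smoothNorm (ε : ℝ) (x : EuclideanSpace ℝ (Fin n)) : ℝ :=
  √(‖x‖ ^ 2 + ε)

section SmoothNorm

variable {ε : ℝ} {g g' : ℝ → ℂ}

theorem smoothNorm_pos (hε : 0 < ε) (x : EuclideanSpace ℝ (Fin n)) : 0 < smoothNorm ε x :=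
  Real.sqrt_pos.2 (by positivity)

theorem norm_le_smoothNorm (hε : 0 < ε) (x : EuclideanSpace ℝ (Fin n)) : ‖x‖ ≤ smoothNorm ε x :=
  Real.le_sqrt_of_sq_le (by linarith)

theorem continuous_smoothNorm (ε : ℝ) :
    Continuous (smoothNorm ε : EuclideanSpace ℝ (Fin n) → ℝ) := by
  unfold smoothNorm
  fun_prop

theorem tendsto_smoothNorm {e : ℕ → ℝ} (he : Tendsto e atTop (𝓝 0))
    (x : EuclideanSpace ℝ (Fin n)) : Tendsto (fun i => smoothNorm (e i) x) atTop (𝓝 ‖x‖) := by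
  have h := (Real.continuous_sqrt.tendsto _).comp (he.const_add (‖x‖ ^ 2))
  rwa [add_zero, Real.sqrt_sq (norm_nonneg x)] at h

theorem hasFDerivAt_comp_smoothNorm (hg : ∀ r, 0 < r → HasDerivAt g (g' r) r) (hε : 0 < ε)
    (x : EuclideanSpace ℝ (Fin n)) :
    HasFDerivAt (fun x : EuclideanSpace ℝ (Fin n) => g (smoothNorm ε x))
      (((1 : ℝ →L[ℝ] ℝ).smulRight (g' (smoothNorm ε x))).comp
        ((1 / (2 * smoothNorm ε x)) • 2 • innerSL ℝ x)) x := by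
  have hsq : HasFDerivAt (fun x : EuclideanSpace ℝ (Fin n) => ‖x‖ ^ 2 + ε) (2 • innerSL ℝ x) x :=
    (hasStrictFDerivAt_norm_sq x).hasFDerivAt.add_const ε
  exact (hg _ (smoothNorm_pos hε x)).hasFDerivAt.comp x
    (hsq.sqrt (by positivity : 0 < ‖x‖ ^ 2 + ε).ne')

theorem fderiv_comp_smoothNorm_single (hg : ∀ r, 0 < r → HasDerivAt g (g' r) r) (hε : 0 < ε)
    (x : EuclideanSpace ℝ (Fin n)) :
    fderiv ℝ (fun x => g (smoothNorm ε x)) x (EuclideanSpace.single j 1)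
      = g' (smoothNorm ε x) * ((x j / smoothNorm ε x : ℝ) : ℂ) := by
  have hne := (smoothNorm_pos hε x).ne'
  rw [(hasFDerivAt_comp_smoothNorm hg hε x).fderiv]
  simp only [ContinuousLinearMap.comp_apply, smul_apply, innerSL_apply_apply,
    EuclideanSpace.inner_single_right, ContinuousLinearMap.smulRight_apply, one_apply_eq_self,
    real_smul, mul_comm (g' _), one_mul, conj_trivial, smul_eq_mul, nsmul_eq_mul]
  congr 2
  push_cast
  field_simp

theorem hasWeakPartial_comp_smoothNorm (hg : ∀ r, 0 < r → HasDerivAt g (g' r) r)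
    (hg' : ContinuousOn g' (Ioi 0)) (hε : 0 < ε) (j : Fin n) :
    HasWeakPartial j (fun x => g (smoothNorm ε x))
      (fun x => g' (smoothNorm ε x) * ((x j / smoothNorm ε x : ℝ) : ℂ)) := by
  simp only [← fderiv_comp_smoothNorm_single hg hε]
  refine hasWeakPartial_of_differentiable
    (fun x => (hasFDerivAt_comp_smoothNorm hg hε x).differentiableAt) ?_
  simp only [fderiv_comp_smoothNorm_single hg hε]
  refine (hg'.comp_continuous (continuous_smoothNorm ε) (smoothNorm_pos hε)).mul
    (continuous_ofReal.comp ?_)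
  exact Continuous.div (by fun_prop) (continuous_smoothNorm ε) fun x => (smoothNorm_pos hε x).ne'

end SmoothNorm

/-- The function `x ↦ g(|x|)`, set to zero at the origin. -/
noncomputable def radialKernel (n : ℕ) (g : ℝ → ℂ) : EuclideanSpace ℝ (Fin n) → ℂ :=
  ({0}ᶜ : Set (EuclideanSpace ℝ (Fin n))).indicator fun x => g ‖x‖

/-- The function `x ↦ g'(|x|) x_j / |x|`, the `j`-th partial derivative of `x ↦ g(|x|)`. It is zero
at the origin. -/
noncomputable def radialPartial (g' : ℝ → ℂ) (j : Fin n) (x : EuclideanSpace ℝ (Fin n)) : ℂ :=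
  g' ‖x‖ * ((x j / ‖x‖ : ℝ) : ℂ)

theorem radialKernel_of_ne {g : ℝ → ℂ} {x : EuclideanSpace ℝ (Fin n)} (hx : x ≠ 0) :
    radialKernel n g x = g ‖x‖ :=
  indicator_of_mem (by simpa using hx) _

theorem continuousOn_comp_norm {g : ℝ → ℂ} (hg : ContinuousOn g (Ioi 0)) :
    ContinuousOn (fun x : EuclideanSpace ℝ (Fin n) => g ‖x‖) {0}ᶜ :=
  hg.comp continuous_norm.continuousOn fun _ hx => norm_pos_iff.2 (by simpa using hx)

theorem measurable_radialKernel {g : ℝ → ℂ} (hg : ContinuousOn g (Ioi 0)) :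
    Measurable (radialKernel n g) := by
  refine ContinuousOn.measurable_of_countable_compl (s := {0}ᶜ) ?_ (by simp)
  exact (continuousOn_comp_norm hg).congr fun x hx => radialKernel_of_ne (by simpa using hx)

theorem measurable_radialPartial {g' : ℝ → ℂ} (hg' : ContinuousOn g' (Ioi 0)) (j : Fin n) :
    Measurable (radialPartial g' j) := by
  refine ContinuousOn.measurable_of_countable_compl (s := {0}ᶜ) ?_ (by simp)
  refine (continuousOn_comp_norm hg').mul (continuous_ofReal.comp_continuousOn ?_)
  refine ContinuousOn.div (by fun_prop) continuous_norm.continuousOn fun x hx => ?_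
  simpa using hx

theorem norm_mul_coord_div_le {x : EuclideanSpace ℝ (Fin n)} {s : ℝ} (hs : ‖x‖ ≤ s) (j : Fin n)
    (c : ℂ) : ‖c * ((x j / s : ℝ) : ℂ)‖ ≤ ‖c‖ := by
  have hs0 : 0 ≤ s := (norm_nonneg _).trans hs
  rw [norm_mul, norm_real, norm_div, Real.norm_of_nonneg hs0]
  exact mul_le_of_le_one_right (norm_nonneg _)
    (div_le_one_of_le₀ ((PiLp.norm_apply_le x j).trans hs) hs0)

theorem norm_radialPartial_le {g' : ℝ → ℂ} {m : ℝ → ℝ} (hg' : ∀ r, 0 < r → ‖g' r‖ ≤ m r)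
    (h0 : 0 ≤ m 0) (j : Fin n) (x : EuclideanSpace ℝ (Fin n)) :
    ‖radialPartial g' j x‖ ≤ m ‖x‖ := by
  rcases eq_or_ne x 0 with rfl | hx
  · simpa [radialPartial] using h0
  · exact (norm_mul_coord_div_le le_rfl j _).trans (hg' _ (norm_pos_iff.2 hx))

theorem norm_radialKernel_le {g : ℝ → ℂ} {m : ℝ → ℝ} (hg : ∀ r, 0 < r → ‖g r‖ ≤ m r)
    (h0 : 0 ≤ m 0) (x : EuclideanSpace ℝ (Fin n)) : ‖radialKernel n g x‖ ≤ m ‖x‖ := by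
  rcases eq_or_ne x 0 with rfl | hx
  · simpa [radialKernel] using h0
  · rw [radialKernel_of_ne hx]
    exact hg _ (norm_pos_iff.2 hx)

theorem locallyIntegrable_rpow_neg_norm (hn : 0 < n) {a : ℝ} (ha : 0 ≤ a)
    (han : a ≤ (n : ℝ) - 1) :
    LocallyIntegrable fun x : EuclideanSpace ℝ (Fin n) => ‖x‖ ^ (-a) := by
  have hcritical :
      LocallyIntegrable fun x : EuclideanSpace ℝ (Fin n) => ‖x‖ ^ (-((n : ℝ) - 1)) := by
    refine locallyIntegrable_iff.2 fun K hK => ?_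
    obtain ⟨ε, hε⟩ := hK.isBounded.subset_closedBall 0
    refine IntegrableOn.mono_set ?_ hε
    exact (integrable_nearSingularity hn ε).integrableOn.congr_fun
      (fun x hx => nearSingularity_of_le (mem_closedBall_zero_iff.1 hx)) measurableSet_closedBall
  refine (hcritical.add (locallyIntegrable_const (1 : ℝ))).mono
    (measurable_norm.pow_const _).aestronglyMeasurable (.of_forall fun x => ?_)
  refine le_trans ?_ (le_abs_self _)
  rw [Real.norm_of_nonneg (by positivity), Pi.add_apply]
  have hpow : 0 ≤ ‖x‖ ^ (-((n : ℝ) - 1)) := by positivity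
  rcases (norm_nonneg x).eq_or_lt with hx | hx
  · rw [← hx] at hpow ⊢
    linarith [Real.zero_rpow_le_one (-a)]
  rcases le_total ‖x‖ 1 with hx1 | hx1
  · linarith [Real.rpow_le_rpow_of_exponent_ge hx hx1 (neg_le_neg han)]
  · linarith [Real.rpow_le_one_of_one_le_of_nonpos hx1 (neg_nonpos.2 ha)]

theorem IsRadialProfile.hasWeakPartial (hn : 0 < n) {a b : ℝ} (ha : 0 ≤ a)
    (han : a ≤ (n : ℝ) - 1) (hb : 0 ≤ b) (hbn : b ≤ (n : ℝ) - 1) {g g' : ℝ → ℂ}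
    (h : IsRadialProfile a b g g') (j : Fin n) :
    HasWeakPartial j (radialKernel n g) (radialPartial g' j) := by
  have : Nonempty (Fin n) := ⟨j⟩
  obtain ⟨C, hC, hbound⟩ := h.exists_bound
  set m : ℝ → ℝ := fun r => C * (r ^ (-a) + r ^ (-b))
  have hm : LocallyIntegrable fun x : EuclideanSpace ℝ (Fin n) => m ‖x‖ :=
    ((locallyIntegrable_rpow_neg_norm hn ha han).add
      (locallyIntegrable_rpow_neg_norm hn hb hbn)).smul C
  have hanti : ∀ {r s : ℝ}, 0 < r → r ≤ s → m s ≤ m r := fun hr hrs => by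
    have hra := Real.rpow_le_rpow_of_nonpos hr hrs (neg_nonpos.2 ha)
    have hrb := Real.rpow_le_rpow_of_nonpos hr hrs (neg_nonpos.2 hb)
    simp only [m]
    gcongr
  have hne : ∀ᵐ x : EuclideanSpace ℝ (Fin n), x ≠ 0 := Measure.ae_ne volume 0
  set e : ℕ → ℝ := fun i => 1 / ((i : ℝ) + 1)
  have he : ∀ i, 0 < e i := fun i => Nat.one_div_pos_of_nat
  have hlim := tendsto_smoothNorm (n := n) tendsto_one_div_add_atTop_nhds_zero_nat
  refine .of_tendsto_of_dominated
    (fun i => hasWeakPartial_comp_smoothNorm h.hasDerivAt h.continuousOn_deriv (he i) j) hm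
    (fun i => ?_) (fun i => ?_) ?_ ?_
  · filter_upwards [hne] with x hx
    exact (hbound _ (smoothNorm_pos (he i) x)).1.trans
      (hanti (norm_pos_iff.2 hx) (norm_le_smoothNorm (he i) x))
  · filter_upwards [hne] with x hx
    exact (norm_mul_coord_div_le (norm_le_smoothNorm (he i) x) j _).trans
      ((hbound _ (smoothNorm_pos (he i) x)).2.trans
        (hanti (norm_pos_iff.2 hx) (norm_le_smoothNorm (he i) x)))
  · filter_upwards [hne] with x hx
    rw [radialKernel_of_ne hx]
    exact (h.hasDerivAt _ (norm_pos_iff.2 hx)).continuousAt.tendsto.comp (hlim x)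
  · filter_upwards [hne] with x hx
    have hx0 : 0 < ‖x‖ := norm_pos_iff.2 hx
    exact ((h.continuousOn_deriv.continuousAt (Ioi_mem_nhds hx0)).tendsto.comp (hlim x)).mul
      ((continuous_ofReal.tendsto _).comp (tendsto_const_nhds.div (hlim x) hx0.ne'))

theorem exists_restrict_le_smul_weightedVolume (σ : ℝ) {K : Set (EuclideanSpace ℝ (Fin n))}
    (hK : IsCompact K) : ∃ c : ℝ≥0, volume.restrict K ≤ c • weightedVolume n σ := by
  have hcont : Continuous fun x : EuclideanSpace ℝ (Fin n) => (1 + ‖x‖ ^ 2) ^ (-σ) :=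
    Continuous.rpow_const (by fun_prop) fun x => Or.inl (one_add_norm_sq_pos x).ne'
  obtain ⟨M, hM⟩ := hK.exists_bound_of_continuousOn hcont.continuousOn
  have hone : ∀ x ∈ K, 1 ≤ (M.toNNReal : ℝ≥0∞) * ENNReal.ofReal ((1 + ‖x‖ ^ 2) ^ σ) := by
    intro x hx
    have hpos := one_add_norm_sq_pos x
    rw [← ENNReal.ofReal_coe_nnreal, ← ENNReal.ofReal_mul (by positivity), ← ENNReal.ofReal_one]
    refine ENNReal.ofReal_le_ofReal ?_
    calc (1 : ℝ) = (1 + ‖x‖ ^ 2) ^ (-σ) * (1 + ‖x‖ ^ 2) ^ σ := by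
          rw [← Real.rpow_add hpos, neg_add_cancel, Real.rpow_zero]
      _ ≤ M.toNNReal * (1 + ‖x‖ ^ 2) ^ σ := by
          gcongr
          exact (le_abs_self _).trans ((hM x hx).trans (Real.le_coe_toNNReal M))
  refine ⟨M.toNNReal, Measure.le_iff.2 fun s hs => ?_⟩
  calc volume.restrict K s = ∫⁻ _ in s ∩ K, 1 := by
        rw [Measure.restrict_apply hs, setLIntegral_one]
    _ ≤ ∫⁻ x in s ∩ K, M.toNNReal * ENNReal.ofReal ((1 + ‖x‖ ^ 2) ^ σ) :=
        setLIntegral_mono' (hs.inter hK.measurableSet) fun x hx => hone x hx.2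
    _ ≤ ∫⁻ x in s, M.toNNReal * ENNReal.ofReal ((1 + ‖x‖ ^ 2) ^ σ) :=
        lintegral_mono_set inter_subset_left
    _ = (M.toNNReal • weightedVolume n σ) s := by
        rw [lintegral_const_mul' _ _ ENNReal.coe_ne_top, Measure.smul_apply, weightedVolume,
          withDensity_apply _ hs, ENNReal.smul_def, smul_eq_mul]

theorem memLocalLp_of_memLp_weightedVolume {F : Type} [NormedAddCommGroup F] {σ : ℝ}
    {f : EuclideanSpace ℝ (Fin n) → F} {p : ℝ≥0∞} (hf : MemLp f p (weightedVolume n σ)) :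
    MemLocalLp f p := fun K hK => by
  obtain ⟨c, hc⟩ := exists_restrict_le_smul_weightedVolume σ hK
  exact hf.of_measure_le_smul ENNReal.coe_ne_top hc

theorem IsL2Kernel.integrable_prod {𝕜 X Y : Type*} [RCLike 𝕜] [MeasurableSpace X]
    [MeasurableSpace Y] {μ : Measure X} {ν : Measure Y} [SFinite ν] {k : X → Y → 𝕜}
    {D : ℝ≥0} (h : IsL2Kernel μ ν k D) {χ : X → ℝ} (hχ : MemLp χ 2 μ) (ψ : Lp 𝕜 2 ν) :
    Integrable (fun p : X × Y => χ p.1 • (k p.1 p.2 * ψ p.2)) (μ.prod ν) := by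
  have hψ : Measurable (ψ : Y → 𝕜) := (Lp.stronglyMeasurable ψ).measurable
  have hmeas : AEStronglyMeasurable (fun p : X × Y => χ p.1 • (k p.1 p.2 * ψ p.2)) (μ.prod ν) :=
    hχ.1.comp_fst.smul (h.measurable.mul (hψ.comp measurable_snd)).aestronglyMeasurable
  refine ⟨hmeas, ?_⟩
  have hfubini : ∫⁻ p, ‖χ p.1 • (k p.1 p.2 * ψ p.2)‖ₑ ∂μ.prod ν
      = ∫⁻ x, ‖χ x‖ₑ * ∫⁻ y, ‖k x y‖ₑ * ‖ψ y‖ₑ ∂ν ∂μ := by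
    rw [lintegral_prod _ hmeas.enorm]
    simp only [enorm_smul, enorm_mul, lintegral_const_mul' _ _ enorm_ne_top]
  rw [HasFiniteIntegral, hfubini]
  refine (ENNReal.pow_lt_top_iff.trans (or_iff_left two_ne_zero)).1 ?_
  exact (lintegral_mul_sq_le hχ.1.enorm
    (measurable_lintegral_enorm_mul h.measurable hψ.enorm).aemeasurable).trans_lt
    (ENNReal.mul_lt_top (eLpNorm_two_lt_top_iff.1 hχ.2)
      (eLpNorm_two_lt_top_iff.1 (h.eLpNorm_lintegral_enorm_lt_top ψ)))

theorem IsL2Kernel.exists_of_le_smul {𝕜 X Y : Type*} [RCLike 𝕜] [MeasurableSpace X]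
    [MeasurableSpace Y] {μ μ' : Measure X} {ν : Measure Y} {k : X → Y → 𝕜} {D c : ℝ≥0}
    (h : IsL2Kernel μ ν k D) (hμ : μ' ≤ c • μ) : ∃ D' : ℝ≥0, IsL2Kernel μ' ν k D' := by
  refine ⟨c ^ (1 / 2 : ℝ≥0∞).toReal * D, h.measurable, fun g hg => ?_⟩
  rw [ENNReal.coe_mul, ENNReal.coe_rpow_of_nonneg _ ENNReal.toReal_nonneg, mul_assoc]
  exact (eLpNorm_le_of_measure_le_smul (c := (c : ℝ≥0∞)) hμ).trans
    (mul_le_mul_right (h.eLpNorm_lintegral_le g hg) _)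

section Convolution

variable {δ σ : ℝ} {D D' : ℝ≥0} {K dK : EuclideanSpace ℝ (Fin n) → ℂ}
  {χ : EuclideanSpace ℝ (Fin n) → ℝ}

theorem IsL2Kernel.integrable_prod_of_hasCompactSupport
    {k : EuclideanSpace ℝ (Fin n) → EuclideanSpace ℝ (Fin n) → ℂ}
    (h : IsL2Kernel (weightedVolume n σ) volume k D) (hχ : Continuous χ)
    (hχc : HasCompactSupport χ) (ψ : Lp ℂ 2 (volume : Measure (EuclideanSpace ℝ (Fin n)))) :
    Integrable (fun p : EuclideanSpace ℝ (Fin n) × EuclideanSpace ℝ (Fin n) =>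
      χ p.1 • (k p.1 p.2 * ψ p.2)) (volume.prod volume) := by
  obtain ⟨c, hc⟩ := exists_restrict_le_smul_weightedVolume σ hχc
  obtain ⟨D', h'⟩ := h.exists_of_le_smul hc
  have hintegrable := h'.integrable_prod ((hχ.memLp_of_hasCompactSupport hχc).restrict _) ψ
  have hrestrict : (volume.restrict (tsupport χ)).prod
      (volume : Measure (EuclideanSpace ℝ (Fin n)))
        = (volume.prod volume).restrict (tsupport χ ×ˢ univ) := by
    rw [← Measure.prod_restrict, Measure.restrict_univ]
  rw [hrestrict] at hintegrable
  refine (integrableOn_iff_integrable_of_support_subset fun p hp => ?_).1 hintegrable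
  exact ⟨subset_tsupport χ (left_ne_zero_of_smul hp), mem_univ _⟩

theorem IsL2Kernel.integral_smul_toCLM
    (h : IsL2Kernel (weightedVolume n σ) volume (weightedKernel K δ) D) (hχ : Continuous χ)
    (hχc : HasCompactSupport χ) (ψ : Lp ℂ 2 (volume : Measure (EuclideanSpace ℝ (Fin n)))) :
    ∫ x, χ x • h.toCLM ψ x
      = ∫ y, (((1 + ‖y‖ ^ 2) ^ (-(δ / 2)) : ℝ) * ψ y) * ∫ z, χ (z + y) • K z := by
  calc ∫ x, χ x • h.toCLM ψ x = ∫ x, ∫ y, χ x • (weightedKernel K δ x y * ψ y) := by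
        refine integral_congr_ae ?_
        filter_upwards [(volume_ac_weightedVolume n σ).ae_le (h.coeFn_toCLM ψ)] with x hx
        rw [hx, ← integral_smul]
    _ = ∫ y, ∫ x, χ x • (weightedKernel K δ x y * ψ y) :=
        integral_integral_swap (h.integrable_prod_of_hasCompactSupport hχ hχc ψ)
    _ = _ := integral_congr_ae (.of_forall fun y => ?_)
  simp only [← integral_const_mul]
  rw [← integral_add_right_eq_self _ y]
  refine integral_congr_ae (.of_forall fun x => ?_)
  simp only [weightedKernel, add_sub_cancel_right, real_smul]
  ring

theorem HasWeakPartial.convolution (hK : HasWeakPartial j K dK)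
    (h : IsL2Kernel (weightedVolume n σ) volume (weightedKernel K δ) D)
    (h' : IsL2Kernel (weightedVolume n σ) volume (weightedKernel dK δ) D')
    (ψ : Lp ℂ 2 (volume : Measure (EuclideanSpace ℝ (Fin n)))) :
    HasWeakPartial j (h.toCLM ψ) (h'.toCLM ψ) := by
  refine ⟨(memLocalLp_of_memLp_weightedVolume (Lp.memLp _)).locallyIntegrable one_le_two,
    (memLocalLp_of_memLp_weightedVolume (Lp.memLp _)).locallyIntegrable one_le_two,
    fun φ hφ hφc => ?_⟩
  rw [h.integral_smul_toCLM (continuous_fderiv_apply_const hφ _) (hφc.fderiv_apply ℝ _),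
    h'.integral_smul_toCLM hφ.continuous hφc, ← integral_neg]
  refine integral_congr_ae (.of_forall fun y => ?_)
  have htranslate := hK.2.2 (fun z => φ (z + y)) (hφ.comp (contDiff_id.add contDiff_const))
    (hφc.comp_homeomorph (Homeomorph.addRight y))
  simp only [fderiv_comp_add_right] at htranslate
  simp only [htranslate, mul_neg]

end Convolution

end GreenGradient

section GreenOperator

open scoped NNReal Topology
open Filter Set

variable {n : ℕ} {σ : ℝ}

instance isLocallyFiniteMeasure_weightedVolume : IsLocallyFiniteMeasure (weightedVolume n σ) :=
  .withDensity_ofReal (Continuous.rpow_const (by fun_prop)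
    fun x => Or.inl (one_add_norm_sq_pos x).ne')

theorem integral_eq_integral_weightedVolume (σ : ℝ) (g : EuclideanSpace ℝ (Fin n) → ℂ) :
    ∫ x, g x = ∫ x, ((1 + ‖x‖ ^ 2) ^ (-σ) : ℝ) • g x ∂weightedVolume n σ := by
  rw [weightedVolume, integral_withDensity_eq_integral_toReal_smul
    (measurable_bracket σ).ennreal_ofReal (.of_forall fun _ => ENNReal.ofReal_lt_top)]
  refine integral_congr_ae (.of_forall fun x => ?_)
  have hpos := one_add_norm_sq_pos x
  simp only [ENNReal.toReal_ofReal (Real.rpow_nonneg hpos.le σ), smul_smul, ← Real.rpow_add hpos,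
    add_neg_cancel, Real.rpow_zero, one_smul]

theorem continuous_integral_test_smul {χ : EuclideanSpace ℝ (Fin n) → ℝ} (hχ : Continuous χ)
    (hχc : HasCompactSupport χ) :
    Continuous fun f : Lp ℂ 2 (weightedVolume n σ) => ∫ x, χ x • f x := by
  have hcont : Continuous fun x : EuclideanSpace ℝ (Fin n) =>
      (((1 + ‖x‖ ^ 2) ^ (-σ) * χ x : ℝ) : ℂ) :=
    continuous_ofReal.comp ((Continuous.rpow_const (by fun_prop)
      fun x => Or.inl (one_add_norm_sq_pos x).ne').mul hχ)
  have hmem : MemLp (fun x : EuclideanSpace ℝ (Fin n) => (((1 + ‖x‖ ^ 2) ^ (-σ) * χ x : ℝ) : ℂ)) 2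
      (weightedVolume n σ) :=
    hcont.memLp_of_hasCompactSupport (hχc.mul_left.comp_left ofReal_zero)
  have hinner : (fun f : Lp ℂ 2 (weightedVolume n σ) => ∫ x, χ x • f x)
      = fun f => inner ℂ (hmem.toLp _) f := by
    funext f
    rw [L2.inner_def, integral_eq_integral_weightedVolume σ]
    refine integral_congr_ae ?_
    filter_upwards [hmem.coeFn_toLp] with x hx
    rw [hx, RCLike.inner_apply, conj_ofReal, smul_smul, real_smul, mul_comm]
  rw [hinner]
  exact continuous_const.inner continuous_id

theorem coeFn_compLpL_proj (j : Fin n)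
    (v : Lp (EuclideanSpace ℂ (Fin n)) 2 (weightedVolume n σ)) :
    (EuclideanSpace.proj (𝕜 := ℂ) j).compLpL 2 (weightedVolume n σ) v
      =ᵐ[volume] fun x => v x j :=
  (volume_ac_weightedVolume n σ).ae_le (ContinuousLinearMap.coeFn_compLpL _ v)

theorem mem_weightedH1_iff {f : WithLp 2 (Lp ℂ 2 (weightedVolume n σ) ×
    Lp (EuclideanSpace ℂ (Fin n)) 2 (weightedVolume n σ))} :
    f ∈ WeightedH1 n σ ↔ ∀ (j : Fin n) (φ : EuclideanSpace ℝ (Fin n) → ℝ), ContDiff ℝ ∞ φ →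
      HasCompactSupport φ → ∫ x, fderiv ℝ φ x (EuclideanSpace.single j 1) • f.fst x
        = -∫ x, φ x • (EuclideanSpace.proj (𝕜 := ℂ) j).compLpL 2 (weightedVolume n σ) f.snd x := by
  have hproj (j : Fin n) (φ : EuclideanSpace ℝ (Fin n) → ℝ) :
      ∫ x, φ x • (EuclideanSpace.proj (𝕜 := ℂ) j).compLpL 2 (weightedVolume n σ) f.snd x
        = ∫ x, φ x • f.snd x j :=
    integral_congr_ae ((coeFn_compLpL_proj j f.snd).mono fun x hx => by simp only [hx])
  simp only [hproj]
  refine ⟨fun h j => (h j).2.2, fun h j => ⟨?_, ?_, h j⟩⟩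
  · exact (memLocalLp_of_memLp_weightedVolume (Lp.memLp f.fst)).locallyIntegrable one_le_two
  · exact ((memLocalLp_of_memLp_weightedVolume (Lp.memLp _)).locallyIntegrable one_le_two).congr
      (coeFn_compLpL_proj j f.snd)

theorem isClosed_weightedH1 (n : ℕ) (σ : ℝ) :
    IsClosed (WeightedH1 n σ : Set (WithLp 2 (Lp ℂ 2 (weightedVolume n σ) ×
      Lp (EuclideanSpace ℂ (Fin n)) 2 (weightedVolume n σ)))) := by
  rw [← SetLike.setOfPred_mem_eq (WeightedH1 n σ)]
  simp only [mem_weightedH1_iff, ofPred_forall]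
  refine isClosed_iInter fun j => isClosed_iInter fun φ => isClosed_iInter fun hφ =>
    isClosed_iInter fun hφc => isClosed_eq ?_ ?_
  · exact (continuous_integral_test_smul (continuous_fderiv_apply_const hφ _)
      (hφc.fderiv_apply ℝ _)).comp (WithLp.fstL 2 ℂ _ _).continuous
  · exact ((continuous_integral_test_smul hφ.continuous hφc).comp
      (((EuclideanSpace.proj (𝕜 := ℂ) j).compLpL 2 (weightedVolume n σ)).continuous.comp
        (WithLp.sndL 2 ℂ _ _).continuous)).neg

theorem isCompactOperator_finsetSum {𝕜 E F ι : Type*} [NontriviallyNormedField 𝕜]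
    [NormedAddCommGroup E] [NormedSpace 𝕜 E] [NormedAddCommGroup F] [NormedSpace 𝕜 F]
    (s : Finset ι) {T : ι → E →L[𝕜] F} (hT : ∀ i ∈ s, IsCompactOperator (T i)) :
    IsCompactOperator (∑ i ∈ s, T i : E →L[𝕜] F) :=
  Finset.sum_induction T (fun S : E →L[𝕜] F => IsCompactOperator S) (fun _ _ hS hT => hS.add hT)
    isCompactOperator_zero hT

theorem isCompactOperator_prod {𝕜 E F G : Type*} [NontriviallyNormedField 𝕜]
    [NormedAddCommGroup E] [NormedSpace 𝕜 E] [NormedAddCommGroup F] [NormedSpace 𝕜 F]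
    [NormedAddCommGroup G] [NormedSpace 𝕜 G] {S : E →L[𝕜] F} {T : E →L[𝕜] G}
    (hS : IsCompactOperator S) (hT : IsCompactOperator T) : IsCompactOperator (S.prod T) := by
  have hsum : ⇑(S.prod T) = ContinuousLinearMap.inl 𝕜 F G ∘ S
      + ContinuousLinearMap.inr 𝕜 F G ∘ T := by
    ext x <;> simp
  rw [hsum]
  exact (hS.clm_comp (ContinuousLinearMap.inl 𝕜 F G)).add
    (hT.clm_comp (ContinuousLinearMap.inr 𝕜 F G))

/-- The embedding of `L²(μ)` into the `j`-th coordinate of `L²(μ; ℂⁿ)`. -/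
noncomputable def lpSingle {X : Type*} [MeasurableSpace X] (μ : Measure X) (j : Fin n) :
    Lp ℂ 2 μ →L[ℂ] Lp (EuclideanSpace ℂ (Fin n)) 2 μ :=
  (ContinuousLinearMap.toSpanSingleton ℂ (EuclideanSpace.single j (1 : ℂ))).compLpL 2 μ

theorem coeFn_sum_lpSingle {X : Type*} [MeasurableSpace X] {μ : Measure X}
    (f : Fin n → Lp ℂ 2 μ) (i : Fin n) :
    (fun x => (∑ j, lpSingle μ j (f j) : Lp (EuclideanSpace ℂ (Fin n)) 2 μ) x i)
      =ᵐ[μ] f i := by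
  have hsingle : ∀ᵐ x ∂μ, ∀ j, lpSingle μ j (f j) x
      = f j x • (EuclideanSpace.single j 1 : EuclideanSpace ℂ (Fin n)) :=
    ae_all_iff.2 fun j => ContinuousLinearMap.coeFn_compLpL (ContinuousLinearMap.toSpanSingleton ℂ
      (EuclideanSpace.single j (1 : ℂ))) (f j)
  filter_upwards [hsingle, Lp.coeFn_fun_finsetSum Finset.univ fun j => lpSingle μ j (f j)]
    with x hx hsum
  rw [hsum]
  simp [hx, Pi.single_apply]

theorem exists_isCompactOperator_weightedH1 {E : Type*} [NormedAddCommGroup E] [NormedSpace ℂ E]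
    {S : E →L[ℂ] Lp ℂ 2 (weightedVolume n σ)} {T : Fin n → E →L[ℂ] Lp ℂ 2 (weightedVolume n σ)}
    (hS : IsCompactOperator S) (hT : ∀ j, IsCompactOperator (T j))
    (hST : ∀ ψ j, HasWeakPartial j (S ψ) (T j ψ)) :
    ∃ P : E →L[ℂ] WeightedH1 n σ, IsCompactOperator P ∧ ∀ ψ, (P ψ).1.fst = S ψ := by
  let grad : E →L[ℂ] Lp (EuclideanSpace ℂ (Fin n)) 2 (weightedVolume n σ) :=
    ∑ j, (lpSingle _ j).comp (T j)
  have hgrad : IsCompactOperator grad :=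
    isCompactOperator_finsetSum _ fun j _ => (hT j).clm_comp (lpSingle _ j)
  let toWithLp := (WithLp.prodContinuousLinearEquiv 2 ℂ (Lp ℂ 2 (weightedVolume n σ))
    (Lp (EuclideanSpace ℂ (Fin n)) 2 (weightedVolume n σ))).symm.toContinuousLinearMap
  have hmem (ψ : E) : toWithLp.comp (S.prod grad) ψ ∈ WeightedH1 n σ := fun j => by
    refine (hST ψ j).congr ae_eq_rfl ((volume_ac_weightedVolume n σ).ae_le ?_)
    have hsum : grad ψ = ∑ j, lpSingle _ j (T j ψ) := by simp [grad]
    change T j ψ =ᵐ[weightedVolume n σ] fun x => grad ψ x j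
    rw [hsum]
    exact (coeFn_sum_lpSingle (fun j => T j ψ) j).symm
  exact ⟨(toWithLp.comp (S.prod grad)).codRestrict _ hmem,
    ((isCompactOperator_prod hS hgrad).clm_comp toWithLp).codRestrict hmem
      (isClosed_weightedH1 n σ), fun _ => rfl⟩

theorem IsRadialProfile.exists_isCompactOperator (hn : 0 < n) {δ : ℝ} (hδ : (n : ℝ) + 1 < 4 * δ)
    {g g' : ℝ → ℂ} (hg : IsRadialProfile ((n : ℝ) - 1) (((n : ℝ) - 1) / 2) g g') :
    ∃ T : Lp ℂ 2 (volume : Measure (EuclideanSpace ℝ (Fin n))) →L[ℂ] WeightedH1 n (-δ),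
      IsCompactOperator T ∧ ∀ ψ, ∀ᵐ x : EuclideanSpace ℝ (Fin n),
        Integrable (fun y => g ‖x - y‖ * ((((1 + ‖y‖ ^ 2) ^ (-(δ / 2)) : ℝ) : ℂ) * ψ y)) ∧
        h1Fun (T ψ) x = ∫ y, g ‖x - y‖ * ((((1 + ‖y‖ ^ 2) ^ (-(δ / 2)) : ℝ) : ℂ) * ψ y) := by
  have hn1 : (1 : ℝ) ≤ n := by exact_mod_cast hn
  have : Nonempty (Fin n) := ⟨⟨0, hn⟩⟩
  obtain ⟨C, hC, hbound⟩ := hg.exists_bound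
  have hm0 : 0 ≤ C * ((0 : ℝ) ^ (-((n : ℝ) - 1)) + (0 : ℝ) ^ (-(((n : ℝ) - 1) / 2))) := by
    positivity
  obtain ⟨D, hD, hDcompact⟩ := exists_isCompactOperator_weightedKernel hn hδ
    (measurable_radialKernel hg.continuousOn) hC
    (norm_radialKernel_le (fun r hr => (hbound r hr).1) hm0)
  choose D' hD' hD'compact using fun j => exists_isCompactOperator_weightedKernel hn hδ
    (measurable_radialPartial hg.continuousOn_deriv j) hC
    (norm_radialPartial_le (fun r hr => (hbound r hr).2) hm0 j)
  obtain ⟨T, hT, hTfst⟩ := exists_isCompactOperator_weightedH1 hDcompact hD'compact fun ψ j =>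
    (hg.hasWeakPartial hn (by linarith) le_rfl (by linarith) (by linarith) j).convolution
      hD (hD' j) ψ
  refine ⟨T, hT, fun ψ => ?_⟩
  have hac := volume_ac_weightedVolume n (-δ)
  filter_upwards [hac.ae_le (hD.ae_integrable ψ), hac.ae_le (hD.coeFn_toCLM ψ)]
    with x hintegrable hval
  have hkernel : ∀ᵐ y, weightedKernel (radialKernel n g) δ x y * ψ y
      = g ‖x - y‖ * ((((1 + ‖y‖ ^ 2) ^ (-(δ / 2)) : ℝ) : ℂ) * ψ y) := by
    filter_upwards [Measure.ae_ne volume x] with y hy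
    rw [weightedKernel, radialKernel_of_ne (sub_ne_zero.2 hy.symm), mul_assoc]
  refine ⟨hintegrable.congr hkernel, ?_⟩
  rw [← integral_congr_ae hkernel, h1Fun, hTfst, hval]

theorem exists_isCompactOperator_outgoingGreen (hn : n = 2 ∨ n = 3) {k : ℝ} (hk : k ≠ 0) {δ : ℝ}
    (hδ : 1 < δ) :
    ∃ T : Lp ℂ 2 (volume : Measure (EuclideanSpace ℝ (Fin n))) →L[ℂ] WeightedH1 n (-δ),
      IsCompactOperator T ∧ ∀ ψ, ∀ᵐ x : EuclideanSpace ℝ (Fin n),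
        Integrable (fun y => outgoingGreen n k ‖x - y‖
          * ((((1 + ‖y‖ ^ 2) ^ (-(δ / 2)) : ℝ) : ℂ) * ψ y)) ∧
        h1Fun (T ψ) x = ∫ y, outgoingGreen n k ‖x - y‖
          * ((((1 + ‖y‖ ^ 2) ^ (-(δ / 2)) : ℝ) : ℂ) * ψ y) := by
  obtain ⟨g', hg⟩ := exists_isRadialProfile_outgoingGreen hn hk
  have hn3 : (n : ℝ) ≤ 3 := by exact_mod_cast (by omega : n ≤ 3)
  exact hg.exists_isCompactOperator (by omega) (by linarith)

end GreenOperator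

/-! ### The first-order perturbation -/

section PotentialOperator

open scoped NNReal Topology
open Filter Set

variable {n : ℕ} {δ σ : ℝ}

theorem eLpNorm_bracket_mul_norm (δ : ℝ) {g : EuclideanSpace ℝ (Fin n) → ℂ} (hg : Measurable g) :
    eLpNorm (fun x => (1 + ‖x‖ ^ 2) ^ (-(δ / 2)) * ‖g x‖) 2 volume
      = eLpNorm g 2 (weightedVolume n (-δ)) := by
  refine (ENNReal.pow_right_strictMono two_ne_zero).injective ?_
  rw [eLpNorm_two_sq, eLpNorm_two_sq, lintegral_weightedVolume _ (hg.enorm.pow_const 2)]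
  refine lintegral_congr fun x => ?_
  have hpos := one_add_norm_sq_pos x
  rw [enorm_mul, mul_pow, enorm_norm, Real.enorm_of_nonneg (Real.rpow_nonneg hpos.le _),
    ← ENNReal.ofReal_pow (Real.rpow_nonneg hpos.le _), ← Real.rpow_mul_natCast hpos.le]
  congr 3
  push_cast
  ring

theorem norm_bracket_mul_mul_le {w z : ℂ} {C r : ℝ}
    (hw : ‖w‖ ≤ C * (1 + r ^ 2) ^ (-δ)) :
    ‖(((1 + r ^ 2) ^ (δ / 2) : ℝ) : ℂ) * (w * z)‖ ≤ C * ‖(1 + r ^ 2) ^ (-(δ / 2)) * ‖z‖‖ := by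
  have hpos : 0 < 1 + r ^ 2 := by positivity
  have hexp : (1 + r ^ 2) ^ (δ / 2) * (1 + r ^ 2) ^ (-δ) = (1 + r ^ 2) ^ (-(δ / 2)) := by
    rw [← Real.rpow_add hpos]
    ring_nf
  calc ‖(((1 + r ^ 2) ^ (δ / 2) : ℝ) : ℂ) * (w * z)‖ = (1 + r ^ 2) ^ (δ / 2) * (‖w‖ * ‖z‖) := by
        rw [norm_mul, norm_mul, norm_real, Real.norm_of_nonneg (by positivity)]
    _ ≤ (1 + r ^ 2) ^ (δ / 2) * (C * (1 + r ^ 2) ^ (-δ) * ‖z‖) := by gcongr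
    _ = C * ((1 + r ^ 2) ^ (δ / 2) * (1 + r ^ 2) ^ (-δ) * ‖z‖) := by ring
    _ = C * ‖(1 + r ^ 2) ^ (-(δ / 2)) * ‖z‖‖ := by
        rw [hexp, Real.norm_of_nonneg (by positivity)]

theorem eLpNorm_bracket_mul_mul_le {w g : EuclideanSpace ℝ (Fin n) → ℂ} {C : ℝ≥0}
    {μ : Measure (EuclideanSpace ℝ (Fin n))} (hμ : μ ≤ volume) (hg : Measurable g)
    (hw : ∀ᵐ x ∂μ, ‖w x‖ ≤ C * (1 + ‖x‖ ^ 2) ^ (-δ)) :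
    eLpNorm (fun x => (((1 + ‖x‖ ^ 2) ^ (δ / 2) : ℝ) : ℂ) * (w x * g x)) 2 μ
      ≤ C * eLpNorm g 2 (weightedVolume n (-δ)) := by
  rw [← eLpNorm_bracket_mul_norm δ hg]
  refine (eLpNorm_le_nnreal_smul_eLpNorm_of_ae_le_mul
    (hw.mono fun x hx => norm_bracket_mul_mul_le hx) 2).trans ?_
  exact mul_le_mul_right (eLpNorm_mono_measure _ hμ) _

theorem measurable_h1Fun (f : WeightedH1 n σ) : Measurable (h1Fun f) :=
  (Lp.stronglyMeasurable f.1.fst).measurable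

theorem measurable_h1Grad (f : WeightedH1 n σ) (j : Fin n) : Measurable fun x => h1Grad f x j :=
  (EuclideanSpace.proj (𝕜 := ℂ) j).continuous.measurable.comp
    (Lp.stronglyMeasurable f.1.snd).measurable

theorem eLpNorm_h1Fun_le (f : WeightedH1 n σ) :
    eLpNorm (h1Fun f) 2 (weightedVolume n σ) ≤ ‖f‖ₑ := by
  have h := WithLp.norm_fst_le _ f.1
  rwa [← enorm_le_iff_norm_le, Lp.enorm_def] at h

theorem eLpNorm_h1Grad_le (f : WeightedH1 n σ) (j : Fin n) :
    eLpNorm (fun x => h1Grad f x j) 2 (weightedVolume n σ) ≤ ‖f‖ₑ := by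
  have h := WithLp.norm_snd_le _ f.1
  rw [← enorm_le_iff_norm_le, Lp.enorm_def] at h
  exact (eLpNorm_mono fun x => PiLp.norm_apply_le _ j).trans h

theorem memLocalLp_h1Fun (f : WeightedH1 n σ) : MemLocalLp (h1Fun f) 2 :=
  memLocalLp_of_memLp_weightedVolume (Lp.memLp f.1.fst)

theorem memLocalLp_h1Grad (f : WeightedH1 n σ) (j : Fin n) :
    MemLocalLp (fun x => h1Grad f x j) 2 :=
  memLocalLp_of_memLp_weightedVolume (σ := σ) ⟨(measurable_h1Grad f j).aestronglyMeasurable,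
    (eLpNorm_h1Grad_le f j).trans_lt enorm_lt_top⟩

theorem exists_eLpNorm_restrict_le_weightedVolume (σ : ℝ) {K : Set (EuclideanSpace ℝ (Fin n))}
    (hK : IsCompact K) :
    ∃ b : ℝ≥0, ∀ g : EuclideanSpace ℝ (Fin n) → ℂ,
      eLpNorm g 2 (volume.restrict K) ≤ b * eLpNorm g 2 (weightedVolume n σ) := by
  obtain ⟨c, hc⟩ := exists_restrict_le_smul_weightedVolume σ hK
  refine ⟨c ^ (1 / 2 : ℝ≥0∞).toReal, fun g => ?_⟩
  rw [ENNReal.coe_rpow_of_nonneg _ ENNReal.toReal_nonneg]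
  exact eLpNorm_le_of_measure_le_smul (c := (c : ℝ≥0∞)) hc

section Multiplication

variable {p : ℝ≥0∞} {B : EuclideanSpace ℝ (Fin n) → ℂ}

theorem exists_eLpNorm_mul_h1Fun_le (hnp : (n = 2 ∧ 2 < p) ∨ (n = 3 ∧ 3 ≤ p))
    (hB : MemLocalLp B p) (σ R : ℝ) :
    ∃ D : ℝ≥0, ∀ f : WeightedH1 n σ,
      eLpNorm (fun x => B x * h1Fun f x) 2 (volume.restrict (Metric.closedBall 0 R))
        ≤ D * ‖f‖ₑ := by
  obtain ⟨A, hA⟩ := exists_eLpNorm_mul_le hnp hB R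
  obtain ⟨b, hb⟩ := exists_eLpNorm_restrict_le_weightedVolume (n := n) σ
    (isCompact_closedBall 0 (|R| + 2))
  refine ⟨A * (b + n * b), fun f => ?_⟩
  have hfun : eLpNorm (h1Fun f) 2 (volume.restrict (Metric.closedBall 0 (|R| + 2))) ≤ b * ‖f‖ₑ :=
    (hb _).trans (mul_le_mul_right (eLpNorm_h1Fun_le f) _)
  have hgrad : ∑ j, eLpNorm (fun x => h1Grad f x j) 2
      (volume.restrict (Metric.closedBall 0 (|R| + 2))) ≤ n * (b * ‖f‖ₑ) := by
    refine (Finset.sum_le_card_nsmul _ _ (b * ‖f‖ₑ) fun j _ => (hb _).trans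
      (mul_le_mul_right (eLpNorm_h1Grad_le f j) _)).trans_eq ?_
    rw [Finset.card_univ, Fintype.card_fin, nsmul_eq_mul]
  calc eLpNorm (fun x => B x * h1Fun f x) 2 (volume.restrict (Metric.closedBall 0 R))
      ≤ A * (b * ‖f‖ₑ + n * (b * ‖f‖ₑ)) :=
        (hA (h1Fun f) (fun j x => h1Grad f x j) f.2 (memLocalLp_h1Fun f)
          (memLocalLp_h1Grad f)).trans (by gcongr)
    _ = ((A * (b + n * b) : ℝ≥0) : ℝ≥0∞) * ‖f‖ₑ := by
        push_cast
        ring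

theorem eLpNorm_bracket_mul_restrict_closedBall_le (hδ : 0 ≤ δ) (R : ℝ)
    (g : EuclideanSpace ℝ (Fin n) → ℂ) :
    eLpNorm (fun x => (((1 + ‖x‖ ^ 2) ^ (δ / 2) : ℝ) : ℂ) * g x) 2
        (volume.restrict (Metric.closedBall 0 R))
      ≤ ((1 + R ^ 2) ^ (δ / 2)).toNNReal
        * eLpNorm g 2 (volume.restrict (Metric.closedBall 0 R)) := by
  refine eLpNorm_le_nnreal_smul_eLpNorm_of_ae_le_mul ?_ 2
  filter_upwards [ae_restrict_mem measurableSet_closedBall] with x hx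
  have hxR : ‖x‖ ≤ R := mem_closedBall_zero_iff.1 hx
  rw [← NNReal.coe_le_coe, NNReal.coe_mul, coe_nnnorm, coe_nnnorm,
    Real.coe_toNNReal _ (by positivity), norm_mul, norm_real, Real.norm_of_nonneg (by positivity)]
  gcongr

theorem eLpNorm_le_restrict_add_restrict_compl {X F : Type*} [MeasurableSpace X]
    [NormedAddCommGroup F] {μ : Measure X} {f : X → F} {s : Set X} {q : ℝ≥0∞}
    (hf : AEStronglyMeasurable f μ) (hs : MeasurableSet s) (hq : 1 ≤ q) :
    eLpNorm f q μ ≤ eLpNorm f q (μ.restrict s) + eLpNorm f q (μ.restrict sᶜ) := by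
  rw [← eLpNorm_indicator_eq_eLpNorm_restrict hs, ← eLpNorm_indicator_eq_eLpNorm_restrict hs.compl]
  conv_lhs => rw [← indicator_self_add_compl s f]
  exact eLpNorm_add_le (hf.indicator hs) (hf.indicator hs.compl) hq

theorem aestronglyMeasurable_bracket_mul {g : EuclideanSpace ℝ (Fin n) → ℂ}
    (hg : AEStronglyMeasurable g) (s : ℝ) :
    AEStronglyMeasurable fun x => (((1 + ‖x‖ ^ 2) ^ s : ℝ) : ℂ) * g x :=
  (measurable_ofReal.comp (measurable_bracket s)).aestronglyMeasurable.mul hg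

theorem exists_eLpNorm_bracket_mul_h1Fun_le (hnp : (n = 2 ∧ 2 < p) ∨ (n = 3 ∧ 3 ≤ p))
    (hB : MemLocalLp B p) {R : ℝ} (hδ : 0 ≤ δ) {C : ℝ≥0}
    (hBC : ∀ᵐ x, R ≤ ‖x‖ → ‖B x‖ ≤ C * (1 + ‖x‖ ^ 2) ^ (-δ)) :
    ∃ D : ℝ≥0, ∀ f : WeightedH1 n (-δ),
      eLpNorm (fun x => (((1 + ‖x‖ ^ 2) ^ (δ / 2) : ℝ) : ℂ) * (B x * h1Fun f x)) 2 volume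
        ≤ D * ‖f‖ₑ := by
  obtain ⟨A, hA⟩ := exists_eLpNorm_mul_h1Fun_le hnp hB (-δ) R
  refine ⟨((1 + R ^ 2) ^ (δ / 2)).toNNReal * A + C, fun f => ?_⟩
  have hBout : ∀ᵐ x ∂volume.restrict (Metric.closedBall 0 R)ᶜ,
      ‖B x‖ ≤ C * (1 + ‖x‖ ^ 2) ^ (-δ) := by
    filter_upwards [ae_restrict_of_ae hBC, ae_restrict_mem measurableSet_closedBall.compl]
      with x hx hxS
    exact hx (not_le.1 fun h => hxS (mem_closedBall_zero_iff.2 h)).le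
  refine (eLpNorm_le_restrict_add_restrict_compl (aestronglyMeasurable_bracket_mul
    (hB.aestronglyMeasurable.mul (measurable_h1Fun f).aestronglyMeasurable) _)
    (measurableSet_closedBall (x := 0) (ε := R)) one_le_two).trans ?_
  rw [ENNReal.coe_add, ENNReal.coe_mul, add_mul, mul_assoc]
  exact add_le_add ((eLpNorm_bracket_mul_restrict_closedBall_le hδ R _).trans
      (mul_le_mul_right (hA f) _))
    ((eLpNorm_bracket_mul_mul_le Measure.restrict_le_self (measurable_h1Fun f) hBout).trans
      (mul_le_mul_right (eLpNorm_h1Fun_le f) _))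

theorem exists_clm_mul_of_eLpNorm_le {𝕜 H X : Type*} [RCLike 𝕜] [NormedAddCommGroup H]
    [NormedSpace 𝕜 H] [MeasurableSpace X] {μ ν : Measure X} (hμν : μ ≪ ν)
    (S : H →L[𝕜] Lp 𝕜 2 ν) {m : X → 𝕜} (hm : AEStronglyMeasurable m μ) {C : ℝ≥0}
    (hC : ∀ f, eLpNorm (fun x => m x * S f x) 2 μ ≤ C * ‖f‖ₑ) :
    ∃ M : H →L[𝕜] Lp 𝕜 2 μ, ∀ f, M f =ᵐ[μ] fun x => m x * S f x := by
  have hmem (f : H) : MemLp (fun x => m x * S f x) 2 μ :=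
    ⟨hm.mul (Lp.stronglyMeasurable _).aestronglyMeasurable,
      (hC f).trans_lt (ENNReal.mul_lt_top ENNReal.coe_lt_top enorm_lt_top)⟩
  refine ⟨LinearMap.mkContinuous
    { toFun := fun f => (hmem f).toLp _
      map_add' := fun f g => by
        rw [← MemLp.toLp_add]
        refine MemLp.toLp_congr _ _ ?_
        rw [map_add]
        filter_upwards [hμν.ae_le (Lp.coeFn_add (S f) (S g))] with x hx
        rw [hx, Pi.add_apply, Pi.add_apply, mul_add]
      map_smul' := fun c f => by
        rw [RingHom.id_apply, ← MemLp.toLp_const_smul]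
        refine MemLp.toLp_congr _ _ ?_
        rw [map_smul]
        filter_upwards [hμν.ae_le (Lp.coeFn_smul c (S f))] with x hx
        rw [hx, Pi.smul_apply, Pi.smul_apply, mul_smul_comm] } C fun f => ?_,
    fun f => (hmem f).coeFn_toLp⟩
  rw [LinearMap.coe_mk, AddHom.coe_mk, Lp.norm_toLp]
  exact ENNReal.toReal_le_of_le_ofReal (by positivity) ((hC f).trans_eq
    (by rw [ENNReal.ofReal_mul C.coe_nonneg, ENNReal.ofReal_coe_nnreal, ofReal_norm]))

theorem exists_clm_mul_h1Fun (hnp : (n = 2 ∧ 2 < p) ∨ (n = 3 ∧ 3 ≤ p))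
    (hB : MemLocalLp B p) {R : ℝ} (hδ : 0 ≤ δ) {C : ℝ≥0}
    (hBC : ∀ᵐ x, R ≤ ‖x‖ → ‖B x‖ ≤ C * (1 + ‖x‖ ^ 2) ^ (-δ)) :
    ∃ M : WeightedH1 n (-δ) →L[ℂ] Lp ℂ 2 (volume : Measure (EuclideanSpace ℝ (Fin n))),
      ∀ f, M f =ᵐ[volume] fun x => (((1 + ‖x‖ ^ 2) ^ (δ / 2) : ℝ) : ℂ) * (B x * h1Fun f x) := by
  obtain ⟨D, hD⟩ := exists_eLpNorm_bracket_mul_h1Fun_le hnp hB hδ hBC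
  simp only [← mul_assoc] at hD ⊢
  exact exists_clm_mul_of_eLpNorm_le (volume_ac_weightedVolume n (-δ))
    ((WithLp.fstL 2 ℂ _ _).comp (WeightedH1 n (-δ)).subtypeL)
    (aestronglyMeasurable_bracket_mul hB.aestronglyMeasurable _) hD

theorem exists_clm_mul_h1Grad {w : EuclideanSpace ℝ (Fin n) → ℂ} (hwm : AEStronglyMeasurable w)
    {C : ℝ≥0} (hw : ∀ᵐ x, ‖w x‖ ≤ C * (1 + ‖x‖ ^ 2) ^ (-δ)) (j : Fin n) :
    ∃ M : WeightedH1 n (-δ) →L[ℂ] Lp ℂ 2 (volume : Measure (EuclideanSpace ℝ (Fin n))),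
      ∀ f, M f =ᵐ[volume] fun x => (((1 + ‖x‖ ^ 2) ^ (δ / 2) : ℝ) : ℂ) * (w x * h1Grad f x j) := by
  let S : WeightedH1 n (-δ) →L[ℂ] Lp ℂ 2 (weightedVolume n (-δ)) :=
    ((EuclideanSpace.proj (𝕜 := ℂ) j).compLpL 2 _).comp
      ((WithLp.sndL 2 ℂ _ _).comp (WeightedH1 n (-δ)).subtypeL)
  have hS (f : WeightedH1 n (-δ)) : (fun x => (((1 + ‖x‖ ^ 2) ^ (δ / 2) : ℝ) : ℂ) * w x * S f x)
      =ᵐ[volume] fun x => (((1 + ‖x‖ ^ 2) ^ (δ / 2) : ℝ) : ℂ) * (w x * h1Grad f x j) :=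
    (coeFn_compLpL_proj j f.1.snd).mono fun x hx =>
      (mul_assoc _ _ _).trans (congrArg (fun z => _ * (w x * z)) hx)
  obtain ⟨M, hM⟩ := exists_clm_mul_of_eLpNorm_le (volume_ac_weightedVolume n (-δ)) S
    (aestronglyMeasurable_bracket_mul hwm (δ / 2)) (C := C) fun f => by
      rw [eLpNorm_congr_ae (hS f)]
      exact (eLpNorm_bracket_mul_mul_le le_rfl (measurable_h1Grad f j) hw).trans
        (mul_le_mul_right (eLpNorm_h1Grad_le f j) _)
  exact ⟨M, fun f => (hM f).trans (hS f)⟩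

theorem exists_firstOrderOperator (hnp : (n = 2 ∧ 2 < p) ∨ (n = 3 ∧ 3 ≤ p))
    (hB : MemLocalLp B p) {R : ℝ} (hδ : 0 ≤ δ) {C : ℝ≥0}
    (hBC : ∀ᵐ x, R ≤ ‖x‖ → ‖B x‖ ≤ C * (1 + ‖x‖ ^ 2) ^ (-δ))
    {w : Fin n → EuclideanSpace ℝ (Fin n) → ℂ} (hwm : ∀ j, AEStronglyMeasurable (w j))
    {C' : ℝ≥0} (hw : ∀ j, ∀ᵐ x, ‖w j x‖ ≤ C' * (1 + ‖x‖ ^ 2) ^ (-δ)) :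
    ∃ M : WeightedH1 n (-δ) →L[ℂ] Lp ℂ 2 (volume : Measure (EuclideanSpace ℝ (Fin n))),
      ∀ f, M f =ᵐ[volume] fun x => (((1 + ‖x‖ ^ 2) ^ (δ / 2) : ℝ) : ℂ)
        * ((∑ j, w j x * h1Grad f x j) + B x * h1Fun f x) := by
  obtain ⟨M₀, hM₀⟩ := exists_clm_mul_h1Fun hnp hB hδ hBC
  choose M₁ hM₁ using fun j => exists_clm_mul_h1Grad (hwm j) (hw j) j
  refine ⟨(∑ j, M₁ j) + M₀, fun f => ?_⟩
  rw [add_apply, sum_apply]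
  filter_upwards [Lp.coeFn_add (∑ j, M₁ j f) (M₀ f), Lp.coeFn_fun_finsetSum Finset.univ (M₁ · f),
    ae_all_iff.2 fun j => hM₁ j f, hM₀ f] with x hadd hsum hgrad hfun
  rw [hadd, Pi.add_apply, hsum, hfun, mul_add, Finset.mul_sum]
  simp only [hgrad]

end Multiplication

end PotentialOperator

section LippmannSchwinger

open scoped NNReal Topology
open Filter Set

variable {n : ℕ}

theorem MemWeightedLp.memLocalLp {F : Type} [NormedAddCommGroup F] [NormedSpace ℝ F]
    {f : EuclideanSpace ℝ (Fin n) → F} {p : ℝ≥0∞} {σ : ℝ} (h : MemWeightedLp f p σ) :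
    MemLocalLp f p := fun K hK => by
  have hcont : Continuous fun x : EuclideanSpace ℝ (Fin n) => (1 + ‖x‖ ^ 2) ^ (-(σ / 2)) :=
    Continuous.rpow_const (by fun_prop) fun x => Or.inl (one_add_norm_sq_pos x).ne'
  obtain ⟨M, hM⟩ := hK.exists_bound_of_continuousOn hcont.continuousOn
  have hcancel (x : EuclideanSpace ℝ (Fin n)) :
      (1 + ‖x‖ ^ 2) ^ (-(σ / 2)) • ((1 + ‖x‖ ^ 2) ^ (σ / 2) : ℝ) • f x = f x := by
    rw [smul_smul, ← Real.rpow_add (one_add_norm_sq_pos x), neg_add_cancel, Real.rpow_zero,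
      one_smul]
  refine (h.restrict K).of_le_mul (c := M)
    ((hcont.aestronglyMeasurable.smul (h.restrict K).1).congr (Eventually.of_forall hcancel)) ?_
  filter_upwards [ae_restrict_mem hK.measurableSet] with x hx
  conv_lhs => rw [← hcancel x, norm_smul]
  exact mul_le_mul_of_nonneg_right (hM x hx) (norm_nonneg _)

theorem MemLocalLp.coord {ι : Type} [Fintype ι] {f : EuclideanSpace ℝ (Fin n) → EuclideanSpace ℝ ι}
    {p : ℝ≥0∞} (h : MemLocalLp f p) (i : ι) : MemLocalLp (fun x => f x i) p := fun K hK =>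
  (h K hK).eval_piLp i

theorem MemLocalLp.ofReal {f : EuclideanSpace ℝ (Fin n) → ℝ} {p : ℝ≥0∞} (h : MemLocalLp f p) :
    MemLocalLp (fun x => (f x : ℂ)) p := fun K hK =>
  (h K hK).ofReal

theorem MemLocalLp.norm_sq {F : Type} [NormedAddCommGroup F] {f : EuclideanSpace ℝ (Fin n) → F}
    (h : MemLocalLp f ⊤) : MemLocalLp (fun x => ‖f x‖ ^ 2) ⊤ := fun K hK => by
  simp only [sq]
  exact (h K hK).norm.mul' (h K hK).norm

theorem hasWeakDivergence_of_hasWeakPartial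
    {F : EuclideanSpace ℝ (Fin n) → EuclideanSpace ℂ (Fin n)}
    {G : Fin n → EuclideanSpace ℝ (Fin n) → ℂ} (h : ∀ j, HasWeakPartial j (fun x => F x j) (G j)) :
    HasWeakDivergence F (fun x => ∑ j, G j x) := by
  refine ⟨locallyIntegrable_iff.2 fun K hK => Integrable.of_eval_piLp fun j =>
      locallyIntegrable_iff.1 (h j).1 K hK,
    locallyIntegrable_finsetSum _ fun j _ => (h j).2.1, fun φ hφ hφc => ?_⟩
  simp only [Finset.smul_sum]
  rw [integral_finsetSum _ fun j _ => integrable_test_smul (continuous_fderiv_apply_const hφ _)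
      (hφc.fderiv_apply ℝ _) (h j).1,
    integral_finsetSum _ fun j _ => integrable_test_smul hφ.continuous hφc (h j).2.1,
    ← Finset.sum_neg_distrib]
  exact Finset.sum_congr rfl fun j _ => (h j).2.2 φ hφ hφc

theorem hasWeakDivergence_vectorTimes {W : EuclideanSpace ℝ (Fin n) → EuclideanSpace ℝ (Fin n)}
    {dW : Fin n → EuclideanSpace ℝ (Fin n) → ℝ}
    (hdW : ∀ j, HasWeakPartial j (fun x => W x j) (dW j)) (hW2 : MemLocalLp W 2)
    (hdW2 : ∀ j, MemLocalLp (dW j) 2) {f : EuclideanSpace ℝ (Fin n) → ℂ}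
    {g : Fin n → EuclideanSpace ℝ (Fin n) → ℂ} (hf : ∀ j, HasWeakPartial j f (g j))
    (hf2 : MemLocalLp f 2) (hg2 : ∀ j, MemLocalLp (g j) 2) :
    HasWeakDivergence (vectorTimes W f)
      (fun x => ∑ j, ((dW j x : ℂ) * f x + (W x j : ℂ) * g j x)) :=
  hasWeakDivergence_of_hasWeakPartial fun j =>
    (hdW j).ofReal.mul (hW2.coord j).ofReal (hdW2 j).ofReal (hf j) hf2 (hg2 j)

section Decay

variable {E : Type*} [NormedAddCommGroup E]

theorem exists_div_norm_rpow_le_bracket (c : ℝ) {δ μ : ℝ} (hδ : 0 ≤ δ) (hμ : 2 * δ ≤ μ) :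
    ∃ C : ℝ≥0, ∀ x : E, 1 ≤ ‖x‖ → c / ‖x‖ ^ μ ≤ C * (1 + ‖x‖ ^ 2) ^ (-δ) := by
  refine ⟨‖c‖₊ * 2 ^ δ, fun x hx => ?_⟩
  have hdecay := rpow_neg_norm_le_bracket hx (mul_nonneg zero_le_two hδ)
  rw [mul_div_cancel_left₀ δ two_ne_zero] at hdecay
  calc c / ‖x‖ ^ μ ≤ |c| * ‖x‖ ^ (-μ) := by
        rw [Real.rpow_neg (norm_nonneg x), ← div_eq_mul_inv]
        gcongr
        exact le_abs_self c
    _ ≤ |c| * (2 ^ δ * (1 + ‖x‖ ^ 2) ^ (-δ)) := by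
        gcongr
        exact (Real.rpow_le_rpow_of_exponent_le hx (neg_le_neg hμ)).trans hdecay
    _ = (‖c‖₊ * 2 ^ δ : ℝ≥0) * (1 + ‖x‖ ^ 2) ^ (-δ) := by
        push_cast
        rw [Real.norm_eq_abs, mul_assoc]

theorem le_bracket_of_norm_le {x : E} {M R δ : ℝ} (hM : 0 ≤ M) (hδ : 0 ≤ δ) (hx : ‖x‖ ≤ R) :
    M ≤ M * (1 + R ^ 2) ^ δ * (1 + ‖x‖ ^ 2) ^ (-δ) := by
  have hpos := one_add_norm_sq_pos x
  calc M = M * (1 + ‖x‖ ^ 2) ^ δ * (1 + ‖x‖ ^ 2) ^ (-δ) := by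
        rw [mul_assoc, ← Real.rpow_add hpos, add_neg_cancel, Real.rpow_zero, mul_one]
    _ ≤ M * (1 + R ^ 2) ^ δ * (1 + ‖x‖ ^ 2) ^ (-δ) := by gcongr

end Decay

theorem MemLocalLp.exists_norm_le_bracket {F : Type} [NormedAddCommGroup F]
    {f : EuclideanSpace ℝ (Fin n) → F} (hf : MemLocalLp f ⊤) {δ R : ℝ} {C : ℝ≥0} (hδ : 0 ≤ δ)
    (hfar : ∀ᵐ x, R ≤ ‖x‖ → ‖f x‖ ≤ C * (1 + ‖x‖ ^ 2) ^ (-δ)) :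
    ∃ A : ℝ≥0, ∀ᵐ x, ‖f x‖ ≤ A * (1 + ‖x‖ ^ 2) ^ (-δ) := by
  have hball := hf _ (isCompact_closedBall 0 R)
  set M := (eLpNorm f ⊤ (volume.restrict (Metric.closedBall 0 R))).toReal
  have hnear : ∀ᵐ x, x ∈ Metric.closedBall 0 R → ‖f x‖ ≤ M :=
    ae_imp_of_ae_restrict <| (ae_le_eLpNormEssSup (f := f)).mono fun x hx => by
      rw [← toReal_enorm]
      exact ENNReal.toReal_mono hball.2.ne hx
  have hM : 0 ≤ M := ENNReal.toReal_nonneg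
  refine ⟨(M * (1 + R ^ 2) ^ δ).toNNReal + C, ?_⟩
  filter_upwards [hfar, hnear] with x hfar hnear
  rw [NNReal.coe_add, Real.coe_toNNReal _ (by positivity), add_mul]
  rcases le_total R ‖x‖ with hx | hx
  · exact (hfar hx).trans (le_add_of_nonneg_left (by positivity))
  · exact ((hnear (mem_closedBall_zero_iff.2 hx)).trans (le_bracket_of_norm_le hM hδ hx)).trans
      (le_add_of_nonneg_right (by positivity))

/-- The coefficient `i ∇·W - |W|² - V` of `f` in `i ∇·(W f) + i W·∇f - (|W|² + V) f`, where `DW` is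
the Jacobian of `W`. -/
noncomputable def zerothOrderCoefficient (W : EuclideanSpace ℝ (Fin n) → EuclideanSpace ℝ (Fin n))
    (DW : EuclideanSpace ℝ (Fin n) → EuclideanSpace ℝ (Fin n × Fin n))
    (V : EuclideanSpace ℝ (Fin n) → ℝ) (x : EuclideanSpace ℝ (Fin n)) : ℂ :=
  I * (∑ j, (DW x (j, j) : ℂ)) - ((‖W x‖ ^ 2 + V x : ℝ) : ℂ)

/-- The function `i ∇·(W f) + i W·∇f - (|W|² + V) f` of `f ∈ H¹_σ(ℝⁿ)`, with `∇·(W f)` expanded by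
the product rule in terms of the Jacobian `DW` of `W`. -/
noncomputable def perturbationTerm {σ : ℝ}
    (W : EuclideanSpace ℝ (Fin n) → EuclideanSpace ℝ (Fin n))
    (DW : EuclideanSpace ℝ (Fin n) → EuclideanSpace ℝ (Fin n × Fin n))
    (V : EuclideanSpace ℝ (Fin n) → ℝ) (f : WeightedH1 n σ) (x : EuclideanSpace ℝ (Fin n)) : ℂ :=
  I * (∑ j, ((DW x (j, j) : ℂ) * h1Fun f x + (W x j : ℂ) * h1Grad f x j))
    + I * ∑ j, (W x j : ℂ) * h1Grad f x j - ((‖W x‖ ^ 2 + V x : ℝ) : ℂ) * h1Fun f x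

variable {W : EuclideanSpace ℝ (Fin n) → EuclideanSpace ℝ (Fin n)}
  {DW : EuclideanSpace ℝ (Fin n) → EuclideanSpace ℝ (Fin n × Fin n)}
  {V : EuclideanSpace ℝ (Fin n) → ℝ} {p : ℝ≥0∞} {δ : ℝ}

theorem perturbationTerm_eq {σ : ℝ} (f : WeightedH1 n σ) (x : EuclideanSpace ℝ (Fin n)) :
    perturbationTerm W DW V f x = (∑ j, 2 * I * (W x j : ℂ) * h1Grad f x j)
      + zerothOrderCoefficient W DW V x * h1Fun f x := by
  simp only [perturbationTerm, zerothOrderCoefficient, mul_assoc, ← Finset.mul_sum,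
    Finset.sum_add_distrib, ← Finset.sum_mul]
  ring

theorem memLocalLp_zerothOrderCoefficient (hW : MemLocalLp W ⊤) (hDW : MemLocalLp DW p)
    (hV : MemLocalLp V p) : MemLocalLp (zerothOrderCoefficient W DW V) p := fun K hK => by
  have hdiv : MemLp (fun x => ∑ j, (DW x (j, j) : ℂ)) p (volume.restrict K) :=
    memLp_finsetSum _ fun j _ => (hDW.coord (j, j)).ofReal K hK
  have hpot : MemLp (fun x => ((‖W x‖ ^ 2 + V x : ℝ) : ℂ)) p (volume.restrict K) :=
    ((hW.norm_sq.mono_exponent le_top K hK).add (hV K hK)).ofReal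
  exact (hdiv.const_mul I).sub hpot

theorem norm_zerothOrderCoefficient_le (x : EuclideanSpace ℝ (Fin n)) :
    ‖zerothOrderCoefficient W DW V x‖ ≤ n * ‖DW x‖ + (‖W x‖ ^ 2 + |V x|) := by
  have hdiv : ‖∑ j, (DW x (j, j) : ℂ)‖ ≤ n * ‖DW x‖ := by
    have hentry (j : Fin n) : ‖(DW x (j, j) : ℂ)‖ ≤ ‖DW x‖ :=
      (norm_real _).trans_le (PiLp.norm_apply_le (DW x) (j, j))
    simpa using norm_sum_le_of_le Finset.univ fun j _ => hentry j
  have hpot : ‖((‖W x‖ ^ 2 + V x : ℝ) : ℂ)‖ ≤ ‖W x‖ ^ 2 + |V x| := by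
    rw [norm_real, Real.norm_eq_abs]
    exact (abs_add_le _ _).trans_eq (by rw [abs_of_nonneg (sq_nonneg _)])
  refine (norm_sub_le _ _).trans (add_le_add ?_ hpot)
  rwa [norm_mul, norm_I, one_mul]

theorem norm_zerothOrderCoefficient_le_bracket (hδ : 0 ≤ δ) {A C : ℝ≥0}
    {x : EuclideanSpace ℝ (Fin n)} (hA : ‖W x‖ ≤ A * (1 + ‖x‖ ^ 2) ^ (-δ))
    (hV : |V x| ≤ C * (1 + ‖x‖ ^ 2) ^ (-δ)) (hDW : ‖DW x‖ ≤ C * (1 + ‖x‖ ^ 2) ^ (-δ)) :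
    ‖zerothOrderCoefficient W DW V x‖
      ≤ (n * C + (A ^ 2 + C) : ℝ≥0) * (1 + ‖x‖ ^ 2) ^ (-δ) := by
  have hone := bracket_rpow_le_one x (neg_nonpos.2 hδ)
  have hsq : ‖W x‖ ^ 2 ≤ A ^ 2 * (1 + ‖x‖ ^ 2) ^ (-δ) :=
    calc ‖W x‖ ^ 2 ≤ (A * (1 + ‖x‖ ^ 2) ^ (-δ)) ^ 2 := by gcongr
      _ = A ^ 2 * (1 + ‖x‖ ^ 2) ^ (-δ) * (1 + ‖x‖ ^ 2) ^ (-δ) := by ring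
      _ ≤ A ^ 2 * (1 + ‖x‖ ^ 2) ^ (-δ) := mul_le_of_le_one_right (by positivity) hone
  calc ‖zerothOrderCoefficient W DW V x‖ ≤ n * ‖DW x‖ + (‖W x‖ ^ 2 + |V x|) :=
        norm_zerothOrderCoefficient_le x
    _ ≤ n * (C * (1 + ‖x‖ ^ 2) ^ (-δ))
        + (A ^ 2 * (1 + ‖x‖ ^ 2) ^ (-δ) + C * (1 + ‖x‖ ^ 2) ^ (-δ)) := by gcongr
    _ = (n * C + (A ^ 2 + C) : ℝ≥0) * (1 + ‖x‖ ^ 2) ^ (-δ) := by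
        push_cast
        ring

theorem exists_perturbationOperator (hnp : (n = 2 ∧ 2 < p) ∨ (n = 3 ∧ 3 ≤ p)) (hδ : 0 ≤ δ)
    (hW : MemLocalLp W ⊤) (hDW : MemLocalLp DW p) (hV : MemLocalLp V p) {C : ℝ≥0} {R : ℝ}
    (hdecay : ∀ᵐ x, R ≤ ‖x‖ → |V x| ≤ C * (1 + ‖x‖ ^ 2) ^ (-δ) ∧
      ‖W x‖ ≤ C * (1 + ‖x‖ ^ 2) ^ (-δ) ∧ ‖DW x‖ ≤ C * (1 + ‖x‖ ^ 2) ^ (-δ)) :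
    ∃ M : WeightedH1 n (-δ) →L[ℂ] Lp ℂ 2 (volume : Measure (EuclideanSpace ℝ (Fin n))),
      ∀ f, ∀ᵐ x, (((1 + ‖x‖ ^ 2) ^ (-(δ / 2)) : ℝ) : ℂ) * M f x = perturbationTerm W DW V f x := by
  obtain ⟨A, hA⟩ := hW.exists_norm_le_bracket hδ (hdecay.mono fun x hx hR => (hx hR).2.1)
  have hcoeff : ∀ᵐ x, R ≤ ‖x‖ → ‖zerothOrderCoefficient W DW V x‖
      ≤ (n * C + (A ^ 2 + C) : ℝ≥0) * (1 + ‖x‖ ^ 2) ^ (-δ) := by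
    filter_upwards [hdecay, hA] with x hx hxA hR
    exact norm_zerothOrderCoefficient_le_bracket hδ hxA (hx hR).1 (hx hR).2.2
  have hmeas (j : Fin n) : AEStronglyMeasurable fun x => 2 * I * (W x j : ℂ) :=
    (hW.coord j).ofReal.aestronglyMeasurable.const_mul _
  have hfield (j : Fin n) :
      ∀ᵐ x, ‖2 * I * (W x j : ℂ)‖ ≤ (2 * A : ℝ≥0) * (1 + ‖x‖ ^ 2) ^ (-δ) := by
    filter_upwards [hA] with x hx
    rw [norm_mul, norm_mul, norm_I, norm_real, mul_one, Complex.norm_ofNat, NNReal.coe_mul,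
      NNReal.coe_ofNat, mul_assoc]
    gcongr
    exact (PiLp.norm_apply_le (W x) j).trans hx
  obtain ⟨M, hM⟩ := exists_firstOrderOperator hnp (memLocalLp_zerothOrderCoefficient hW hDW hV) hδ
    hcoeff hmeas hfield
  refine ⟨M, fun f => ?_⟩
  filter_upwards [hM f] with x hx
  rw [hx, ← perturbationTerm_eq, ← mul_assoc, ← ofReal_mul, ← Real.rpow_add (one_add_norm_sq_pos x),
    neg_add_cancel, Real.rpow_zero, ofReal_one, one_mul]

theorem isLippmannSchwingerImage_of_perturbationTerm (hp : 2 ≤ p)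
    (hDW : ∀ j l : Fin n, HasWeakPartial j (fun x => W x l) (fun x => DW x (j, l)))
    (hW : MemLocalLp W ⊤) (hDWp : MemLocalLp DW p) {k : ℝ} {f u : WeightedH1 n (-δ)}
    {q : EuclideanSpace ℝ (Fin n) → ℂ} (hq : q =ᵐ[volume] perturbationTerm W DW V f)
    (hu : ∀ᵐ x, Integrable (fun y => outgoingGreen n k ‖x - y‖ * q y) ∧
      h1Fun u x = ∫ y, outgoingGreen n k ‖x - y‖ * q y) :
    IsLippmannSchwingerImage k W V f u := by
  refine ⟨_, hasWeakDivergence_vectorTimes (fun j => hDW j j) (hW.mono_exponent le_top)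
    (fun j => (hDWp.coord (j, j)).mono_exponent hp) f.2 (memLocalLp_h1Fun f)
    (memLocalLp_h1Grad f), ?_⟩
  filter_upwards [hu] with x hx
  have hintegrand : (fun y => outgoingGreen n k ‖x - y‖ * q y)
      =ᵐ[volume] fun y => outgoingGreen n k ‖x - y‖ * perturbationTerm W DW V f y :=
    hq.mono fun y hy => congrArg _ hy
  exact ⟨hx.1.congr hintegrand, hx.2.trans (integral_congr_ae hintegrand)⟩

end LippmannSchwinger

theorem lemma2p2_general {n : ℕ} {p : ℝ≥0∞} (hnp : (n = 2 ∧ 2 < p) ∨ (n = 3 ∧ 3 ≤ p))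
    {W : EuclideanSpace ℝ (Fin n) → EuclideanSpace ℝ (Fin n)}
    {DW : EuclideanSpace ℝ (Fin n) → EuclideanSpace ℝ (Fin n × Fin n)}
    {V : EuclideanSpace ℝ (Fin n) → ℝ}
    (hDW : ∀ j l : Fin n, HasWeakPartial j (fun x => W x l) (fun x => DW x (j, l)))
    (hW : MemLocalLp W ⊤) (hDWp : MemLocalLp DW p) (hV : MemLocalLp V p) {c R μ : ℝ}
    (hdecay : ∀ᵐ x : EuclideanSpace ℝ (Fin n), R ≤ ‖x‖ →
      |V x| ≤ c / ‖x‖ ^ μ ∧ ‖W x‖ ≤ c / ‖x‖ ^ μ ∧ ‖DW x‖ ≤ c / ‖x‖ ^ μ)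
    {δ₀ : ℝ} (hδ₀ : 1 < δ₀) (hμ : 2 * δ₀ ≤ μ) {k : ℝ} (hk : k ≠ 0) :
    ∃ L : WeightedH1 n (-δ₀) →L[ℂ] WeightedH1 n (-δ₀),
      IsCompactOperator L ∧ ∀ f : WeightedH1 n (-δ₀), IsLippmannSchwingerImage k W V f (L f) := by
  have hp : 2 ≤ p := hnp.elim (fun h => h.2.le) fun h => le_trans (by norm_num) h.2
  obtain ⟨C, hC⟩ := exists_div_norm_rpow_le_bracket (E := EuclideanSpace ℝ (Fin n)) c
    (zero_le_one.trans hδ₀.le) hμ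
  obtain ⟨M, hM⟩ := exists_perturbationOperator hnp (zero_le_one.trans hδ₀.le) hW hDWp hV
    (C := C) (R := max R 1) <| by
      filter_upwards [hdecay] with x hx hR
      have hbound := hC x ((le_max_right _ _).trans hR)
      obtain ⟨hVx, hWx, hDWx⟩ := hx ((le_max_left _ _).trans hR)
      exact ⟨hVx.trans hbound, hWx.trans hbound, hDWx.trans hbound⟩
  obtain ⟨T, hT, hTψ⟩ := exists_isCompactOperator_outgoingGreen (hnp.imp And.left And.left) hk hδ₀
  exact ⟨T.comp M, hT.comp_clm M, fun f =>
    isLippmannSchwingerImage_of_perturbationTerm hp hDW hW hDWp (hM f) (hTψ (M f))⟩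

theorem lemma2p2 (n : ℕ) (p : ℝ≥0∞) (hnp : (n = 2 ∧ 2 < p) ∨ (n = 3 ∧ 3 ≤ p))
    (δ μ : ℝ) (hδ : ((n : ℝ) + 1) / 2 - n * (p⁻¹).toReal < δ) (hμ : 2 < μ)
    (W : EuclideanSpace ℝ (Fin n) → EuclideanSpace ℝ (Fin n))
    (DW : EuclideanSpace ℝ (Fin n) → EuclideanSpace ℝ (Fin n × Fin n))
    (V : EuclideanSpace ℝ (Fin n) → ℝ)
    (hDW : ∀ j l : Fin n, HasWeakPartial j (fun x => W x l) (fun x => DW x (j, l)))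
    (hW : MemWeightedLp W ⊤ δ) (hDWp : MemWeightedLp DW p δ) (hV : MemLocalLp V p)
    (hdecay : ∃ c R : ℝ, ∀ᵐ x : EuclideanSpace ℝ (Fin n), R ≤ ‖x‖ →
      |V x| ≤ c / ‖x‖ ^ μ ∧ ‖W x‖ ≤ c / ‖x‖ ^ μ ∧ ‖DW x‖ ≤ c / ‖x‖ ^ μ) :
    ∃ δ₀ : ℝ, 1 / 2 < δ₀ ∧ ∀ k : ℝ, k ≠ 0 →
      ∃ L : WeightedH1 n (-δ₀) →L[ℂ] WeightedH1 n (-δ₀),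
        IsCompactOperator L ∧ ∀ f : WeightedH1 n (-δ₀), IsLippmannSchwingerImage k W V f (L f) := by
  obtain ⟨c, R, hcR⟩ := hdecay
  exact ⟨μ / 2, by linarith, fun k hk => lemma2p2_general hnp hDW hW.memLocalLp hDWp.memLocalLp hV
    hcR (by linarith) (mul_div_cancel₀ μ two_ne_zero).le hk⟩
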